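/- Let $w\in H^{1/2}(\mathbb{R}^3)$ be a radial positive ground state of the $L^2$-critical boson star equation, i.e. $w=w(|x|)>0$ and, in the sense of distributions, $$\sqrt{-\Delta}\,w-\bigl(|x|^{-1}*|w|^2\bigr)w=-w\quad\text{in }\mathbb{R}^3 .$$ Put $e:=\int_{\mathbb{R}^3}|y|^{-1}|w(y)|^2\,dy-1$ and, for $x\neq 0$, $$\Phi_u(x):=\int_{|y|<|x|}\bigl(|y|^{-1}-|x|^{-1}\bigr)|u(y)|^2\,dy ,\qquad \Phi_u(0):=0 .$$ Then $e>0$, and the rescaled function $u(x):=e^{-3/2}w(e^{-1}x)$ (here $e^{-3/2}$ and $e^{-1}$ are powers of the number $e$) satisfies $\sqrt{-\Delta}\,u+(\Phi_u-1)u=0$ in the sense of distributions. Let $$U(x,t):=(\mathcal P_t*u)(x),\qquad \mathcal P_t(z)=\frac{t}{\pi^2(t^2+|z|^2)^2},$$ be the harmonic extension of $u$ to $\mathbb{R}^4_+=\{(x,t):x\in\mathbb{R}^3,\ t>0\}$. Then $U\in H^1(\mathbb{R}^4_+)$. For complex-valued $\psi\in H^1(\mathbb{R}^4_+)$, with boundary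 trace $\psi(\cdot,0)\in L^2(\mathbb{R}^3)$, the quadratic form $$\mathcal A_u[\psi]:=\iint_{\mathbb{R}^4_+}|\nabla_{(x,t)}\psi|^2\,dx\,dt+\int_{\mathbb{R}^3}(\Phi_u-1)\,|\psi(x,0)|^2\,dx$$ is well defined (the trace exists and both integrals converge absolutely), and $$\mathcal A_u[\psi]\ge 0\qquad\text{for all }\psi\in H^1(\mathbb{R}^4_+).$$ Moreover, $\mathcal A_u[\psi]=0$ if and only if $\psi\equiv\lambda U$ (almost everywhere) for some constant $\lambda\in\mathbb{C}$. -/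

import Mathlib

open MeasureTheory
open scoped FourierTransform SchwartzMap ContDiff

namespace BosonStar

/-- Euclidean space `ℝ³`. -/
abbrev E3 : Type := EuclideanSpace ℝ (Fin 3)

noncomputable section

/-! ### The boson star equation on `ℝ³` -/

/-- `√(-Δ) φ` for a Schwartz function `φ`: the Fourier multiplier with symbol `|ξ|`. The Fourier
transform of Mathlib is normalised with `exp (-2πi x·ξ)`, so that the symbol reads `2π|ξ|`. -/
def sqrtLaplacian (φ : 𝓢(E3, ℂ)) : E3 → ℂ :=
  𝓕⁻ (fun ξ : E3 => ((2 * Real.pi * ‖ξ‖ : ℝ) : ℂ) * 𝓕 (φ : E3 → ℂ) ξ)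

/-- The convolution `(|x|⁻¹ ∗ |w|²)(x)`. -/
def newtonPotential (w : E3 → ℝ) (x : E3) : ℝ :=
  ∫ y, ‖x - y‖⁻¹ * |w y| ^ 2

/-- `w` is a ground state: a nonnegative, nonzero function in `H^{1/2}(ℝ³)` which solves
`√(-Δ) w - (|x|⁻¹ ∗ |w|²) w = -w` in the sense of (tempered) distributions. -/
structure IsGroundState (w : E3 → ℝ) : Prop where
  memLp : MemLp (fun x => (w x : ℂ)) 2 volume
  memSobolev : TemperedDistribution.MemSobolev (1 / 2) 2 (memLp.toLp : 𝓢'(E3, ℂ))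
  nonneg : ∀ᵐ x, 0 ≤ w x
  ne_zero : ¬ ∀ᵐ x, w x = 0
  equation : ∀ φ : 𝓢(E3, ℂ),
    (∫ x, (w x : ℂ) * sqrtLaplacian φ x) - ∫ x, ((newtonPotential w x * w x : ℝ) : ℂ) * φ x
      = -∫ x, (w x : ℂ) * φ x

/-- `w` is (almost everywhere) a function of `|x|`. -/
def IsRadial (w : E3 → ℝ) : Prop :=
  ∃ g : ℝ → ℝ, ∀ᵐ x, w x = g ‖x‖

/-- `Φ_u(x) = ∫_{|y| < |x|} (|y|⁻¹ - |x|⁻¹) |u(y)|² dy`. -/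
def Phi (u : E3 → ℝ) (x : E3) : ℝ :=
  ∫ y in {y : E3 | ‖y‖ < ‖x‖}, (‖y‖⁻¹ - ‖x‖⁻¹) * |u y| ^ 2

/-- The number `e = ∫ |w(y)|² / |y| dy - 1`. -/
def scale (w : E3 → ℝ) : ℝ :=
  (∫ y, ‖y‖⁻¹ * |w y| ^ 2) - 1

/-- The rescaled function `e^{-3/2} w(e⁻¹ x)`. -/
def rescale (e : ℝ) (w : E3 → ℝ) (x : E3) : ℝ :=
  e ^ (-(3 / 2) : ℝ) * w (e⁻¹ • x)

/-- `√(-Δ) u + (Φ_u - 1) u = 0` in the sense of (tempered) distributions. -/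
def SolvesNormalized (u : E3 → ℝ) : Prop :=
  ∀ φ : 𝓢(E3, ℂ),
    (∫ x, (u x : ℂ) * sqrtLaplacian φ x) + ∫ x, (((Phi u x - 1) * u x : ℝ) : ℂ) * φ x = 0

/-! ### The half-space -/

/-- The open half-space `ℝ⁴₊ = ℝ³ × (0, ∞)`, with points `(x, t)`. -/
def halfSpace : Set (E3 × ℝ) := {p | 0 < p.2}

/-- Lebesgue measure `dx dt` on the half-space. -/
def halfVolume : Measure (E3 × ℝ) := volume.restrict halfSpace

/-- The Poisson kernel `𝒫_t(z) = π⁻² t / (t² + |z|²)²` in three dimensions. -/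
def poissonKernel (t : ℝ) (z : E3) : ℝ :=
  t / (Real.pi ^ 2 * (t ^ 2 + ‖z‖ ^ 2) ^ 2)

/-- The harmonic extension `U(x, t) = (𝒫_t ∗ u)(x)`; only its values for `t > 0` matter. -/
def harmonicExtension (u : E3 → ℝ) (p : E3 × ℝ) : ℝ :=
  ∫ y, poissonKernel p.2 (p.1 - y) * u y

/-- `g` is the weak derivative of `ψ` in the direction `v` on the open half-space. -/
def IsWeakDeriv (v : E3 × ℝ) (ψ g : E3 × ℝ → ℂ) : Prop :=
  ∀ φ : E3 × ℝ → ℝ, ContDiff ℝ ∞ φ → HasCompactSupport φ → tsupport φ ⊆ halfSpace →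
    ∫ p, fderiv ℝ φ p v • ψ p ∂halfVolume = -∫ p, φ p • g p ∂halfVolume

/-- `ψ ∈ H¹(ℝ⁴₊)`: `ψ` and all its first order weak derivatives are square integrable. -/
def MemH1 (ψ : E3 × ℝ → ℂ) : Prop :=
  MemLp ψ 2 halfVolume ∧ ∀ v : E3 × ℝ, ∃ g, MemLp g 2 halfVolume ∧ IsWeakDeriv v ψ g

/-- The square integrable weak derivative of `ψ` in the direction `v`
(unique almost everywhere on the half-space; it exists for `ψ ∈ H¹`). -/
def weakDeriv (v : E3 × ℝ) (ψ : E3 × ℝ → ℂ) : E3 × ℝ → ℂ :=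
  Classical.epsilon fun g => MemLp g 2 halfVolume ∧ IsWeakDeriv v ψ g

/-- `|∇_{(x,t)} ψ|²`. -/
def gradSq (ψ : E3 × ℝ → ℂ) (p : E3 × ℝ) : ℝ :=
  (∑ i : Fin 3, ‖weakDeriv (EuclideanSpace.single i (1 : ℝ), 0) ψ p‖ ^ 2)
    + ‖weakDeriv (0, 1) ψ p‖ ^ 2

/-- `f ∈ L²(ℝ³)` is the boundary trace of `ψ ∈ H¹(ℝ⁴₊)`: integration by parts in `t` against
test functions that need not vanish at `t = 0` produces the boundary term `-∫ φ(x,0) f(x) dx`. -/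
def IsTrace (ψ : E3 × ℝ → ℂ) (f : E3 → ℂ) : Prop :=
  MemLp f 2 volume ∧
  ∀ φ : E3 × ℝ → ℝ, ContDiff ℝ ∞ φ → HasCompactSupport φ →
    (∫ p, fderiv ℝ φ p (0, 1) • ψ p ∂halfVolume) + ∫ p, φ p • weakDeriv (0, 1) ψ p ∂halfVolume
      = -∫ x, φ (x, 0) • f x

/-- The boundary trace `x ↦ ψ(x, 0)` (unique almost everywhere). -/
def trace (ψ : E3 × ℝ → ℂ) : E3 → ℂ :=
  Classical.epsilon fun f => IsTrace ψ f

/-- The quadratic form `𝒜_u[ψ] = ∬ |∇ψ|² dx dt + ∫ (Φ_u - 1) |ψ(x,0)|² dx`. -/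
def quadForm (u : E3 → ℝ) (ψ : E3 × ℝ → ℂ) : ℝ :=
  (∫ p, gradSq ψ p ∂halfVolume) + ∫ x, (Phi u x - 1) * ‖trace ψ x‖ ^ 2

end

end BosonStar

/-! Write `V(x) = ∫ min(|x|⁻¹, |y|⁻¹) |u(y)|² dy` (`potential`) and `κ = ∫ |y|⁻¹ |u(y)|² dy - 1`
(`gap`), so that `Φ_u - 1 = κ - V` almost everywhere.

*The normalised equation.* Kato's inequality (`kato`) makes `∫ |w|² / |y|` finite. By Newton's theorem
(`lintegral_newton`) the potential `|x|⁻¹ ∗ |w|²` of the radial density `|w|²` is the `V` of `w`,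
which is bounded by its value `e + 1` at the origin. Testing the equation with `w` then gives
`e > 0` (`IsGroundState.one_lt_centralPotential`), since `⟨w, √(-Δ) w⟩ > 0`. Rescaling by `e` yields
`√(-Δ) u = (V - κ) u` with `κ = 1 / e > 0`, that is, `u = (√(-Δ) + κ)⁻¹ (V u)`
(`IsPositiveSolution.isFourierPair_resolventSymbol`).

*Completing the square.* Harmonic extensions are handled as superpositions `synth c` of the
exponentials `exp (2πi x·ξ - 2πt|ξ|)`, and every norm and pairing is computed by Plancherel's theorem
and integration by parts on the half-space. Let `f` be the trace of `ψ ∈ H¹`, put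
`a = (√(-Δ) + κ)⁻¹ (V f)`, and let `Θ` be the harmonic extension of `a`. It lies in `H¹`: near
frequency zero, `‖Θ‖² = ∫ |â|² / (4π|ξ|)` is controlled by Kato's inequality with the roles of `x` and
`ξ` exchanged (`kato_dual`), as `V` decays like `|x|⁻¹`. The Dirichlet form of `ψ` against `Θ` is
`⟨√(-Δ) a, f⟩` (`sum_integral_conj_synth`), and therefore (`IsPositiveSolution.quadForm_eq`)

`𝒜_u[ψ] = ∬ |∇(ψ - Θ)|² + κ ∫ |f - a|² + (∫ V |f|² - ⟨V f, (√(-Δ) + κ)⁻¹ V f⟩)`.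

*The ground state substitution.* The last bracket is nonnegative by Schur's test. The resolvent
`∫₀^∞ e^{-κs} e^{-s√(-Δ)} ds` is an integral operator with the positive kernel
`k(x, y) = ∫₀^∞ e^{-κs} 𝒫_s(x - y) ds`, and `∫ k(x, y) V(y) u(y) dy = u(x)`. With `f = η u`, the
bracket is (`IsPositiveSolution.integral_kernel_mul_sq_sub`)

`½ ∬ k(x, y) V(x) u(x) V(y) u(y) |η(x) - η(y)|² dx dy`.

If `𝒜_u[ψ] = 0`, all three terms vanish. Thus `η` is a constant `l`, so that `f = l u = a` and
`Θ = l U`; and `ψ - Θ`, a square integrable function without gradient, is zero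
(`ae_eq_zero_of_isWeakDeriv_zero`). Conversely all three terms vanish for `ψ = l U`.
-/

namespace BosonStar

open Set Filter Topology ComplexConjugate

/-! ### The Fourier transform on `L²(ℝ³)` -/

/-- `F` is the `L²` Fourier transform of `f`. -/
def IsFourierPair (f F : E3 → ℂ) : Prop :=
  ∃ (hf : MemLp f 2 volume) (hF : MemLp F 2 volume), 𝓕 (hf.toLp f) = hF.toLp F

namespace IsFourierPair

variable {f g F G : E3 → ℂ}

theorem memLp_left (h : IsFourierPair f F) : MemLp f 2 volume := h.1

theorem memLp_right (h : IsFourierPair f F) : MemLp F 2 volume := h.2.1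

theorem exists_right (hf : MemLp f 2 volume) :
    ∃ F, StronglyMeasurable F ∧ IsFourierPair f F :=
  ⟨_, Lp.stronglyMeasurable _, hf, Lp.memLp (𝓕 (hf.toLp f)), by simp⟩

theorem exists_left (hF : MemLp F 2 volume) : ∃ f, IsFourierPair f F :=
  ⟨_, Lp.memLp (𝓕⁻ (hF.toLp F)), hF, by simp⟩

theorem congr {f' F' : E3 → ℂ} (h : IsFourierPair f F) (hf : f =ᵐ[volume] f')
    (hF : F =ᵐ[volume] F') : IsFourierPair f' F' := by
  obtain ⟨h1, h2, h3⟩ := h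
  refine ⟨(memLp_congr_ae hf).1 h1, (memLp_congr_ae hF).1 h2, ?_⟩
  rw [← MemLp.toLp_congr h1 _ hf, ← MemLp.toLp_congr h2 _ hF, h3]

theorem right_unique {f' : E3 → ℂ} (h : IsFourierPair f F) (h' : IsFourierPair f' G)
    (hf : f =ᵐ[volume] f') : F =ᵐ[volume] G := by
  obtain ⟨h1, h2, h3⟩ := h
  obtain ⟨h1', h2', h3'⟩ := h'
  rw [← MemLp.toLp_eq_toLp_iff h2 h2', ← h3, ← h3', MemLp.toLp_congr h1 h1' hf]

theorem left_unique {F' : E3 → ℂ} (h : IsFourierPair f F) (h' : IsFourierPair g F')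
    (hF : F =ᵐ[volume] F') : f =ᵐ[volume] g := by
  obtain ⟨h1, h2, h3⟩ := h
  obtain ⟨h1', h2', h3'⟩ := h'
  rw [← MemLp.toLp_eq_toLp_iff h1 h1']
  have := congrArg (fun z : Lp ℂ 2 (volume : Measure E3) => 𝓕⁻ z)
    (h3.trans ((MemLp.toLp_congr h2 h2' hF).trans h3'.symm))
  simpa using this

theorem const_mul (h : IsFourierPair f F) (c : ℂ) :
    IsFourierPair (fun x => c * f x) (fun x => c * F x) := by
  obtain ⟨h1, h2, h3⟩ := h
  refine ⟨h1.const_mul c, h2.const_mul c, ?_⟩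
  have e1 : (h1.const_mul c).toLp (fun x => c * f x) = c • h1.toLp f :=
    (MemLp.toLp_const_smul c h1)
  have e2 : (h2.const_mul c).toLp (fun x => c * F x) = c • h2.toLp F :=
    (MemLp.toLp_const_smul c h2)
  rw [e1, e2, FourierTransform.fourier_smul, h3]

theorem add (h : IsFourierPair f F) (h' : IsFourierPair g G) :
    IsFourierPair (fun x => f x + g x) (fun x => F x + G x) := by
  obtain ⟨h1, h2, h3⟩ := h
  obtain ⟨h1', h2', h3'⟩ := h'
  refine ⟨h1.add h1', h2.add h2', ?_⟩
  have e1 : (h1.add h1').toLp (fun x => f x + g x) = h1.toLp f + h1'.toLp g :=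
    MemLp.toLp_add h1 h1'
  have e2 : (h2.add h2').toLp (fun x => F x + G x) = h2.toLp F + h2'.toLp G :=
    MemLp.toLp_add h2 h2'
  rw [e1, e2, FourierTransform.fourier_add, h3, h3']

/-- Plancherel's theorem in polarised form. -/
theorem integral_conj_mul (h : IsFourierPair f F) (h' : IsFourierPair g G) :
    ∫ x, conj (f x) * g x = ∫ ξ, conj (F ξ) * G ξ := by
  obtain ⟨h1, h2, h3⟩ := h
  obtain ⟨h1', h2', h3'⟩ := h'
  have key := Lp.inner_fourier_eq (h1.toLp f) (h1'.toLp g)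
  rw [h3, h3', L2.inner_def, L2.inner_def] at key
  have a1 : ∫ x, conj (f x) * g x = ∫ x, inner ℂ (h1.toLp f x) (h1'.toLp g x) := by
    refine integral_congr_ae ?_
    filter_upwards [h1.coeFn_toLp, h1'.coeFn_toLp] with x hx hx'
    rw [hx, hx', RCLike.inner_apply']; 
  have a2 : ∫ x, conj (F x) * G x = ∫ x, inner ℂ (h2.toLp F x) (h2'.toLp G x) := by
    refine integral_congr_ae ?_
    filter_upwards [h2.coeFn_toLp, h2'.coeFn_toLp] with x hx hx'
    rw [hx, hx', RCLike.inner_apply']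
  rw [a1, a2, key]

theorem lintegral_enorm_sq (h : IsFourierPair f F) :
    ∫⁻ x, ‖f x‖ₑ ^ 2 = ∫⁻ ξ, ‖F ξ‖ₑ ^ 2 := by
  obtain ⟨h1, h2, h3⟩ := h
  have key := Lp.norm_fourier_eq (h1.toLp f)
  rw [h3, Lp.norm_toLp, Lp.norm_toLp,
    ENNReal.toReal_eq_toReal_iff' h2.eLpNorm_ne_top h1.eLpNorm_ne_top] at key
  have e : ∀ u : E3 → ℂ, eLpNorm u 2 volume ^ (2 : ℕ) = ∫⁻ x, ‖u x‖ₑ ^ 2 := fun u => by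
    have := eLpNorm_nnreal_pow_eq_lintegral (f := u) (μ := (volume : Measure E3)) (p := 2)
      (by norm_num)
    simpa using this
  rw [← e, ← e, key]

end IsFourierPair

theorem integral_fourier_mul {f : E3 → ℂ} (hf : Integrable f) {g : E3 → ℂ} (hg : Integrable g) :
    ∫ ξ, 𝓕 f ξ * g ξ = ∫ x, f x * 𝓕 g x := by
  have := VectorFourier.integral_fourierIntegral_smul_eq_flip (L := innerₗ E3)
    (μ := (volume : Measure E3)) (ν := (volume : Measure E3))
    Real.continuous_fourierChar continuous_inner hf hg
  rw [flip_innerₗ] at this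
  exact this

theorem integral_fourierInv_mul {f : E3 → ℂ} (hf : Integrable f) {g : E3 → ℂ}
    (hg : Integrable g) : ∫ ξ, 𝓕⁻ f ξ * g ξ = ∫ x, f x * 𝓕⁻ g x := by
  have h1 : 𝓕⁻ f = 𝓕 (fun x => f (-x)) := Real.fourierInv_eq_fourier_comp_neg f
  have h2 : 𝓕⁻ g = fun x => 𝓕 g (-x) := by
    ext x; rw [Real.fourierInv_eq_fourier_neg]
  rw [h1, integral_fourier_mul hf.comp_neg hg, h2,
    ← integral_neg_eq_self (fun x => f x * 𝓕 g (-x))]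
  simp

theorem integral_schwartz_mul_eq_imp_ae_eq {f g : E3 → ℂ} (hf : LocallyIntegrable f)
    (hg : LocallyIntegrable g)
    (h : ∀ φ : 𝓢(E3, ℂ), ∫ x, φ x * f x = ∫ x, φ x * g x) : f =ᵐ[volume] g := by
  refine ae_eq_of_integral_contDiff_smul_eq hf hg fun φ hφ hc => ?_
  have hφ' : ContDiff ℝ ∞ (fun x => (φ x : ℂ)) := Complex.ofRealCLM.contDiff.comp hφ
  have hc' : HasCompactSupport (fun x => (φ x : ℂ)) := hc.comp_left (g := fun r : ℝ => (r : ℂ)) rfl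
  simpa using h (hc'.toSchwartzMap hφ')

theorem isFourierPair_fourier {f : E3 → ℂ} (hf : Integrable f) (hf2 : MemLp f 2 volume) :
    IsFourierPair f (𝓕 f) := by
  have key : 𝓕 f =ᵐ[volume] (𝓕 (hf2.toLp f) : Lp ℂ 2 (volume : Measure E3)) := by
    refine integral_schwartz_mul_eq_imp_ae_eq ?_ ?_ fun φ => ?_
    · exact (VectorFourier.fourierIntegral_continuous Real.continuous_fourierChar
        continuous_inner hf : Continuous (𝓕 f)).locallyIntegrable
    · exact (Lp.memLp _).locallyIntegrable (by norm_num)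
    have h := congrArg (fun T : 𝓢'(E3, ℂ) => T φ)
      (Lp.fourier_toTemperedDistribution_eq (hf2.toLp f))
    simp only [TemperedDistribution.fourier_apply, Lp.toTemperedDistribution_apply] at h
    simp only [smul_eq_mul] at h
    rw [← h]
    have : ∫ x, (𝓕 φ) x * (hf2.toLp f) x = ∫ x, (𝓕 φ) x * f x := by
      refine integral_congr_ae ?_
      filter_upwards [hf2.coeFn_toLp] with x hx
      rw [hx]
    rw [this, SchwartzMap.fourier_coe, integral_fourier_mul φ.integrable hf]
  have : IsFourierPair f _ := ⟨hf2, Lp.memLp (𝓕 (hf2.toLp f)), by simp⟩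
  exact IsFourierPair.congr this (Filter.EventuallyEq.refl _ _) key.symm

theorem isFourierPair_fourierInv {F : E3 → ℂ} (hf : Integrable F) (hf2 : MemLp F 2 volume) :
    IsFourierPair (𝓕⁻ F) F := by
  have key : 𝓕⁻ F =ᵐ[volume] (𝓕⁻ (hf2.toLp F) : Lp ℂ 2 (volume : Measure E3)) := by
    refine integral_schwartz_mul_eq_imp_ae_eq ?_ ?_ fun φ => ?_
    · have : 𝓕⁻ F = fun x => 𝓕 F (-x) := by
        ext x; rw [Real.fourierInv_eq_fourier_neg]
      rw [this]
      exact ((VectorFourier.fourierIntegral_continuous Real.continuous_fourierChar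
        continuous_inner hf : Continuous (𝓕 F)).comp continuous_neg).locallyIntegrable
    · exact (Lp.memLp _).locallyIntegrable (by norm_num)
    have h := congrArg (fun T : 𝓢'(E3, ℂ) => T φ)
      (Lp.fourierInv_toTemperedDistribution_eq (hf2.toLp F))
    simp only [TemperedDistribution.fourierInv_apply, Lp.toTemperedDistribution_apply] at h
    simp only [smul_eq_mul] at h
    rw [← h]
    have : ∫ x, (𝓕⁻ φ) x * (hf2.toLp F) x = ∫ x, (𝓕⁻ φ) x * F x := by
      refine integral_congr_ae ?_
      filter_upwards [hf2.coeFn_toLp] with x hx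
      rw [hx]
    rw [this, SchwartzMap.fourierInv_coe, integral_fourierInv_mul φ.integrable hf]
  have : IsFourierPair _ F := ⟨Lp.memLp (𝓕⁻ (hf2.toLp F)), hf2, by simp⟩
  exact IsFourierPair.congr this key.symm (Filter.EventuallyEq.refl _ _)

theorem memLp_two_of_integrable_of_bound {f : E3 → ℂ} (hf : Integrable f) {C : ℝ}
    (hC : ∀ x, ‖f x‖ ≤ C) : MemLp f 2 volume := by
  rw [memLp_two_iff_integrable_sq_norm hf.aestronglyMeasurable]
  refine (hf.norm.const_mul C).mono' (hf.aestronglyMeasurable.norm.pow 2) ?_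
  filter_upwards with x
  rw [Real.norm_of_nonneg (by positivity), pow_two]
  exact mul_le_mul_of_nonneg_right (hC x) (norm_nonneg _)

theorem isFourierPair_schwartz (φ : 𝓢(E3, ℂ)) : IsFourierPair φ (𝓕 (φ : E3 → ℂ)) :=
  isFourierPair_fourier φ.integrable (φ.memLp 2)

theorem isFourierPair_sqrtLaplacian (φ : 𝓢(E3, ℂ)) :
    IsFourierPair (sqrtLaplacian φ)
      (fun ξ => ((2 * Real.pi * ‖ξ‖ : ℝ) : ℂ) * 𝓕 (φ : E3 → ℂ) ξ) := by
  have hm : AEStronglyMeasurable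
      (fun ξ : E3 => ((2 * Real.pi * ‖ξ‖ : ℝ) : ℂ) * 𝓕 (φ : E3 → ℂ) ξ) volume := by
    rw [← SchwartzMap.fourier_coe]
    exact (Continuous.mul (by fun_prop) (𝓕 φ).continuous).aestronglyMeasurable
  have hi : Integrable (fun ξ : E3 => ((2 * Real.pi * ‖ξ‖ : ℝ) : ℂ) * 𝓕 (φ : E3 → ℂ) ξ) := by
    have := ((𝓕 φ).integrable_pow_mul volume 1).const_mul (2 * Real.pi)
    refine this.mono' hm (Filter.Eventually.of_forall fun ξ => ?_)
    rw [norm_mul, Complex.norm_real, Real.norm_of_nonneg (by positivity),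
      ← SchwartzMap.fourier_coe, pow_one, mul_assoc]
  obtain ⟨C, hC⟩ := (𝓕 φ).decay 1 0
  refine isFourierPair_fourierInv hi (memLp_two_of_integrable_of_bound hi
    (C := 2 * Real.pi * C) fun ξ => ?_)
  rw [norm_mul, Complex.norm_real, Real.norm_of_nonneg (by positivity),
    ← SchwartzMap.fourier_coe, mul_assoc]
  have := hC.2 ξ
  simp only [pow_one, norm_iteratedFDeriv_zero] at this
  gcongr

/-! ### The Poisson kernel as a Fourier transform -/

theorem integrableOn_pow_mul_exp_neg {a : ℝ} (ha : 0 < a) (n : ℕ) :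
    IntegrableOn (fun y : ℝ => y ^ n * Real.exp (-a * y)) (Ioi 0) := by
  have h := integrableOn_rpow_mul_exp_neg_mul_rpow (s := n) (p := 1) (b := a)
    (by have : (0 : ℝ) ≤ n := n.cast_nonneg
        linarith) one_pos ha
  refine h.congr_fun (fun y _ => ?_) measurableSet_Ioi
  simp only [Real.rpow_natCast, Real.rpow_one]

theorem integrable_norm_pow_mul_exp_neg {a : ℝ} (ha : 0 < a) (n : ℕ) :
    Integrable (fun ξ : E3 => ‖ξ‖ ^ n * Real.exp (-a * ‖ξ‖)) := by
  refine (integrable_fun_norm_addHaar (μ := (volume : Measure E3))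
    (f := fun y : ℝ => y ^ n * Real.exp (-a * y))).2 ?_
  refine (integrableOn_pow_mul_exp_neg ha (n + 2)).congr_fun (fun y _ => ?_) measurableSet_Ioi
  simp [E3]
  ring

theorem integrable_exp_neg_norm {a : ℝ} (ha : 0 < a) :
    Integrable (fun ξ : E3 => Real.exp (-a * ‖ξ‖)) := by
  simpa using integrable_norm_pow_mul_exp_neg ha 0

/-- The map `y ↦ y - c / y` is a bijection of `(0, ∞)` onto `ℝ`; adding the pull-backs of the
Gaussian along it and along its composition with `y ↦ c / y` gives the Cauchy–Schlömilch
substitution. -/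
theorem integral_exp_neg_sub_div_sq {c : ℝ} (hc : 0 < c) :
    ∫ y in Ioi (0 : ℝ), Real.exp (-(y - c / y) ^ 2) = √Real.pi / 2 := by
  have hinv : ∀ y ∈ Ioi (0 : ℝ), HasDerivWithinAt (fun y => c / y) (-(c / y ^ 2)) (Ioi 0) y := by
    intro y hy
    have := ((hasDerivAt_inv (ne_of_gt hy)).const_mul c).hasDerivWithinAt (s := Ioi 0)
    refine this.congr_deriv ?_ |>.congr (fun z _ => div_eq_mul_inv _ _) (div_eq_mul_inv _ _)
    ring
  have hder : ∀ y ∈ Ioi (0 : ℝ),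
      HasDerivWithinAt (fun y => y - c / y) (1 + c / y ^ 2) (Ioi 0) y := by
    intro y hy
    refine ((hasDerivWithinAt_id y _).sub (hinv y hy)).congr_deriv ?_
    ring
  have hmono : StrictMonoOn (fun y : ℝ => y - c / y) (Ioi 0) := by
    intro a ha b hb hab
    have := div_lt_div_of_pos_left hc ha hab
    simp only
    linarith
  have himg : (fun y : ℝ => y - c / y) '' Ioi 0 = univ := by
    refine eq_univ_of_forall fun z => ?_
    -- the positive root of `y ^ 2 - z * y - c = 0`
    refine ⟨(z + √(z ^ 2 + 4 * c)) / 2, ?_, ?_⟩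
    · have : |z| < √(z ^ 2 + 4 * c) := by
        rw [← Real.sqrt_sq_eq_abs]
        exact Real.sqrt_lt_sqrt (sq_nonneg _) (by linarith)
      have := neg_abs_le z
      rw [mem_Ioi]
      linarith
    · have h1 : |z| < √(z ^ 2 + 4 * c) := by
        rw [← Real.sqrt_sq_eq_abs]
        exact Real.sqrt_lt_sqrt (sq_nonneg _) (by linarith)
      have h2 := neg_abs_le z
      have h3 : (z + √(z ^ 2 + 4 * c)) / 2 ≠ 0 := by
        have : 0 < z + √(z ^ 2 + 4 * c) := by linarith
        positivity
      have h4 : √(z ^ 2 + 4 * c) ^ 2 = z ^ 2 + 4 * c := Real.sq_sqrt (by positivity)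
      simp only
      rw [sub_eq_iff_eq_add, ← sub_eq_iff_eq_add', eq_div_iff h3]
      nlinarith
  have hG : Integrable (fun z : ℝ => Real.exp (-z ^ 2)) := by
    simpa using integrable_exp_neg_mul_sq one_pos
  have hGi : ∫ z : ℝ, Real.exp (-z ^ 2) = √Real.pi := by
    simpa using integral_gaussian 1
  have hI := (integrableOn_image_iff_integrableOn_abs_deriv_smul measurableSet_Ioi hder
    hmono.injOn (fun z => Real.exp (-z ^ 2))).1 (by rw [himg]; exact hG.integrableOn)
  have hE := integral_image_eq_integral_abs_deriv_smul measurableSet_Ioi hder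
    hmono.injOn (fun z => Real.exp (-z ^ 2))
  rw [himg, setIntegral_univ, hGi] at hE
  have habs : ∀ y : ℝ, |1 + c / y ^ 2| = 1 + c / y ^ 2 := fun y => abs_of_nonneg (by positivity)
  simp only [habs, smul_eq_mul] at hI hE
  have hinj : InjOn (fun y : ℝ => c / y) (Ioi 0) := by
    intro a ha b hb hab
    have ha' := ne_of_gt (mem_Ioi.1 ha)
    have hb' := ne_of_gt (mem_Ioi.1 hb)
    simp only at hab
    field_simp at hab
    exact hab.symm
  have himg2 : (fun y : ℝ => c / y) '' Ioi 0 = Ioi 0 := by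
    ext z
    constructor
    · rintro ⟨y, hy, rfl⟩
      exact div_pos hc hy
    · intro hz
      refine ⟨c / z, div_pos hc hz, ?_⟩
      have := ne_of_gt (mem_Ioi.1 hz)
      field_simp
  -- the involution `y ↦ c / y` exchanges the two halves of the weight `1 + c / y²`
  have hE2 := integral_image_eq_integral_abs_deriv_smul measurableSet_Ioi hinv
    hinj (fun z => Real.exp (-(z - c / z) ^ 2))
  rw [himg2] at hE2
  have hE3 : ∫ y in Ioi (0 : ℝ), Real.exp (-(y - c / y) ^ 2)
      = ∫ y in Ioi (0 : ℝ), c / y ^ 2 * Real.exp (-(y - c / y) ^ 2) := by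
    rw [hE2]
    refine setIntegral_congr_fun measurableSet_Ioi fun y hy => ?_
    have hy' := ne_of_gt (mem_Ioi.1 hy)
    have : c / (c / y) = y := by field_simp
    simp only [abs_neg, smul_eq_mul, this]
    rw [abs_of_nonneg (by positivity)]
    congr 2
    ring
  have hmeas : AEStronglyMeasurable (fun y : ℝ => Real.exp (-(y - c / y) ^ 2))
      (volume.restrict (Ioi 0)) := by
    apply Measurable.aestronglyMeasurable
    fun_prop
  have hI1 : IntegrableOn (fun y : ℝ => Real.exp (-(y - c / y) ^ 2)) (Ioi 0) := by
    refine Integrable.mono' hI hmeas (Eventually.of_forall fun y => ?_)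
    rw [Real.norm_of_nonneg (Real.exp_pos _).le]
    have : 0 ≤ c / y ^ 2 := by positivity
    nlinarith [Real.exp_pos (-(y - c / y) ^ 2)]
  have hI2 : IntegrableOn (fun y : ℝ => c / y ^ 2 * Real.exp (-(y - c / y) ^ 2)) (Ioi 0) := by
    refine (Integrable.sub hI hI1).congr (Eventually.of_forall fun y => ?_)
    simp only [Pi.sub_apply]
    ring
  have : ∫ y in Ioi (0 : ℝ), (1 + c / y ^ 2) * Real.exp (-(y - c / y) ^ 2)
      = (∫ y in Ioi (0 : ℝ), Real.exp (-(y - c / y) ^ 2))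
        + ∫ y in Ioi (0 : ℝ), c / y ^ 2 * Real.exp (-(y - c / y) ^ 2) := by
    rw [← integral_add hI1 hI2]
    congr 1 with y
    ring
  rw [this, ← hE3] at hE
  linarith

/-- The square completed: `y ^ 2 + c ^ 2 / y ^ 2 = (y - c / y) ^ 2 + 2 * c`. -/
theorem integral_exp_neg_sq_sub_div_sq {c : ℝ} (hc : 0 ≤ c) :
    ∫ y in Ioi (0 : ℝ), Real.exp (-y ^ 2 - c ^ 2 / y ^ 2) = √Real.pi / 2 * Real.exp (-2 * c) := by
  rcases hc.eq_or_lt with rfl | hc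
  · simpa using integral_gaussian_Ioi 1
  · rw [← integral_exp_neg_sub_div_sq hc, ← integral_mul_const]
    refine setIntegral_congr_fun measurableSet_Ioi fun y hy => ?_
    have hy' := ne_of_gt (mem_Ioi.1 hy)
    rw [← Real.exp_add]
    congr 1
    field_simp
    ring

theorem integrableOn_exp_neg_sq_sub_div_sq (c : ℝ) :
    IntegrableOn (fun y : ℝ => Real.exp (-y ^ 2 - c ^ 2 / y ^ 2)) (Ioi 0) := by
  have hG : IntegrableOn (fun z : ℝ => Real.exp (-z ^ 2)) (Ioi 0) := by
    simpa using (integrable_exp_neg_mul_sq one_pos).integrableOn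
  refine Integrable.mono' hG (Measurable.aestronglyMeasurable (by fun_prop))
    (Eventually.of_forall fun y => ?_)
  rw [Real.norm_of_nonneg (Real.exp_pos _).le]
  apply Real.exp_le_exp.2
  have : 0 ≤ c ^ 2 / y ^ 2 := by positivity
  linarith

/-- Subordination: `exp (-2πt|ξ|)` is a superposition of Gaussians in `ξ`, whose Fourier transforms
are known; integrating these gives the Poisson kernel. -/
theorem integral_cexp_mul_exp_neg_norm {t : ℝ} (ht : 0 < t) (x : E3) :
    ∫ ξ : E3, Complex.exp (2 * Real.pi * Complex.I * (inner ℝ x ξ : ℝ))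
      * (Real.exp (-(2 * Real.pi * t) * ‖ξ‖) : ℂ) = (poissonKernel t x : ℂ) := by
  have hpi := Real.pi_pos
  have hs : (√Real.pi : ℂ) ≠ 0 := by
    exact_mod_cast (Real.sqrt_pos.2 hpi).ne'
  set F : E3 → ℝ → ℂ := fun ξ y => Complex.exp (2 * Real.pi * Complex.I * (inner ℝ x ξ : ℝ))
    * (Real.exp (-y ^ 2 - (Real.pi * t * ‖ξ‖) ^ 2 / y ^ 2) : ℂ) with hF
  have hnorm : ∀ ξ y, ‖F ξ y‖ = Real.exp (-y ^ 2 - (Real.pi * t * ‖ξ‖) ^ 2 / y ^ 2) := by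
    intro ξ y
    simp only [hF, norm_mul, Complex.norm_real, Real.norm_of_nonneg (Real.exp_pos _).le]
    rw [Complex.norm_exp]
    simp
  have hFm : Measurable (Function.uncurry F) := by
    simp only [hF, Function.uncurry_def]
    fun_prop
  have hFi : Integrable (Function.uncurry F) (volume.prod (volume.restrict (Ioi (0 : ℝ)))) := by
    rw [integrable_prod_iff hFm.aestronglyMeasurable]
    constructor
    · refine Eventually.of_forall fun ξ => ?_
      refine (integrableOn_exp_neg_sq_sub_div_sq (Real.pi * t * ‖ξ‖)).mono'
        (hFm.of_uncurry_left).aestronglyMeasurable (Eventually.of_forall fun y => ?_)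
      exact (hnorm ξ y).le
    · simp only [Function.uncurry_apply_pair, hnorm]
      have h0 : ∀ ξ : E3, ∫ y in Ioi (0 : ℝ),
          Real.exp (-y ^ 2 - (Real.pi * t * ‖ξ‖) ^ 2 / y ^ 2)
          = √Real.pi / 2 * Real.exp (-2 * (Real.pi * t * ‖ξ‖)) := fun ξ =>
        integral_exp_neg_sq_sub_div_sq (by positivity)
      simp_rw [h0]
      refine ((integrable_exp_neg_norm (a := 2 * (Real.pi * t)) (by positivity)).const_mul
        (√Real.pi / 2)).congr (Eventually.of_forall fun ξ => ?_)
      simp only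
      congr 2
      ring
  have h1 : ∀ ξ : E3, Complex.exp (2 * Real.pi * Complex.I * (inner ℝ x ξ : ℝ))
      * (Real.exp (-(2 * Real.pi * t) * ‖ξ‖) : ℂ)
      = (2 / √Real.pi : ℂ) * ∫ y in Ioi (0 : ℝ), F ξ y := by
    intro ξ
    simp only [hF]
    rw [integral_const_mul, integral_complex_ofReal,
      integral_exp_neg_sq_sub_div_sq (c := Real.pi * t * ‖ξ‖) (by positivity)]
    rw [show -(2 * Real.pi * t) * ‖ξ‖ = -2 * (Real.pi * t * ‖ξ‖) by ring]
    push_cast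
    field_simp
  simp_rw [h1]
  rw [integral_const_mul, integral_integral_swap hFi]
  have h2 : ∀ y ∈ Ioi (0 : ℝ), ∫ ξ : E3, F ξ y
      = ((1 / (√Real.pi ^ 3 * t ^ 3) * (y ^ 3 *
        Real.exp (-((t ^ 2 + ‖x‖ ^ 2) / t ^ 2) * y ^ 2)) : ℝ) : ℂ) := by
    intro y hy
    have hy : 0 < y := hy
    have hb : 0 < (Real.pi * t / y) ^ 2 := by positivity
    have := GaussianFourier.integral_cexp_neg_mul_sq_norm_add (V := E3)
      (b := ((Real.pi * t / y) ^ 2 : ℝ)) (by exact_mod_cast hb) (2 * Real.pi * Complex.I) x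
    have h3 : ∀ ξ : E3, F ξ y = Complex.exp (-y ^ 2) *
        Complex.exp (-((Real.pi * t / y) ^ 2 : ℝ) * ‖ξ‖ ^ 2
          + 2 * Real.pi * Complex.I * (inner ℝ x ξ : ℝ)) := by
      intro ξ
      simp only [hF]
      rw [Complex.ofReal_exp, ← Complex.exp_add, ← Complex.exp_add]
      congr 1
      push_cast
      ring
    simp_rw [h3]
    rw [integral_const_mul, this]
    have h4 : ((Real.pi : ℂ) / (((Real.pi * t / y) ^ 2 : ℝ) : ℂ)) ^ (Module.finrank ℝ E3 / 2 : ℂ)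
        = ((y ^ 3 / (√Real.pi ^ 3 * t ^ 3) : ℝ) : ℂ) := by
      have e1 : ((Real.pi : ℂ) / (((Real.pi * t / y) ^ 2 : ℝ) : ℂ))
          = (((y / (√Real.pi * t)) ^ 2 : ℝ) : ℂ) := by
        rw [← Complex.ofReal_div]
        congr 1
        have : √Real.pi ^ 2 = Real.pi := Real.sq_sqrt hpi.le
        rw [div_pow y, mul_pow, this]
        field_simp
      have e2 : (Module.finrank ℝ E3 / 2 : ℂ) = ((3 / 2 : ℝ) : ℂ) := by
        simp [E3]
      have hpos : 0 < y / (√Real.pi * t) := by positivity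
      rw [e1, e2, ← Complex.ofReal_cpow (by positivity), ← Real.rpow_natCast,
        ← Real.rpow_mul hpos.le]
      norm_num
      rw [div_pow, mul_pow]
    rw [h4]
    rw [show Complex.exp (-(y : ℂ) ^ 2) = ((Real.exp (-y ^ 2) : ℝ) : ℂ) by push_cast; rfl]
    have h5 : (2 * (Real.pi : ℂ) * Complex.I) ^ 2 * (‖x‖ : ℂ) ^ 2
        / (4 * (((Real.pi * t / y) ^ 2 : ℝ) : ℂ)) = ((-(‖x‖ ^ 2 * y ^ 2 / t ^ 2) : ℝ) : ℂ) := by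
      have hy' : (y : ℂ) ≠ 0 := by exact_mod_cast hy.ne'
      have ht' : (t : ℂ) ≠ 0 := by exact_mod_cast ht.ne'
      have hpi' : (Real.pi : ℂ) ≠ 0 := by exact_mod_cast hpi.ne'
      push_cast
      field_simp
      rw [Complex.I_sq]
      ring
    rw [h5, ← Complex.ofReal_exp, ← Complex.ofReal_mul, ← Complex.ofReal_mul]
    congr 1
    rw [show -((t ^ 2 + ‖x‖ ^ 2) / t ^ 2) * y ^ 2 = -y ^ 2 + -(‖x‖ ^ 2 * y ^ 2 / t ^ 2) by
      field_simp
      ring, Real.exp_add]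
    ring
  rw [setIntegral_congr_fun measurableSet_Ioi h2, integral_complex_ofReal, integral_const_mul]
  have hA : 0 < (t ^ 2 + ‖x‖ ^ 2) / t ^ 2 := by positivity
  have h6 := integral_rpow_mul_exp_neg_mul_rpow (p := 2) (q := 3) (b := (t ^ 2 + ‖x‖ ^ 2) / t ^ 2)
    (by norm_num) (by norm_num) hA
  have h7 : ∫ y in Ioi (0 : ℝ), y ^ 3 * Real.exp (-((t ^ 2 + ‖x‖ ^ 2) / t ^ 2) * y ^ 2)
      = 1 / 2 * ((t ^ 2 + ‖x‖ ^ 2) / t ^ 2)⁻¹ ^ 2 := by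
    have e : ∀ y : ℝ, y ^ (3 : ℝ) = y ^ 3 := fun y => by
      rw [← Real.rpow_natCast]; norm_num
    simp only [e, Real.rpow_two] at h6
    rw [h6]
    norm_num
    field_simp
  rw [h7, poissonKernel]
  have hsq : (√Real.pi : ℂ) ^ 4 = (Real.pi : ℂ) ^ 2 := by
    have : √Real.pi ^ 4 = Real.pi ^ 2 := by
      rw [show √Real.pi ^ 4 = (√Real.pi ^ 2) ^ 2 by ring, Real.sq_sqrt hpi.le]
    exact_mod_cast this
  have hne : ((t : ℂ) ^ 2 + (‖x‖ : ℂ) ^ 2) ≠ 0 := by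
    have : t ^ 2 + ‖x‖ ^ 2 ≠ 0 := by positivity
    exact_mod_cast this
  have ht' : (t : ℂ) ≠ 0 := by exact_mod_cast ht.ne'
  have hpi' : (Real.pi : ℂ) ≠ 0 := by exact_mod_cast hpi.ne'
  push_cast
  field_simp
  rw [hsq]

/-! ### Superpositions of the harmonic exponentials `exp (2πi x·ξ - 2πt|ξ|)` -/

/-- The linear form `(x, t) ↦ 2πi x·ξ - 2πt|ξ|`. Its exponential is a harmonic function on `ℝ⁴`,
decaying in `t`. -/
noncomputable def phase (ξ : E3) (p : E3 × ℝ) : ℂ :=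
  2 * Real.pi * Complex.I * (inner ℝ p.1 ξ : ℝ) - 2 * Real.pi * ‖ξ‖ * p.2

/-- The function with frequency density `c` on `{t = 0}`, extended by `exp (-2πt|ξ|)` to `t > 0`:
`(x, t) ↦ ∫ exp (2πi x·ξ - 2πt|ξ|) c(ξ) dξ`. -/
noncomputable def synth (c : E3 → ℂ) (p : E3 × ℝ) : ℂ :=
  ∫ ξ, Complex.exp (phase ξ p) * c ξ

/-- The factor `exp (-2πt|ξ|)`, the symbol of the Poisson semigroup `exp (-t√(-Δ))`. -/
noncomputable def damp (t : ℝ) (ξ : E3) : ℝ := Real.exp (-(2 * Real.pi * t) * ‖ξ‖)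

theorem damp_pos (t : ℝ) (ξ : E3) : 0 < damp t ξ := Real.exp_pos _

theorem damp_le_one {t : ℝ} (ht : 0 ≤ t) (ξ : E3) : damp t ξ ≤ 1 := by
  rw [damp, Real.exp_le_one_iff]
  have : 0 ≤ 2 * Real.pi * t * ‖ξ‖ := by positivity
  linarith

theorem damp_zero (ξ : E3) : damp 0 ξ = 1 := by simp [damp]

@[fun_prop]
theorem measurable_damp (t : ℝ) : Measurable (damp t) := by
  unfold damp; fun_prop

@[fun_prop]
theorem continuous_phase : Continuous (fun q : E3 × (E3 × ℝ) => phase q.1 q.2) := by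
  unfold phase; fun_prop

theorem phase_add (ξ : E3) (p q : E3 × ℝ) : phase ξ (p + q) = phase ξ p + phase ξ q := by
  simp only [phase, Prod.fst_add, Prod.snd_add, inner_add_left]
  push_cast
  ring

theorem phase_smul (ξ : E3) (r : ℝ) (p : E3 × ℝ) : phase ξ (r • p) = r * phase ξ p := by
  simp only [phase, Prod.smul_fst, Prod.smul_snd, inner_smul_left, smul_eq_mul, conj_trivial]
  push_cast
  ring

theorem norm_exp_phase (ξ : E3) (p : E3 × ℝ) : ‖Complex.exp (phase ξ p)‖ = damp p.2 ξ := by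
  rw [Complex.norm_exp, damp]
  simp [phase]
  ring

theorem norm_phase_le (ξ : E3) (p : E3 × ℝ) : ‖phase ξ p‖ ≤ 4 * Real.pi * ‖p‖ * ‖ξ‖ := by
  have hpi := Real.pi_pos
  have h1 : |(inner ℝ p.1 ξ : ℝ)| ≤ ‖p‖ * ‖ξ‖ :=
    (abs_real_inner_le_norm _ _).trans (by gcongr; exact norm_fst_le p)
  have h2 : |p.2| ≤ ‖p‖ := norm_snd_le p
  unfold phase
  refine (norm_sub_le _ _).trans ?_
  simp only [norm_mul, Complex.norm_I, Complex.norm_real, Complex.norm_ofNat, Real.norm_eq_abs,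
    abs_of_pos hpi, abs_norm, mul_one]
  calc 2 * Real.pi * |(inner ℝ p.1 ξ : ℝ)| + 2 * Real.pi * ‖ξ‖ * |p.2|
      ≤ 2 * Real.pi * (‖p‖ * ‖ξ‖) + 2 * Real.pi * ‖ξ‖ * ‖p‖ := by gcongr
    _ = _ := by ring

/-- Densities whose superposition converges, together with its Plancherel formula, at every height
`t > 0`. -/
def Damped (c : E3 → ℂ) : Prop :=
  StronglyMeasurable c ∧ ∀ t : ℝ, 0 < t →
    Integrable (fun ξ => (damp t ξ : ℂ) * c ξ) ∧ MemLp (fun ξ => (damp t ξ : ℂ) * c ξ) 2 volume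

theorem memLp_damp {t : ℝ} (ht : 0 < t) : MemLp (fun ξ => (damp t ξ : ℂ)) 2 volume := by
  have hi : Integrable (fun ξ => (damp t ξ : ℂ)) :=
    (integrable_exp_neg_norm (a := 2 * Real.pi * t) (by positivity)).ofReal
  refine memLp_two_of_integrable_of_bound hi (C := 1) fun ξ => ?_
  rw [Complex.norm_real, Real.norm_of_nonneg (damp_pos _ _).le]
  exact damp_le_one ht.le ξ

theorem damped_of_memLp {c : E3 → ℂ} (hc : StronglyMeasurable c) (h2 : MemLp c 2 volume) :
    Damped c := by
  refine ⟨hc, fun t ht => ⟨(memLp_damp ht).integrable_mul h2, ?_⟩⟩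
  refine h2.mono ?_ (Eventually.of_forall fun ξ => ?_)
  · exact (Measurable.aestronglyMeasurable (by fun_prop)).mul hc.aestronglyMeasurable
  · rw [norm_mul, Complex.norm_real, Real.norm_of_nonneg (damp_pos _ _).le]
    exact mul_le_of_le_one_left (norm_nonneg _) (damp_le_one ht.le ξ)

/-- Multipliers of linear growth, such as the symbols of first derivatives, preserve damped densities:
half of the exponential decay absorbs the factor `|ξ|`. -/
theorem Damped.mul {c m : E3 → ℂ} (hc : Damped c) (hm : Measurable m) {C : ℝ}
    (hC : ∀ ξ, ‖m ξ‖ ≤ C * ‖ξ‖) : Damped (fun ξ => m ξ * c ξ) := by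
  have hmc : StronglyMeasurable (fun ξ => m ξ * c ξ) := hm.stronglyMeasurable.mul hc.1
  refine ⟨hmc, fun t ht => ?_⟩
  obtain ⟨h1, h2⟩ := hc.2 (t / 2) (by positivity)
  have hb : ∀ ξ, ‖(damp t ξ : ℂ) * (m ξ * c ξ)‖
      ≤ C / (Real.pi * t) * ‖(damp (t / 2) ξ : ℂ) * c ξ‖ := by
    intro ξ
    have hC0 : 0 ≤ C * ‖ξ‖ := (norm_nonneg _).trans (hC ξ)
    have hd : damp t ξ = damp (t / 2) ξ * Real.exp (-(Real.pi * t * ‖ξ‖)) := by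
      rw [damp, damp, ← Real.exp_add]; congr 1; ring
    have he : Real.pi * t * ‖ξ‖ * Real.exp (-(Real.pi * t * ‖ξ‖)) ≤ 1 := by
      have h := Real.add_one_le_exp (Real.pi * t * ‖ξ‖)
      rw [Real.exp_neg, ← div_eq_mul_inv, div_le_one (Real.exp_pos _)]
      linarith
    have hpt : 0 < Real.pi * t := by positivity
    simp only [norm_mul, Complex.norm_real, Real.norm_of_nonneg (damp_pos _ _).le]
    rw [hd]
    have : Real.exp (-(Real.pi * t * ‖ξ‖)) * ‖m ξ‖ ≤ C / (Real.pi * t) := by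
      rw [le_div_iff₀ hpt]
      rcases eq_or_ne ξ 0 with rfl | hξ
      · have : ‖m 0‖ ≤ 0 := by simpa using hC 0
        have h0 : ‖m 0‖ = 0 := le_antisymm this (norm_nonneg _)
        have hC1 : 0 ≤ C := by
          by_contra hneg
          push Not at hneg
          obtain ⟨v, hv⟩ := exists_ne (0 : E3)
          have h1 := (norm_nonneg _).trans (hC v)
          have h2 : 0 < ‖v‖ := norm_pos_iff.2 hv
          nlinarith
        rw [h0]; simpa using hC1
      · have hC1 : 0 ≤ C := nonneg_of_mul_nonneg_left hC0 (norm_pos_iff.2 hξ)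
        calc Real.exp (-(Real.pi * t * ‖ξ‖)) * ‖m ξ‖ * (Real.pi * t)
            ≤ Real.exp (-(Real.pi * t * ‖ξ‖)) * (C * ‖ξ‖) * (Real.pi * t) := by
              gcongr; exact hC ξ
          _ = C * (Real.pi * t * ‖ξ‖ * Real.exp (-(Real.pi * t * ‖ξ‖))) := by ring
          _ ≤ C * 1 := by gcongr
          _ = C := mul_one C
    calc damp (t / 2) ξ * Real.exp (-(Real.pi * t * ‖ξ‖)) * (‖m ξ‖ * ‖c ξ‖)
        = (Real.exp (-(Real.pi * t * ‖ξ‖)) * ‖m ξ‖) * (damp (t / 2) ξ * ‖c ξ‖) := by ring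
      _ ≤ C / (Real.pi * t) * (damp (t / 2) ξ * ‖c ξ‖) := by
        gcongr
        exact mul_nonneg (damp_pos _ _).le (norm_nonneg _)
  have hmeas : AEStronglyMeasurable (fun ξ => (damp t ξ : ℂ) * (m ξ * c ξ)) volume :=
    (Measurable.aestronglyMeasurable (by fun_prop)).mul hmc.aestronglyMeasurable
  exact ⟨(h1.norm.const_mul _).mono' hmeas (Eventually.of_forall hb),
    h2.of_le_mul hmeas (Eventually.of_forall hb)⟩

@[fun_prop]
theorem measurable_phase_left (v : E3 × ℝ) : Measurable (fun ξ => phase ξ v) := by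
  have : Continuous (fun ξ => phase ξ v) := by unfold phase; fun_prop
  exact this.measurable

theorem Damped.phase_mul {c : E3 → ℂ} (hc : Damped c) (v : E3 × ℝ) :
    Damped (fun ξ => phase ξ v * c ξ) :=
  hc.mul (measurable_phase_left v) fun ξ => norm_phase_le ξ v

theorem stronglyMeasurable_synth {c : E3 → ℂ} (hc : StronglyMeasurable c) :
    StronglyMeasurable (synth c) := by
  have : StronglyMeasurable (fun q : (E3 × ℝ) × E3 => Complex.exp (phase q.2 q.1) * c q.2) := by
    refine StronglyMeasurable.mul ?_ (hc.comp_measurable measurable_snd)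
    exact (Complex.continuous_exp.comp
      (continuous_phase.comp (continuous_snd.prodMk continuous_fst))).stronglyMeasurable
  exact this.integral_prod_right

theorem exp_phase_eq (ξ x : E3) (t : ℝ) : Complex.exp (phase ξ (x, t))
    = Complex.exp (2 * Real.pi * Complex.I * (inner ℝ x ξ : ℝ)) * (damp t ξ : ℂ) := by
  rw [damp, Complex.ofReal_exp, ← Complex.exp_add]
  congr 1
  simp only [phase]
  push_cast
  ring

theorem synth_eq_fourierInv (c : E3 → ℂ) (x : E3) (t : ℝ) :
    synth c (x, t) = 𝓕⁻ (fun ξ => (damp t ξ : ℂ) * c ξ) x := by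
  rw [Real.fourierInv_eq', synth]
  congr 1 with ξ
  rw [exp_phase_eq, smul_eq_mul, mul_assoc, real_inner_comm]
  congr 2
  push_cast
  ring

/-- Horizontal slices of a superposition, on the Fourier side. -/
theorem isFourierPair_synth {c : E3 → ℂ} {t : ℝ} (h1 : Integrable (fun ξ => (damp t ξ : ℂ) * c ξ))
    (h2 : MemLp (fun ξ => (damp t ξ : ℂ) * c ξ) 2 volume) :
    IsFourierPair (fun x => synth c (x, t)) (fun ξ => (damp t ξ : ℂ) * c ξ) := by
  simp_rw [synth_eq_fourierInv]
  exact isFourierPair_fourierInv h1 h2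

/-- The Fourier transform of a translate of the Poisson kernel. -/
theorem isFourierPair_poissonKernel {t : ℝ} (ht : 0 < t) (x : E3) :
    IsFourierPair (fun y => (poissonKernel t (x - y) : ℂ)) fun ξ =>
      Complex.exp (-(2 * Real.pi * Complex.I * (inner ℝ x ξ : ℝ))) * (damp t ξ : ℂ) := by
  set G : E3 → ℂ := fun ξ =>
    Complex.exp (-(2 * Real.pi * Complex.I * (inner ℝ x ξ : ℝ))) * (damp t ξ : ℂ) with hG
  have hGn : ∀ ξ, ‖G ξ‖ = ‖(damp t ξ : ℂ)‖ := fun ξ => by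
    simp only [hG, norm_mul, Complex.norm_exp]
    simp
  have hGm : Measurable G := by fun_prop
  have hd : Integrable (fun ξ => (damp t ξ : ℂ)) :=
    (integrable_exp_neg_norm (a := 2 * Real.pi * t) (by positivity)).ofReal
  have hGi : Integrable G := hd.mono hGm.aestronglyMeasurable
    (Eventually.of_forall fun ξ => (hGn ξ).le)
  have hG2 : MemLp G 2 volume := (memLp_damp ht).mono hGm.aestronglyMeasurable
    (Eventually.of_forall fun ξ => (hGn ξ).le)
  have hinv : 𝓕⁻ G = fun y => (poissonKernel t (x - y) : ℂ) := by
    ext y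
    have hsymm : poissonKernel t (x - y) = poissonKernel t (y - x) := by
      rw [poissonKernel, poissonKernel, norm_sub_rev]
    rw [hsymm, ← integral_cexp_mul_exp_neg_norm ht, Real.fourierInv_eq']
    congr 1 with ξ
    simp only [hG, damp, smul_eq_mul]
    rw [← mul_assoc, ← Complex.exp_add, inner_sub_left, real_inner_comm]
    congr 2
    push_cast
    ring
  rw [← hinv]
  exact isFourierPair_fourierInv hGi hG2

/-- The Poisson integral of an `L²` function, on the Fourier side. -/
theorem integral_poissonKernel_mul {f F : E3 → ℂ} (h : IsFourierPair f F) {t : ℝ} (ht : 0 < t)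
    (x : E3) : ∫ y, (poissonKernel t (x - y) : ℂ) * f y = synth F (x, t) := by
  have key := (isFourierPair_poissonKernel ht x).integral_conj_mul h
  simp_rw [Complex.conj_ofReal] at key
  rw [key, synth]
  congr 1 with ξ
  rw [exp_phase_eq]
  simp only [map_mul, Complex.conj_ofReal, ← Complex.exp_conj]
  congr 3
  simp [Complex.conj_ofNat]

theorem harmonicExtension_eq_synth {u : E3 → ℝ} {F : E3 → ℂ}
    (h : IsFourierPair (fun x => (u x : ℂ)) F) {t : ℝ} (ht : 0 < t) (x : E3) :
    (harmonicExtension u (x, t) : ℂ) = synth F (x, t) := by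
  rw [← integral_poissonKernel_mul h ht x, harmonicExtension, ← integral_complex_ofReal]
  push_cast
  rfl

theorem halfVolume_eq : halfVolume = (volume : Measure E3).prod (volume.restrict (Ioi (0 : ℝ))) := by
  have : halfSpace = univ ×ˢ Ioi (0 : ℝ) := by
    ext p; simp [halfSpace]
  rw [halfVolume, this, Measure.volume_eq_prod, ← Measure.prod_restrict, Measure.restrict_univ]

theorem lintegral_exp_neg_Ioi {a : ℝ} (ha : 0 < a) :
    ∫⁻ t in Ioi (0 : ℝ), ENNReal.ofReal (Real.exp (-a * t)) = ENNReal.ofReal a⁻¹ := by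
  have h1 := integrableOn_pow_mul_exp_neg ha 0
  simp only [pow_zero, one_mul] at h1
  rw [← ofReal_integral_eq_lintegral_ofReal h1
    (Eventually.of_forall fun t => (Real.exp_pos _).le), integral_exp_mul_Ioi (by linarith)]
  congr 1
  simp

theorem enorm_damp_mul_sq (t : ℝ) (ξ : E3) (z : ℂ) : ‖(damp t ξ : ℂ) * z‖ₑ ^ 2
    = ENNReal.ofReal (Real.exp (-(4 * Real.pi * ‖ξ‖) * t)) * ‖z‖ₑ ^ 2 := by
  rw [enorm_mul, mul_pow]
  congr 1
  rw [← ofReal_norm, Complex.norm_real, Real.norm_of_nonneg (damp_pos _ _).le,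
    ← ENNReal.ofReal_pow (damp_pos _ _).le, damp, ← Real.exp_nat_mul]
  congr 2
  push_cast
  ring

/-- Plancherel for superpositions on the half-space. -/
theorem lintegral_synth_sq {c : E3 → ℂ} (hc : Damped c) :
    ∫⁻ p, ‖synth c p‖ₑ ^ 2 ∂halfVolume
      = ∫⁻ ξ, ENNReal.ofReal (4 * Real.pi * ‖ξ‖)⁻¹ * ‖c ξ‖ₑ ^ 2 := by
  have hcm : Measurable (fun ξ => ‖c ξ‖ₑ ^ 2) := (hc.1.enorm).pow_const 2
  rw [halfVolume_eq, lintegral_prod_symm _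
    ((stronglyMeasurable_synth hc.1).enorm.pow_const 2).aemeasurable]
  have h1 : ∀ t ∈ Ioi (0 : ℝ), ∫⁻ x, ‖synth c (x, t)‖ₑ ^ 2
      = ∫⁻ ξ, ENNReal.ofReal (Real.exp (-(4 * Real.pi * ‖ξ‖) * t)) * ‖c ξ‖ₑ ^ 2 := by
    intro t ht
    obtain ⟨h1, h2⟩ := hc.2 t ht
    rw [(isFourierPair_synth h1 h2).lintegral_enorm_sq]
    simp_rw [enorm_damp_mul_sq]
  rw [setLIntegral_congr_fun measurableSet_Ioi h1, lintegral_lintegral_swap]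
  · have hne : ∀ᵐ ξ : E3, ξ ≠ 0 := by
      simp [ae_iff, measure_singleton]
    refine lintegral_congr_ae ?_
    filter_upwards [hne] with ξ hξ
    rw [lintegral_mul_const _ (by fun_prop), lintegral_exp_neg_Ioi
      (by have := norm_pos_iff.2 hξ; positivity)]
  · refine Measurable.aemeasurable ?_
    refine Measurable.mul (by fun_prop) (hcm.comp measurable_snd)

theorem memLp_two_iff_lintegral {α : Type*} [MeasurableSpace α] {μ : Measure α} {f : α → ℂ}
    (hf : AEStronglyMeasurable f μ) : MemLp f 2 μ ↔ ∫⁻ x, ‖f x‖ₑ ^ 2 ∂μ < ⊤ := by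
  have h := eLpNorm_nnreal_pow_eq_lintegral (f := f) (μ := μ) (p := 2) (by norm_num)
  simp only [ENNReal.coe_ofNat, NNReal.coe_ofNat, ENNReal.rpow_ofNat] at h
  rw [← h, MemLp, and_iff_right hf]
  simp

theorem memLp_synth {c : E3 → ℂ} (hc : Damped c)
    (hfin : ∫⁻ ξ, ENNReal.ofReal (4 * Real.pi * ‖ξ‖)⁻¹ * ‖c ξ‖ₑ ^ 2 < ⊤) :
    MemLp (synth c) 2 halfVolume := by
  rw [memLp_two_iff_lintegral (stronglyMeasurable_synth hc.1).aestronglyMeasurable,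
    lintegral_synth_sq hc]
  exact hfin

/-! ### Band-limited superpositions are smooth -/

/-- Integrable densities supported in a ball. -/
def BandLimited (c : E3 → ℂ) : Prop :=
  Integrable c ∧ ∃ R : ℝ, ∀ ξ, R < ‖ξ‖ → c ξ = 0

theorem BandLimited.phase_mul {c : E3 → ℂ} (hc : BandLimited c) (v : E3 × ℝ) :
    BandLimited (fun ξ => phase ξ v * c ξ) := by
  obtain ⟨h1, R, hR⟩ := hc
  refine ⟨?_, R, fun ξ hξ => by simp [hR ξ hξ]⟩
  refine (h1.norm.const_mul (4 * Real.pi * ‖v‖ * R)).mono'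
    ((measurable_phase_left v).aestronglyMeasurable.mul h1.aestronglyMeasurable)
    (Eventually.of_forall fun ξ => ?_)
  rcases le_or_gt ‖ξ‖ R with h | h
  · rw [norm_mul]
    gcongr
    refine (norm_phase_le ξ v).trans ?_
    have := Real.pi_pos
    gcongr
  · simp [hR ξ h]

/-- `phase ξ` as a continuous real-linear form. -/
noncomputable def phaseCLM (ξ : E3) : (E3 × ℝ) →L[ℝ] ℂ :=
  LinearMap.mkContinuous
    { toFun := phase ξ
      map_add' := phase_add ξ
      map_smul' := fun r p => by simp [phase_smul] }
    (4 * Real.pi * ‖ξ‖) fun p => (norm_phase_le ξ p).trans_eq (by ring)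

@[simp]
theorem phaseCLM_apply (ξ : E3) (p : E3 × ℝ) : phaseCLM ξ p = phase ξ p := rfl

theorem norm_phaseCLM_le (ξ : E3) : ‖phaseCLM ξ‖ ≤ 4 * Real.pi * ‖ξ‖ :=
  LinearMap.mkContinuous_norm_le _ (by have := Real.pi_pos; positivity) _

theorem continuous_phaseCLM : Continuous phaseCLM := by
  refine continuous_clm_apply.2 fun p => ?_
  simp only [phaseCLM_apply]
  unfold phase
  fun_prop

theorem BandLimited.integrable_exp_mul {c : E3 → ℂ} (hc : BandLimited c) (p : E3 × ℝ) :
    Integrable (fun ξ => Complex.exp (phase ξ p) * c ξ) := by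
  obtain ⟨h1, R, hR⟩ := hc
  have hpi := Real.pi_pos
  refine (h1.norm.const_mul (Real.exp (2 * Real.pi * ‖p‖ * R))).mono'
    ((measurable_phase_left p).cexp.aestronglyMeasurable.mul h1.aestronglyMeasurable)
    (Eventually.of_forall fun ξ => ?_)
  rcases le_or_gt ‖ξ‖ R with h | h
  · rw [norm_mul, norm_exp_phase, damp]
    gcongr
    have h2 : |p.2| ≤ ‖p‖ := norm_snd_le p
    calc -(2 * Real.pi * p.2) = 2 * Real.pi * (-p.2) := by ring
      _ ≤ 2 * Real.pi * ‖p‖ := by gcongr; exact (neg_le_abs _).trans h2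
  · simp [hR ξ h]

theorem BandLimited.hasFDerivAt_synth {c : E3 → ℂ} (hc : BandLimited c) (p : E3 × ℝ) :
    HasFDerivAt (synth c) (∫ ξ, (Complex.exp (phase ξ p) * c ξ) • phaseCLM ξ) p := by
  have hpi := Real.pi_pos
  have hint := hc.integrable_exp_mul p
  obtain ⟨h1, R, hR⟩ := hc
  refine hasFDerivAt_integral_of_dominated_of_fderiv_le (s := Metric.ball p 1)
    (F := fun q ξ => Complex.exp (phase ξ q) * c ξ)
    (F' := fun q ξ => (Complex.exp (phase ξ q) * c ξ) • phaseCLM ξ)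
    (bound := fun ξ => Real.exp (2 * Real.pi * (‖p‖ + 1) * R) * (4 * Real.pi * R) * ‖c ξ‖)
    (Metric.ball_mem_nhds p one_pos) ?_ hint ?_ ?_ (h1.norm.const_mul _) ?_
  · exact Eventually.of_forall fun q =>
      (measurable_phase_left q).cexp.aestronglyMeasurable.mul h1.aestronglyMeasurable
  · exact ((measurable_phase_left p).cexp.aestronglyMeasurable.mul
      h1.aestronglyMeasurable).smul continuous_phaseCLM.aestronglyMeasurable
  · refine Eventually.of_forall fun ξ q hq => ?_
    rcases le_or_gt ‖ξ‖ R with h | h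
    · have hR0 : 0 ≤ R := (norm_nonneg _).trans h
      have hq' : ‖q‖ ≤ ‖p‖ + 1 := by
        have := norm_sub_norm_le q p
        rw [Metric.mem_ball, dist_eq_norm] at hq
        linarith
      have h2 : -q.2 ≤ ‖p‖ + 1 := (neg_le_abs _).trans ((norm_snd_le q).trans hq')
      rw [norm_smul, norm_mul, norm_exp_phase, damp]
      calc Real.exp (-(2 * Real.pi * q.2) * ‖ξ‖) * ‖c ξ‖ * ‖phaseCLM ξ‖
          ≤ Real.exp (2 * Real.pi * (‖p‖ + 1) * R) * ‖c ξ‖ * (4 * Real.pi * R) := by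
            gcongr
            · calc -(2 * Real.pi * q.2) = 2 * Real.pi * (-q.2) := by ring
                _ ≤ 2 * Real.pi * (‖p‖ + 1) := by gcongr
            · exact (norm_phaseCLM_le ξ).trans (by gcongr)
        _ = _ := by ring
    · simp [hR ξ h]
  · refine Eventually.of_forall fun ξ q _ => ?_
    have h := ((phaseCLM ξ).hasFDerivAt (x := q)).cexp.mul_const (c ξ)
    refine h.congr_fderiv ?_
    ext v <;> simp <;> ring

theorem BandLimited.fderiv_synth {c : E3 → ℂ} (hc : BandLimited c) (p v : E3 × ℝ) :
    fderiv ℝ (synth c) p v = synth (fun ξ => phase ξ v * c ξ) p := by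
  have hpi := Real.pi_pos
  rw [(hc.hasFDerivAt_synth p).fderiv, ContinuousLinearMap.integral_apply, synth]
  · congr 1 with ξ
    simp
    ring
  · have h1 := hc.integrable_exp_mul p
    obtain ⟨h0, R, hR⟩ := hc
    refine (h1.norm.const_mul (4 * Real.pi * R)).mono'
      (h1.aestronglyMeasurable.smul continuous_phaseCLM.aestronglyMeasurable)
      (Eventually.of_forall fun ξ => ?_)
    rcases le_or_gt ‖ξ‖ R with h | h
    · rw [norm_smul, mul_comm]
      gcongr
      exact (norm_phaseCLM_le ξ).trans (by gcongr)
    · simp [hR ξ h]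

theorem BandLimited.contDiff_synth {c : E3 → ℂ} (hc : BandLimited c) :
    ContDiff ℝ ∞ (synth c) := by
  rw [contDiff_infty]
  intro n
  induction n generalizing c with
  | zero =>
    exact contDiff_zero.2 (continuous_iff_continuousAt.2 fun p =>
      (hc.hasFDerivAt_synth p).continuousAt)
  | succ n ih =>
    push_cast
    rw [contDiff_succ_iff_fderiv_apply]
    refine ⟨fun p => (hc.hasFDerivAt_synth p).differentiableAt, by simp, fun v => ?_⟩
    simp_rw [hc.fderiv_synth]
    exact ih (hc.phase_mul v)

/-! ### The divergence theorem and weak derivatives on the half-space -/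

theorem integral_fderiv_eq_zero {f : E3 → ℂ} (hf : ContDiff ℝ 1 f) (hc : HasCompactSupport f)
    (v : E3) : ∫ x, fderiv ℝ f x v = 0 := by
  have hcont : Continuous (fun x => fderiv ℝ f x v) :=
    (hf.continuous_fderiv one_ne_zero).clm_apply continuous_const
  have hi : Integrable (fun x => fderiv ℝ f x v) :=
    hcont.integrable_of_hasCompactSupport (hc.fderiv_apply ℝ v)
  have h := integral_mul_fderiv_eq_neg_fderiv_mul_of_integrable (μ := (volume : Measure E3))
    (f := fun _ => (1 : ℂ)) (g := f) (v := v) (by simp) (by simpa using hi)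
    (by simpa using hf.continuous.integrable_of_hasCompactSupport hc)
    (fun x _ => differentiableAt_const _) (fun x _ => hf.differentiable one_ne_zero x)
  simpa using h

instance : IsLocallyFiniteMeasure halfVolume := by unfold halfVolume; infer_instance

theorem integrable_half_of_continuous {f : E3 × ℝ → ℂ} (hf : Continuous f)
    (hc : HasCompactSupport f) : Integrable f halfVolume :=
  (hf.integrable_of_hasCompactSupport hc).integrableOn

/-- The divergence theorem on the half-space: tangential derivatives integrate to zero, the normal one
to minus the boundary integral. -/
theorem integral_half_fderiv {f : E3 × ℝ → ℂ} (hf : ContDiff ℝ 1 f) (hc : HasCompactSupport f)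
    (v : E3 × ℝ) : ∫ p, fderiv ℝ f p v ∂halfVolume = -(v.2 * ∫ x, f (x, 0)) := by
  have hcont : ∀ w, Continuous (fun p => fderiv ℝ f p w) := fun w =>
    (hf.continuous_fderiv one_ne_zero).clm_apply continuous_const
  have hi : ∀ w, Integrable (fun p => fderiv ℝ f p w) halfVolume := fun w =>
    integrable_half_of_continuous (hcont w) (hc.fderiv_apply ℝ w)
  have hslice : ∀ t : ℝ, HasCompactSupport (fun x => f (x, t)) := fun t =>
    hc.comp_isClosedEmbedding (Function.LeftInverse.isClosedEmbedding
      (f := Prod.fst) (fun _ => rfl) continuous_fst (by fun_prop))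
  have hslice' : ∀ x : E3, HasCompactSupport (fun t => f (x, t)) := fun x =>
    hc.comp_isClosedEmbedding (Function.LeftInverse.isClosedEmbedding
      (f := Prod.snd) (fun _ => rfl) continuous_snd (by fun_prop))
  have hd : ∀ p, HasFDerivAt f (fderiv ℝ f p) p := fun p =>
    (hf.differentiable one_ne_zero p).hasFDerivAt
  have h1 : ∫ p, fderiv ℝ f p (v.1, 0) ∂halfVolume = 0 := by
    have hh := hi (v.1, 0)
    rw [halfVolume_eq] at hh ⊢
    rw [integral_prod_symm _ hh]
    refine integral_eq_zero_of_ae (Eventually.of_forall fun t => ?_)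
    have e : ∀ x, fderiv ℝ (fun x => f (x, t)) x v.1 = fderiv ℝ f (x, t) (v.1, 0) := by
      intro x
      have h' : HasFDerivAt (fun x => f (x, t)) _ x := HasFDerivAt.comp (g := f)
        (f := fun x => (x, t)) x (hd (x, t)) ((hasFDerivAt_id x).prodMk (hasFDerivAt_const t x))
      rw [h'.fderiv]
      simp
    have := integral_fderiv_eq_zero (f := fun x => f (x, t))
      (hf.comp (contDiff_id.prodMk contDiff_const)) (hslice t) v.1
    simp_rw [e] at this
    exact this
  have h2 : ∫ p, fderiv ℝ f p (0, 1) ∂halfVolume = -∫ x, f (x, 0) := by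
    have hh := hi (0, 1)
    rw [halfVolume_eq] at hh ⊢
    rw [integral_prod _ hh, ← integral_neg]
    congr 1 with x
    have e : ∀ t, deriv (fun t => f (x, t)) t = fderiv ℝ f (x, t) (0, 1) := by
      intro t
      have := (hd (x, t)).comp_hasDerivAt t ((hasDerivAt_const t x).prodMk (hasDerivAt_id t))
      have h' : HasDerivAt (fun t => f (x, t)) _ t := this
      rw [h'.deriv]
    simp_rw [← e]
    exact HasCompactSupport.integral_Ioi_deriv_eq
      (hf.comp (contDiff_const.prodMk contDiff_id)) (hslice' x) 0
  have e : ∀ p, fderiv ℝ f p v = fderiv ℝ f p (v.1, 0) + v.2 * fderiv ℝ f p (0, 1) := by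
    intro p
    have : v = (v.1, 0) + v.2 • ((0 : E3), (1 : ℝ)) := by ext <;> simp
    conv_lhs => rw [this]
    rw [map_add, map_smul]
    simp
  simp_rw [e]
  rw [integral_add (hi _) ((hi _).const_mul _), h1, integral_const_mul, h2]
  ring

theorem isOpen_halfSpace : IsOpen halfSpace := isOpen_lt continuous_const continuous_snd

theorem ae_mem_halfSpace : ∀ᵐ p ∂halfVolume, 0 < p.2 :=
  ae_restrict_mem isOpen_halfSpace.measurableSet

theorem memLp_half_of_continuous {f : E3 × ℝ → ℂ} (hf : Continuous f)
    (hc : HasCompactSupport f) : MemLp f 2 halfVolume :=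
  (hf.memLp_of_hasCompactSupport hc (μ := volume)).restrict _

theorem integrable_half_mul {f g : E3 × ℝ → ℂ} (hf : MemLp f 2 halfVolume)
    (hg : MemLp g 2 halfVolume) : Integrable (fun p => f p * g p) halfVolume :=
  hf.integrable_mul hg

/-- Functions in `L²` of the half-space are determined by their integrals against test functions. -/
theorem ae_eq_of_integral_test_eq {g h : E3 × ℝ → ℂ} (hg : MemLp g 2 halfVolume)
    (hh : MemLp h 2 halfVolume)
    (H : ∀ φ : E3 × ℝ → ℝ, ContDiff ℝ ∞ φ → HasCompactSupport φ → tsupport φ ⊆ halfSpace →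
      ∫ p, φ p • g p ∂halfVolume = ∫ p, φ p • h p ∂halfVolume) : g =ᵐ[halfVolume] h := by
  have hloc : LocallyIntegrable (fun p => g p - h p) halfVolume :=
    (hg.sub hh).locallyIntegrable (by norm_num)
  have := isOpen_halfSpace.ae_eq_zero_of_integral_contDiff_smul_eq_zero
    (hloc.locallyIntegrableOn _) fun φ hφ hc hs => by
      have hint : ∀ {k : E3 × ℝ → ℂ}, MemLp k 2 halfVolume →
          Integrable (fun p => φ p • k p) halfVolume := fun {k} hk => by
        have hφ' : Continuous (fun p => (φ p : ℂ)) := Complex.continuous_ofReal.comp hφ.continuous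
        have hc' : HasCompactSupport (fun p => (φ p : ℂ)) :=
          hc.comp_left (g := fun r : ℝ => (r : ℂ)) rfl
        simpa using integrable_half_mul (memLp_half_of_continuous hφ' hc') hk
      simp_rw [smul_sub]
      rw [integral_sub (hint hg) (hint hh), H φ hφ hc hs, sub_self]
  filter_upwards [this, ae_mem_halfSpace] with p hp hp2
  exact sub_eq_zero.1 (hp hp2)

theorem IsWeakDeriv.unique {v : E3 × ℝ} {ψ g h : E3 × ℝ → ℂ} (hg : IsWeakDeriv v ψ g)
    (hh : IsWeakDeriv v ψ h) (hg2 : MemLp g 2 halfVolume) (hh2 : MemLp h 2 halfVolume) :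
    g =ᵐ[halfVolume] h :=
  ae_eq_of_integral_test_eq hg2 hh2 fun φ h1 h2 h3 =>
    neg_injective ((hg φ h1 h2 h3).symm.trans (hh φ h1 h2 h3))

theorem MemH1.weakDeriv_spec {ψ : E3 × ℝ → ℂ} (hψ : MemH1 ψ) (v : E3 × ℝ) :
    MemLp (weakDeriv v ψ) 2 halfVolume ∧ IsWeakDeriv v ψ (weakDeriv v ψ) :=
  Classical.epsilon_spec (hψ.2 v)

theorem weakDeriv_ae_eq {v : E3 × ℝ} {ψ g : E3 × ℝ → ℂ} (hg : IsWeakDeriv v ψ g)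
    (hg2 : MemLp g 2 halfVolume) : weakDeriv v ψ =ᵐ[halfVolume] g := by
  have := Classical.epsilon_spec (p := fun g => MemLp g 2 halfVolume ∧ IsWeakDeriv v ψ g)
    ⟨g, hg2, hg⟩
  exact IsWeakDeriv.unique this.2 hg this.1 hg2

/-! ### Integration by parts up to the boundary, and boundary traces -/

/-- The Cauchy–Schwarz inequality for lower Lebesgue integrals. -/
theorem lintegral_mul_sq_le {α : Type*} [MeasurableSpace α] {μ : Measure α} {f g : α → ENNReal}
    (hf : AEMeasurable f μ) (hg : AEMeasurable g μ) :
    (∫⁻ x, f x * g x ∂μ) ^ 2 ≤ (∫⁻ x, f x ^ 2 ∂μ) * ∫⁻ x, g x ^ 2 ∂μ := by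
  have h := ENNReal.lintegral_mul_le_Lp_mul_Lq μ (p := 2) (q := 2)
    Real.HolderConjugate.two_two hf hg
  simp only [ENNReal.rpow_two, Pi.mul_apply] at h
  calc (∫⁻ x, f x * g x ∂μ) ^ 2
      ≤ ((∫⁻ x, f x ^ 2 ∂μ) ^ (1 / 2 : ℝ) * (∫⁻ x, g x ^ 2 ∂μ) ^ (1 / 2 : ℝ)) ^ 2 := by gcongr
    _ = _ := by
      rw [mul_pow, ← ENNReal.rpow_two, ← ENNReal.rpow_two, ← ENNReal.rpow_mul, ← ENNReal.rpow_mul]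
      norm_num

theorem integral_mul_eq_re_add_im {α : Type*} [MeasurableSpace α] {μ : Measure α} {a f : α → ℂ}
    (ha : MemLp a 2 μ) (hf : MemLp f 2 μ) :
    ∫ x, a x * f x ∂μ = ∫ x, (a x).re • f x ∂μ + Complex.I * ∫ x, (a x).im • f x ∂μ := by
  have h1 : Integrable (fun x => (a x).re • f x) μ := by
    have := (ha.re.ofReal (K := ℂ)).integrable_mul hf
    refine this.congr (Eventually.of_forall fun x => ?_)
    simp
  have h2 : Integrable (fun x => (a x).im • f x) μ := by
    have := (ha.im.ofReal (K := ℂ)).integrable_mul hf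
    refine this.congr (Eventually.of_forall fun x => ?_)
    simp
  rw [← integral_const_mul, ← integral_add h1 (h2.const_mul _)]
  congr 1 with x
  conv_lhs => rw [← Complex.re_add_im (a x)]
  simp only [Complex.real_smul]
  ring

theorem fderiv_re {φ : E3 × ℝ → ℂ} {p : E3 × ℝ} (h : DifferentiableAt ℝ φ p) (v : E3 × ℝ) :
    fderiv ℝ (fun q => (φ q).re) p v = (fderiv ℝ φ p v).re := by
  have := (Complex.reCLM.hasFDerivAt.comp p h.hasFDerivAt)
  have h' : HasFDerivAt (fun q => (φ q).re) _ p := this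
  rw [h'.fderiv]; rfl

theorem fderiv_im {φ : E3 × ℝ → ℂ} {p : E3 × ℝ} (h : DifferentiableAt ℝ φ p) (v : E3 × ℝ) :
    fderiv ℝ (fun q => (φ q).im) p v = (fderiv ℝ φ p v).im := by
  have := (Complex.imCLM.hasFDerivAt.comp p h.hasFDerivAt)
  have h' : HasFDerivAt (fun q => (φ q).im) _ p := this
  rw [h'.fderiv]; rfl

section

variable {φ : E3 × ℝ → ℂ}

theorem continuous_fderiv_apply' (hφ : ContDiff ℝ ∞ φ) (v : E3 × ℝ) :
    Continuous (fun p => fderiv ℝ φ p v) :=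
  (hφ.continuous_fderiv (by simp)).clm_apply continuous_const

theorem memLp_fderiv_apply (hφ : ContDiff ℝ ∞ φ) (hc : HasCompactSupport φ) (v : E3 × ℝ) :
    MemLp (fun p => fderiv ℝ φ p v) 2 halfVolume :=
  memLp_half_of_continuous (continuous_fderiv_apply' hφ v) (hc.fderiv_apply ℝ v)

theorem contDiff_re (hφ : ContDiff ℝ ∞ φ) : ContDiff ℝ ∞ (fun q => (φ q).re) :=
  Complex.reCLM.contDiff.comp hφ

theorem contDiff_im (hφ : ContDiff ℝ ∞ φ) : ContDiff ℝ ∞ (fun q => (φ q).im) :=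
  Complex.imCLM.contDiff.comp hφ

theorem IsWeakDeriv.complex_test {v : E3 × ℝ} {ψ g : E3 × ℝ → ℂ} (h : IsWeakDeriv v ψ g)
    (hψ : MemLp ψ 2 halfVolume) (hg : MemLp g 2 halfVolume) (hφ : ContDiff ℝ ∞ φ)
    (hc : HasCompactSupport φ) (hs : tsupport φ ⊆ halfSpace) :
    ∫ p, fderiv ℝ φ p v * ψ p ∂halfVolume = -∫ p, φ p * g p ∂halfVolume := by
  have hd : ∀ p, DifferentiableAt ℝ φ p := fun p => hφ.differentiable (by simp) p
  rw [integral_mul_eq_re_add_im (memLp_fderiv_apply hφ hc v) hψ,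
    integral_mul_eq_re_add_im (memLp_half_of_continuous hφ.continuous hc) hg]
  have h1 := h (fun q => (φ q).re) (contDiff_re hφ) (hc.comp_left (g := Complex.re) rfl)
    ((tsupport_comp_subset (g := Complex.re) rfl φ).trans hs)
  have h2 := h (fun q => (φ q).im) (contDiff_im hφ) (hc.comp_left (g := Complex.im) rfl)
    ((tsupport_comp_subset (g := Complex.im) rfl φ).trans hs)
  simp_rw [fderiv_re (hd _)] at h1
  simp_rw [fderiv_im (hd _)] at h2
  rw [h1, h2]
  ring

theorem IsTrace.complex_test {ψ : E3 × ℝ → ℂ} {f : E3 → ℂ} (h : IsTrace ψ f) (hψ : MemH1 ψ)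
    (hφ : ContDiff ℝ ∞ φ) (hc : HasCompactSupport φ) :
    (∫ p, fderiv ℝ φ p (0, 1) * ψ p ∂halfVolume) + ∫ p, φ p * weakDeriv (0, 1) ψ p ∂halfVolume
      = -∫ x, φ (x, 0) * f x := by
  have hd : ∀ p, DifferentiableAt ℝ φ p := fun p => hφ.differentiable (by simp) p
  have hb : MemLp (fun x => φ (x, 0)) 2 volume := by
    refine Continuous.memLp_of_hasCompactSupport (hφ.continuous.comp (by fun_prop)) ?_
    exact hc.comp_isClosedEmbedding (Function.LeftInverse.isClosedEmbedding
      (f := Prod.fst) (fun _ => rfl) continuous_fst (by fun_prop))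
  rw [integral_mul_eq_re_add_im (memLp_fderiv_apply hφ hc _) hψ.1,
    integral_mul_eq_re_add_im (memLp_half_of_continuous hφ.continuous hc) (hψ.weakDeriv_spec _).1,
    integral_mul_eq_re_add_im hb h.1]
  have h1 := h.2 (fun q => (φ q).re) (contDiff_re hφ) (hc.comp_left (g := Complex.re) rfl)
  have h2 := h.2 (fun q => (φ q).im) (contDiff_im hφ) (hc.comp_left (g := Complex.im) rfl)
  simp_rw [fderiv_re (hd _)] at h1
  simp_rw [fderiv_im (hd _)] at h2
  linear_combination h1 + Complex.I * h2

/-- Weak derivatives may be tested with functions that do not vanish near the boundary, as long as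
either the direction is tangential or the test function vanishes on the boundary: the error made by
cutting off near `{t = 0}` stays bounded and lives on a set that shrinks to the boundary. -/
theorem IsWeakDeriv.test_up_to_boundary {v : E3 × ℝ} {ψ g : E3 × ℝ → ℂ} (h : IsWeakDeriv v ψ g)
    (hψ : MemLp ψ 2 halfVolume) (hg : MemLp g 2 halfVolume) (hφ : ContDiff ℝ ∞ φ)
    (hc : HasCompactSupport φ) (hv : ∀ x, (v.2 : ℂ) * φ (x, 0) = 0) :
    ∫ p, fderiv ℝ φ p v * ψ p ∂halfVolume = -∫ p, φ p * g p ∂halfVolume := by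
  have hTsm : ContDiff ℝ ∞ Real.smoothTransition := Real.smoothTransition.contDiff
  have hT0 : ∀ t, t ∉ Icc (0 : ℝ) 1 → deriv Real.smoothTransition t = 0 := by
    intro t ht
    rw [mem_Icc, not_and_or, not_le, not_le] at ht
    rcases ht with ht | ht
    · have : Real.smoothTransition =ᶠ[𝓝 t] fun _ => 0 := by
        filter_upwards [gt_mem_nhds ht] with s hs
        exact Real.smoothTransition.zero_of_nonpos hs.le
      rw [this.deriv_eq, deriv_const]
    · have : Real.smoothTransition =ᶠ[𝓝 t] fun _ => 1 := by
        filter_upwards [lt_mem_nhds ht] with s hs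
        exact Real.smoothTransition.one_of_one_le hs.le
      rw [this.deriv_eq, deriv_const]
  obtain ⟨C, hC⟩ : ∃ C, ∀ t, ‖deriv Real.smoothTransition t‖ ≤ C :=
    (hTsm.continuous_deriv (by simp)).bounded_above_of_compact_support
      (HasCompactSupport.of_support_subset_isCompact isCompact_Icc fun t ht =>
        by_contra fun h => ht (hT0 t h))
  have hC0 : 0 ≤ C := (norm_nonneg _).trans (hC 0)
  obtain ⟨L, hL⟩ := (hφ.of_le (by simp : (1 : WithTop ℕ∞) ≤ ∞)).lipschitzWith_of_hasCompactSupport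
    hc one_ne_zero
  -- `ζ n` vanishes for `t ≤ 1 / (n + 1)` and equals `1` for `t ≥ 2 / (n + 1)`
  let ζ : ℕ → ℝ → ℝ := fun n t => Real.smoothTransition ((n + 1 : ℝ) * t - 1)
  have hζsm : ∀ n, ContDiff ℝ ∞ (ζ n) := fun n => hTsm.comp (by fun_prop)
  have hζd : ∀ n t, HasDerivAt (ζ n)
      ((n + 1 : ℝ) * deriv Real.smoothTransition ((n + 1 : ℝ) * t - 1)) t := by
    intro n t
    have h1 : HasDerivAt Real.smoothTransition
        (deriv Real.smoothTransition ((n + 1 : ℝ) * t - 1)) ((n + 1 : ℝ) * t - 1) :=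
      (hTsm.differentiable (by simp) _).hasDerivAt
    have h2 : HasDerivAt (fun t : ℝ => (n + 1 : ℝ) * t - 1) (n + 1) t := by
      simpa using ((hasDerivAt_id t).const_mul (n + 1 : ℝ)).sub_const 1
    exact (h1.comp t h2).congr_deriv (mul_comm _ _)
  let φn : ℕ → E3 × ℝ → ℂ := fun n p => (ζ n p.2 : ℂ) * φ p
  have hφn : ∀ n, ContDiff ℝ ∞ (φn n) := fun n =>
    (Complex.ofRealCLM.contDiff.comp ((hζsm n).comp contDiff_snd)).mul hφ
  have hφnc : ∀ n, HasCompactSupport (φn n) := fun n => hc.mul_left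
  have hφns : ∀ n, tsupport (φn n) ⊆ halfSpace := by
    intro n
    have hcl : IsClosed {p : E3 × ℝ | 1 ≤ (n + 1 : ℝ) * p.2} :=
      isClosed_le continuous_const (by fun_prop)
    have hsub : tsupport (φn n) ⊆ {p : E3 × ℝ | 1 ≤ (n + 1 : ℝ) * p.2} := by
      refine closure_minimal (fun p hp => ?_) hcl
      by_contra hlt
      simp only [mem_ofPred_eq, not_le] at hlt
      apply hp
      simp [φn, ζ, Real.smoothTransition.zero_of_nonpos (sub_nonpos.2 hlt.le)]
    refine hsub.trans fun p hp => ?_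
    simp only [mem_ofPred_eq] at hp
    have hn : (0 : ℝ) < n + 1 := by positivity
    exact pos_of_mul_pos_right (one_pos.trans_le hp) hn.le
  have hφnd : ∀ n p, fderiv ℝ (φn n) p v = (ζ n p.2 : ℂ) * fderiv ℝ φ p v
      + (((n + 1 : ℝ) * deriv Real.smoothTransition ((n + 1 : ℝ) * p.2 - 1) : ℝ) : ℂ)
        * (v.2 * φ p) := by
    intro n p
    have h1 : HasFDerivAt (fun q : E3 × ℝ => (ζ n q.2 : ℂ)) _ p :=
      Complex.ofRealCLM.hasFDerivAt.comp p
        ((hζd n p.2).hasFDerivAt.comp p (hasFDerivAt_snd (𝕜 := ℝ) (E := E3) (F := ℝ)))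
    have h2 := h1.mul (hφ.differentiable (by simp) p).hasFDerivAt
    have h3 : HasFDerivAt (φn n) _ p := h2
    rw [h3.fderiv]
    simp
    ring
  have hpt : ∀ p : E3 × ℝ, 0 < p.2 → ∀ᶠ n : ℕ in atTop,
      ζ n p.2 = 1 ∧ deriv Real.smoothTransition ((n + 1 : ℝ) * p.2 - 1) = 0 := by
    intro p hp
    filter_upwards [eventually_gt_atTop ⌈2 / p.2⌉₊] with n hn
    have h1 : 2 / p.2 < n + 1 := by
      have := (Nat.ceil_lt_add_one (a := 2 / p.2) (by positivity))
      have h2 : (⌈2 / p.2⌉₊ : ℝ) < n := by exact_mod_cast hn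
      linarith [Nat.le_ceil (2 / p.2)]
    rw [div_lt_iff₀ hp] at h1
    refine ⟨Real.smoothTransition.one_of_one_le (by linarith), hT0 _ fun h => ?_⟩
    linarith [h.2]
  -- `ζ n'` has size `n` but is supported where `t ≤ 2 / (n + 1)`, and there `|v.2 * φ| ≤ |v.2| L t`
  have hbd : ∀ n, ∀ p : E3 × ℝ, 0 < p.2 → ‖fderiv ℝ (φn n) p v‖
      ≤ ‖fderiv ℝ φ p v‖ + (tsupport φ).indicator (fun _ => 2 * C * (|v.2| * L)) p := by
    intro n p hp
    rw [hφnd]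
    refine (norm_add_le _ _).trans (add_le_add ?_ ?_)
    · rw [norm_mul, Complex.norm_real, Real.norm_of_nonneg (Real.smoothTransition.nonneg _)]
      exact mul_le_of_le_one_left (norm_nonneg _) (Real.smoothTransition.le_one _)
    · by_cases hps : p ∈ tsupport φ
      · rw [indicator_of_mem hps, norm_mul, Complex.norm_real, norm_mul (n + 1 : ℝ),
          Real.norm_of_nonneg (by positivity : (0 : ℝ) ≤ n + 1)]
        have hφb : ‖(v.2 : ℂ) * φ p‖ ≤ |v.2| * L * p.2 := by
          have e : (v.2 : ℂ) * φ p = v.2 * (φ p - φ (p.1, 0)) := by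
            rw [mul_sub, hv, sub_zero]
          rw [e, norm_mul, Complex.norm_real, Real.norm_eq_abs, mul_assoc]
          gcongr
          have := hL.dist_le_mul p (p.1, 0)
          rw [dist_eq_norm] at this
          refine this.trans_eq ?_
          rw [Prod.dist_eq]
          simp [abs_of_pos hp, hp.le]
        rcases lt_or_ge 2 ((n + 1 : ℝ) * p.2) with h2 | h2
        · rw [hT0 _ (fun h => by linarith [h.2])]
          simp only [norm_zero, mul_zero, zero_mul]
          positivity
        · calc (n + 1 : ℝ) * ‖deriv Real.smoothTransition ((n + 1 : ℝ) * p.2 - 1)‖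
                * ‖(v.2 : ℂ) * φ p‖
              ≤ (n + 1 : ℝ) * C * (|v.2| * L * p.2) := by
                gcongr
                exact hC _
            _ = ((n + 1 : ℝ) * p.2) * C * (|v.2| * L) := by ring
            _ ≤ 2 * C * (|v.2| * L) := by gcongr
      · simp [indicator_of_notMem hps, image_eq_zero_of_notMem_tsupport hps]
  have hind : MemLp ((tsupport φ).indicator (fun _ => 2 * C * (|v.2| * L))) 2 halfVolume :=
    memLp_indicator_const _ (isClosed_tsupport φ).measurableSet _
      (Or.inr (hc.isCompact.measure_lt_top.ne))
  have hlim1 : Tendsto (fun n => ∫ p, fderiv ℝ (φn n) p v * ψ p ∂halfVolume) atTop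
      (𝓝 (∫ p, fderiv ℝ φ p v * ψ p ∂halfVolume)) := by
    refine tendsto_integral_of_dominated_convergence
      (fun p => (‖fderiv ℝ φ p v‖ + (tsupport φ).indicator (fun _ => 2 * C * (|v.2| * L)) p)
        * ‖ψ p‖) (fun n => ?_) ?_ (fun n => ?_) ?_
    · exact ((continuous_fderiv_apply' (hφn n) v).aestronglyMeasurable).mul hψ.1
    · exact ((memLp_fderiv_apply hφ hc v).norm.add hind).integrable_mul hψ.norm
    · filter_upwards [ae_mem_halfSpace] with p hp
      rw [norm_mul]
      gcongr
      exact hbd n p hp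
    · filter_upwards [ae_mem_halfSpace] with p hp
      refine tendsto_const_nhds.congr' ?_
      filter_upwards [hpt p hp] with n hn
      rw [hφnd, hn.1, hn.2]
      simp
  have hlim2 : Tendsto (fun n => -∫ p, φn n p * g p ∂halfVolume) atTop
      (𝓝 (-∫ p, φ p * g p ∂halfVolume)) := by
    refine (tendsto_integral_of_dominated_convergence (fun p => ‖φ p‖ * ‖g p‖)
      (fun n => ?_) ?_ (fun n => ?_) ?_).neg
    · exact ((hφn n).continuous.aestronglyMeasurable).mul hg.1
    · exact (memLp_half_of_continuous hφ.continuous hc).norm.integrable_mul hg.norm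
    · refine Eventually.of_forall fun p => ?_
      simp only [φn, norm_mul, Complex.norm_real,
        Real.norm_of_nonneg (Real.smoothTransition.nonneg _), ζ]
      gcongr
      exact mul_le_of_le_one_left (norm_nonneg _) (Real.smoothTransition.le_one _)
    · filter_upwards [ae_mem_halfSpace] with p hp
      refine tendsto_const_nhds.congr' ?_
      filter_upwards [hpt p hp] with n hn
      simp [φn, hn.1]
  refine tendsto_nhds_unique hlim1 (hlim2.congr fun n => ?_)
  exact (h.complex_test hψ hg (hφn n) (hφnc n) (hφns n)).symm

end

/-- Every `ψ ∈ H¹` has a trace: with a cut-off `χ(t)`, `χ(0) = 1`, it is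
`-∫₀^∞ ∂ₜ(χ ψ) dt`. -/
theorem MemH1.exists_trace {ψ : E3 × ℝ → ℂ} (hψ : MemH1 ψ) : ∃ f, IsTrace ψ f := by
  obtain ⟨hg, hw⟩ := hψ.weakDeriv_spec (0, 1)
  set g := weakDeriv (0, 1) ψ with hgdef
  let b : ContDiffBump (0 : ℝ) := ⟨1, 2, one_pos, one_lt_two⟩
  have hbsm : ContDiff ℝ ∞ b := b.contDiff
  have hb0 : b 0 = 1 := b.one_of_mem_closedBall (by simp [b])
  obtain ⟨C, hC⟩ : ∃ C, ∀ t, ‖deriv b t‖ ≤ C :=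
    (hbsm.continuous_deriv (by simp)).bounded_above_of_compact_support b.hasCompactSupport.deriv
  let F : E3 × ℝ → ℂ := fun p => ((deriv b p.2 : ℝ) : ℂ) * ψ p + (b p.2 : ℂ) * g p
  have hm1 : AEStronglyMeasurable (fun p : E3 × ℝ => ((deriv b p.2 : ℝ) : ℂ)) halfVolume :=
    (Complex.continuous_ofReal.comp
      ((hbsm.continuous_deriv (by simp)).comp continuous_snd)).aestronglyMeasurable
  have hm2 : AEStronglyMeasurable (fun p : E3 × ℝ => (b p.2 : ℂ)) halfVolume :=
    (Complex.continuous_ofReal.comp (hbsm.continuous.comp continuous_snd)).aestronglyMeasurable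
  have hF1 : MemLp (fun p => ((deriv b p.2 : ℝ) : ℂ) * ψ p) 2 halfVolume :=
    hψ.1.of_le_mul (c := C) (hm1.mul hψ.1.1) (Eventually.of_forall fun p => by
      rw [norm_mul, Complex.norm_real]
      gcongr
      exact hC _)
  have hF2 : MemLp (fun p => (b p.2 : ℂ) * g p) 2 halfVolume :=
    hg.of_le_mul (c := 1) (hm2.mul hg.1) (Eventually.of_forall fun p => by
      rw [norm_mul, Complex.norm_real, Real.norm_of_nonneg b.nonneg]
      gcongr
      exact b.le_one)
  have hF : MemLp F 2 halfVolume := hF1.add hF2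
  have hF0 : ∀ x t, t ∉ Icc (-2 : ℝ) 2 → F (x, t) = 0 := by
    intro x t ht
    have ht' : t ∉ tsupport b := by
      rw [b.tsupport_eq, Real.closedBall_eq_Icc]
      simpa using ht
    have h1 : deriv b t = 0 := by
      by_contra hne
      exact ht' (support_deriv_subset hne)
    simp [F, h1, image_eq_zero_of_notMem_tsupport ht']
  have hFm : AEStronglyMeasurable F ((volume : Measure E3).prod (volume.restrict (Ioi (0 : ℝ)))) := by
    rw [← halfVolume_eq]; exact hF.1
  have hFsl : ∀ᵐ x : E3, AEStronglyMeasurable (fun t => F (x, t)) (volume.restrict (Ioi (0 : ℝ))) :=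
    hFm.prodMk_left
  have hfin : ∫⁻ x, ∫⁻ t in Ioi (0 : ℝ), ‖F (x, t)‖ₑ ^ 2 < ⊤ := by
    rw [← lintegral_prod (fun p : E3 × ℝ => ‖F p‖ₑ ^ 2) (hFm.enorm.pow_const 2), ← halfVolume_eq]
    exact (memLp_two_iff_lintegral hF.1).1 hF
  have hfL2 : MemLp (fun x => -∫ t in Ioi (0 : ℝ), F (x, t)) 2 volume := by
    have hmeas : AEStronglyMeasurable (fun x => -∫ t in Ioi (0 : ℝ), F (x, t)) volume :=
      hFm.integral_prod_right'.neg
    rw [memLp_two_iff_lintegral hmeas]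
    refine lt_of_le_of_lt ?_ (ENNReal.mul_lt_top hfin (ENNReal.ofReal_lt_top (r := 4)))
    rw [← lintegral_mul_const' _ _ ENNReal.ofReal_ne_top]
    refine lintegral_mono_ae ?_
    filter_upwards [hFsl] with x hx
    have h1 : ‖-∫ t in Ioi (0 : ℝ), F (x, t)‖ₑ
        ≤ ∫⁻ t in Ioi (0 : ℝ), ‖F (x, t)‖ₑ * (Icc (-2 : ℝ) 2).indicator 1 t := by
      rw [enorm_neg]
      refine (enorm_integral_le_lintegral_enorm _).trans (lintegral_mono fun t => ?_)
      by_cases ht : t ∈ Icc (-2 : ℝ) 2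
      · simp [ht]
      · simp [hF0 x t ht]
    calc ‖-∫ t in Ioi (0 : ℝ), F (x, t)‖ₑ ^ 2
        ≤ (∫⁻ t in Ioi (0 : ℝ), ‖F (x, t)‖ₑ * (Icc (-2 : ℝ) 2).indicator 1 t) ^ 2 := by gcongr
      _ ≤ (∫⁻ t in Ioi (0 : ℝ), ‖F (x, t)‖ₑ ^ 2)
          * ∫⁻ t in Ioi (0 : ℝ), (Icc (-2 : ℝ) 2).indicator 1 t ^ 2 :=
        lintegral_mul_sq_le hx.enorm
          ((measurable_one.indicator measurableSet_Icc).aemeasurable)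
      _ ≤ _ := by
        gcongr
        calc ∫⁻ t in Ioi (0 : ℝ), (Icc (-2 : ℝ) 2).indicator 1 t ^ 2
            ≤ ∫⁻ t, (Icc (-2 : ℝ) 2).indicator 1 t ^ 2 := setLIntegral_le_lintegral _ _
          _ = ∫⁻ t, (Icc (-2 : ℝ) 2).indicator 1 t := by
            congr 1 with t
            by_cases ht : t ∈ Icc (-2 : ℝ) 2 <;> simp [ht]
          _ ≤ ENNReal.ofReal 4 := by
            rw [lintegral_indicator_one measurableSet_Icc, Real.volume_Icc]
            norm_num
  refine ⟨_, hfL2, fun φ hφ hc => ?_⟩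
  -- compare `φ` with the product `φ(x, 0) b(t)`, which has the same boundary values
  let φ0 : E3 × ℝ → ℂ := fun p => (φ (p.1, 0) : ℂ) * (b p.2 : ℂ)
  have hφc : ContDiff ℝ ∞ (fun p => (φ p : ℂ)) := Complex.ofRealCLM.contDiff.comp hφ
  have hcc : HasCompactSupport (fun p => (φ p : ℂ)) := hc.comp_left (g := fun r : ℝ => (r : ℂ)) rfl
  have hφ0 : ContDiff ℝ ∞ φ0 :=
    (hφc.comp (contDiff_fst.prodMk contDiff_const)).mul
      (Complex.ofRealCLM.contDiff.comp (hbsm.comp contDiff_snd))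
  have hφ0c : HasCompactSupport φ0 := by
    have h1 : HasCompactSupport (fun x => φ (x, 0)) :=
      hc.comp_isClosedEmbedding (Function.LeftInverse.isClosedEmbedding
        (f := Prod.fst) (fun _ => rfl) continuous_fst (by fun_prop))
    refine HasCompactSupport.intro (h1.isCompact.prod b.hasCompactSupport.isCompact) fun p hp => ?_
    rw [mem_prod, not_and_or] at hp
    rcases hp with hp | hp
    · have : φ (p.1, 0) = 0 := image_eq_zero_of_notMem_tsupport (f := fun x => φ (x, 0)) hp
      simp [φ0, this]
    · simp [φ0, image_eq_zero_of_notMem_tsupport hp]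
  have hdφ0 : ∀ p, fderiv ℝ φ0 p (0, 1) = (φ (p.1, 0) : ℂ) * ((deriv b p.2 : ℝ) : ℂ) := by
    intro p
    have hpath : HasDerivAt (fun s : ℝ => p + s • ((0 : E3), (1 : ℝ))) (0, 1) 0 := by
      simpa using ((hasDerivAt_id (0 : ℝ)).smul_const ((0 : E3), (1 : ℝ))).const_add p
    have h1 := (hφ0.differentiable (by simp) (p + (0 : ℝ) • ((0 : E3), (1 : ℝ)))).hasFDerivAt.comp_hasDerivAt
      (0 : ℝ) hpath
    have hb1 : HasDerivAt b (deriv b p.2) (p.2 + 0) := by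
      rw [add_zero]; exact (hbsm.differentiable (by simp) p.2).hasDerivAt
    have h2 : HasDerivAt (fun s : ℝ => (φ (p.1, 0) : ℂ) * ((b (p.2 + s) : ℝ) : ℂ))
        ((φ (p.1, 0) : ℂ) * ((deriv b p.2 : ℝ) : ℂ)) 0 := by
      refine HasDerivAt.const_mul _ ?_
      have h3 := HasDerivAt.comp (0 : ℝ) hb1 ((hasDerivAt_id (0 : ℝ)).const_add p.2)
      simpa using h3.ofReal_comp
    have h4 : (φ0 ∘ fun s : ℝ => p + s • ((0 : E3), (1 : ℝ)))
        = fun s : ℝ => (φ (p.1, 0) : ℂ) * ((b (p.2 + s) : ℝ) : ℂ) := by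
      ext s; simp [φ0]
    rw [h4] at h1
    have := h1.unique h2
    simpa using this
  have hdiff := hw.test_up_to_boundary (φ := fun p => (φ p : ℂ) - φ0 p) hψ.1 hg (hφc.sub hφ0)
    (hcc.sub hφ0c) (fun x => by simp [φ0, hb0])
  have hfd : ∀ p, fderiv ℝ (fun p => (φ p : ℂ) - φ0 p) p (0, 1)
      = (fderiv ℝ φ p (0, 1) : ℂ) - fderiv ℝ φ0 p (0, 1) := by
    intro p
    have h1 : HasFDerivAt (fun p => (φ p : ℂ)) _ p :=
      Complex.ofRealCLM.hasFDerivAt.comp p (hφ.differentiable (by simp) p).hasFDerivAt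
    have h2 := h1.sub (hφ0.differentiable (by simp) p).hasFDerivAt
    have h3 : HasFDerivAt (fun p => (φ p : ℂ) - φ0 p) _ p := h2
    rw [h3.fderiv]
    simp
  have hi1 : Integrable (fun p => (fderiv ℝ φ p (0, 1) : ℂ) * ψ p) halfVolume := by
    refine integrable_half_mul (memLp_half_of_continuous (Complex.continuous_ofReal.comp
      ((hφ.continuous_fderiv (by simp)).clm_apply continuous_const)) ?_) hψ.1
    exact (hc.fderiv_apply ℝ (0, 1)).comp_left (g := fun r : ℝ => (r : ℂ)) rfl
  have hi2 : Integrable (fun p => fderiv ℝ φ0 p (0, 1) * ψ p) halfVolume :=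
    integrable_half_mul (memLp_fderiv_apply hφ0 hφ0c _) hψ.1
  have hi3 : Integrable (fun p => (φ p : ℂ) * g p) halfVolume :=
    integrable_half_mul (memLp_half_of_continuous hφc.continuous hcc) hg
  have hi4 : Integrable (fun p => φ0 p * g p) halfVolume :=
    integrable_half_mul (memLp_half_of_continuous hφ0.continuous hφ0c) hg
  simp_rw [hfd, sub_mul] at hdiff
  rw [integral_sub hi1 hi2, integral_sub hi3 hi4] at hdiff
  -- for the product, Fubini's theorem gives the boundary term by definition of the trace
  have hprod : ∫ p, fderiv ℝ φ0 p (0, 1) * ψ p ∂halfVolume + ∫ p, φ0 p * g p ∂halfVolume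
      = ∫ x, (φ (x, 0) : ℂ) * ∫ t in Ioi (0 : ℝ), F (x, t) := by
    rw [← integral_add hi2 hi4]
    have hi5 : Integrable (fun p => fderiv ℝ φ0 p (0, 1) * ψ p + φ0 p * g p) halfVolume :=
      hi2.add hi4
    rw [halfVolume_eq] at hi5 ⊢
    rw [integral_prod _ hi5]
    congr 1 with x
    rw [← integral_const_mul]
    congr 1 with t
    rw [hdφ0]
    simp only [φ0, F]
    ring
  simp only [Complex.real_smul, mul_neg, integral_neg]
  rw [← hprod]
  linear_combination hdiff

/-- Smooth cut-offs with compact support that increase to `1` and whose gradients tend to `0`. -/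
theorem exists_cutoff : ∃ (C : ℝ) (b : ℕ → E3 × ℝ → ℝ), (∀ n, ContDiff ℝ ∞ (b n)) ∧
    (∀ n, HasCompactSupport (b n)) ∧ (∀ n p, ‖(b n p : ℂ)‖ ≤ 1) ∧
    (∀ n p, ‖fderiv ℝ (b n) p‖ ≤ C * ((n : ℝ) + 1)⁻¹) ∧ ∀ p, ∀ᶠ n in atTop, b n p = 1 := by
  let b : ContDiffBump (0 : E3 × ℝ) := ⟨1, 2, one_pos, one_lt_two⟩
  have hbsm : ContDiff ℝ ∞ b := b.contDiff
  obtain ⟨C, hC⟩ : ∃ C, ∀ q, ‖fderiv ℝ b q‖ ≤ C :=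
    (hbsm.continuous_fderiv (by simp)).bounded_above_of_compact_support
      (b.hasCompactSupport.fderiv ℝ)
  have hr0 : ∀ n : ℕ, 0 < ((n : ℝ) + 1)⁻¹ := fun n => by positivity
  refine ⟨C, fun n p => b (((n : ℝ) + 1)⁻¹ • p), fun n => hbsm.comp (contDiff_const_smul _),
    fun n => b.hasCompactSupport.comp_smul (hr0 n).ne', fun n p => ?_, fun n p => ?_, fun p => ?_⟩
  · rw [Complex.norm_real, Real.norm_of_nonneg b.nonneg]
    exact b.le_one
  · have h0 : HasFDerivAt (fun q : E3 × ℝ => ((n : ℝ) + 1)⁻¹ • q)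
        (((n : ℝ) + 1)⁻¹ • ContinuousLinearMap.id ℝ (E3 × ℝ)) p :=
      (((n : ℝ) + 1)⁻¹ • ContinuousLinearMap.id ℝ (E3 × ℝ)).hasFDerivAt
    have h1 : HasFDerivAt (fun q : E3 × ℝ => b (((n : ℝ) + 1)⁻¹ • q)) _ p :=
      (hbsm.differentiable (by simp) _).hasFDerivAt.comp p h0
    rw [h1.fderiv, ContinuousLinearMap.comp_smul, ContinuousLinearMap.comp_id, norm_smul,
      Real.norm_of_nonneg (hr0 n).le, mul_comm]
    gcongr
    exact hC _
  · have hrlim : Tendsto (fun n : ℕ => ((n : ℝ) + 1)⁻¹) atTop (𝓝 0) := by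
      simpa using tendsto_one_div_add_atTop_nhds_zero_nat (𝕜 := ℝ)
    have : Tendsto (fun n : ℕ => ((n : ℝ) + 1)⁻¹ • p) atTop (𝓝 0) := by
      simpa using hrlim.smul_const p
    filter_upwards [this (Metric.closedBall_mem_nhds (0 : E3 × ℝ) one_pos)] with n hn
    exact b.one_of_mem_closedBall hn

/-- Integration by parts on the half-space against a smooth square-integrable function `D`, in a
tangential direction or in the normal direction. -/
theorem IsTrace.integral_by_parts {ψ : E3 × ℝ → ℂ} {f : E3 → ℂ} (hf : IsTrace ψ f)
    (hψ : MemH1 ψ) {v : E3 × ℝ} (hv : v.2 = 0 ∨ v = (0, 1)) {D : E3 × ℝ → ℂ}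
    (hD : ContDiff ℝ ∞ D) (hD2 : MemLp D 2 halfVolume)
    (hDv : MemLp (fun p => fderiv ℝ D p v) 2 halfVolume)
    (hD0 : MemLp (fun x => D (x, 0)) 2 volume) :
    (∫ p, fderiv ℝ D p v * ψ p ∂halfVolume) + ∫ p, D p * weakDeriv v ψ p ∂halfVolume
      = -(v.2 * ∫ x, D (x, 0) * f x) := by
  obtain ⟨hg, hw⟩ := hψ.weakDeriv_spec v
  -- the case of compact support; the general case follows by cutting off at infinity
  have hcpt : ∀ φ : E3 × ℝ → ℂ, ContDiff ℝ ∞ φ → HasCompactSupport φ →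
      (∫ p, fderiv ℝ φ p v * ψ p ∂halfVolume) + ∫ p, φ p * weakDeriv v ψ p ∂halfVolume
        = -(v.2 * ∫ x, φ (x, 0) * f x) := by
    intro φ hφ hc
    rcases hv with hv | rfl
    · rw [hw.test_up_to_boundary hψ.1 hg hφ hc (fun x => by simp [hv]), hv]
      simp
    · rw [hf.complex_test hψ hφ hc]
      simp
  obtain ⟨C, b, hbsm, hbc, hbn, hbd, hb1⟩ := exists_cutoff
  have hC0 : 0 ≤ C := by
    have := (norm_nonneg _).trans (hbd 0 0)
    simpa using this
  have hkn : ∀ n p, ‖((fderiv ℝ (b n) p v : ℝ) : ℂ)‖ ≤ C * ((n : ℝ) + 1)⁻¹ * ‖v‖ := fun n p => by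
    rw [Complex.norm_real]
    exact (fderiv ℝ (b n) p).le_of_opNorm_le (hbd n p) v
  have hr1 : ∀ n : ℕ, ((n : ℝ) + 1)⁻¹ ≤ 1 := fun n => inv_le_one_of_one_le₀ (by simp)
  let φ : ℕ → E3 × ℝ → ℂ := fun n p => (b n p : ℂ) * D p
  have hφ : ∀ n, ContDiff ℝ ∞ (φ n) := fun n => (Complex.ofRealCLM.contDiff.comp (hbsm n)).mul hD
  have hφc : ∀ n, HasCompactSupport (φ n) := fun n =>
    ((hbc n).comp_left (g := fun s : ℝ => (s : ℂ)) rfl).mul_right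
  have hφd : ∀ n p, fderiv ℝ (φ n) p v = (b n p : ℂ) * fderiv ℝ D p v
      + ((fderiv ℝ (b n) p v : ℝ) : ℂ) * D p := by
    intro n p
    have h1 : HasFDerivAt (fun q : E3 × ℝ => ((b n q : ℝ) : ℂ)) _ p :=
      Complex.ofRealCLM.hasFDerivAt.comp p ((hbsm n).differentiable (by simp) p).hasFDerivAt
    have h2 := h1.mul (hD.differentiable (by simp) p).hasFDerivAt
    have h3 : HasFDerivAt (φ n) _ p := h2
    rw [h3.fderiv]
    simp
    ring
  have hl1 : Tendsto (fun n => ∫ p, fderiv ℝ (φ n) p v * ψ p ∂halfVolume) atTop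
      (𝓝 (∫ p, fderiv ℝ D p v * ψ p ∂halfVolume)) := by
    refine tendsto_integral_of_dominated_convergence
      (fun p => (‖fderiv ℝ D p v‖ + C * ‖v‖ * ‖D p‖) * ‖ψ p‖) (fun n => ?_) ?_ (fun n => ?_) ?_
    · exact ((continuous_fderiv_apply' (hφ n) v).aestronglyMeasurable).mul hψ.1.1
    · exact (hDv.norm.add (hD2.norm.const_mul _)).integrable_mul hψ.1.norm
    · refine Eventually.of_forall fun p => ?_
      rw [norm_mul, hφd]
      gcongr
      refine (norm_add_le _ _).trans (add_le_add ?_ ?_)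
      · rw [norm_mul]
        exact mul_le_of_le_one_left (norm_nonneg _) (hbn n p)
      · rw [norm_mul]
        gcongr
        refine (hkn n p).trans ?_
        gcongr
        exact mul_le_of_le_one_right hC0 (hr1 n)
    · refine Eventually.of_forall fun p => ?_
      refine Tendsto.mul_const _ ?_
      simp_rw [hφd]
      suffices h : Tendsto (fun n => (b n p : ℂ) * fderiv ℝ D p v
          + ((fderiv ℝ (b n) p v : ℝ) : ℂ) * D p) atTop
          (𝓝 (1 * fderiv ℝ D p v + 0 * D p)) by simpa using h
      refine Tendsto.add (Tendsto.mul_const _ ?_) (Tendsto.mul_const _ ?_)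
      · refine tendsto_const_nhds.congr' ?_
        filter_upwards [hb1 p] with n hn
        simp [hn]
      · refine squeeze_zero_norm (fun n => hkn n p) ?_
        have hrlim : Tendsto (fun n : ℕ => ((n : ℝ) + 1)⁻¹) atTop (𝓝 0) := by
          simpa using tendsto_one_div_add_atTop_nhds_zero_nat (𝕜 := ℝ)
        simpa using (hrlim.const_mul C).mul_const ‖v‖
  have hl2 : Tendsto (fun n => ∫ p, φ n p * weakDeriv v ψ p ∂halfVolume) atTop
      (𝓝 (∫ p, D p * weakDeriv v ψ p ∂halfVolume)) := by
    refine tendsto_integral_of_dominated_convergence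
      (fun p => ‖D p‖ * ‖weakDeriv v ψ p‖) (fun n => ?_) ?_ (fun n => ?_) ?_
    · exact (hφ n).continuous.aestronglyMeasurable.mul hg.1
    · exact hD2.norm.integrable_mul hg.norm
    · refine Eventually.of_forall fun p => ?_
      simp only [φ, norm_mul]
      gcongr
      exact mul_le_of_le_one_left (norm_nonneg _) (hbn n p)
    · refine Eventually.of_forall fun p => tendsto_const_nhds.congr' ?_
      filter_upwards [hb1 p] with n hn
      simp [φ, hn]
  have hl3 : Tendsto (fun n => -((v.2 : ℂ) * ∫ x, φ n (x, 0) * f x)) atTop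
      (𝓝 (-((v.2 : ℂ) * ∫ x, D (x, 0) * f x))) := by
    refine Tendsto.neg (Tendsto.const_mul _ ?_)
    refine tendsto_integral_of_dominated_convergence
      (fun x => ‖D (x, 0)‖ * ‖f x‖) (fun n => ?_) ?_ (fun n => ?_) ?_
    · exact (((hφ n).continuous.comp (by fun_prop : Continuous fun x : E3 =>
        (x, (0 : ℝ)))).aestronglyMeasurable).mul hf.1.1
    · exact hD0.norm.integrable_mul hf.1.norm
    · refine Eventually.of_forall fun p => ?_
      simp only [φ, norm_mul]
      gcongr
      exact mul_le_of_le_one_left (norm_nonneg _) (hbn n _)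
    · refine Eventually.of_forall fun p => tendsto_const_nhds.congr' ?_
      filter_upwards [hb1 (p, 0)] with n hn
      simp only [φ, hn]
      simp
  exact tendsto_nhds_unique (hl1.add hl2)
    (hl3.congr fun n => (hcpt (φ n) (hφ n) (hφc n)).symm)

/-! ### Superpositions as functions on the half-space -/

/-- The part of `c` at frequencies `|ξ| < n`. -/
noncomputable def lowPass (n : ℕ) (c : E3 → ℂ) : E3 → ℂ := (Metric.ball 0 (n : ℝ)).indicator c

theorem lowPass_of_lt {n : ℕ} {c : E3 → ℂ} {ξ : E3} (h : ‖ξ‖ < n) : lowPass n c ξ = c ξ :=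
  indicator_of_mem (by simpa using h) c

theorem lowPass_of_le {n : ℕ} {c : E3 → ℂ} {ξ : E3} (h : (n : ℝ) ≤ ‖ξ‖) : lowPass n c ξ = 0 :=
  indicator_of_notMem (by simpa using h) c

theorem norm_lowPass_le (n : ℕ) (c : E3 → ℂ) (ξ : E3) : ‖lowPass n c ξ‖ ≤ ‖c ξ‖ :=
  norm_indicator_le_norm_self _ _

theorem mul_lowPass (n : ℕ) (m c : E3 → ℂ) :
    (fun ξ => m ξ * lowPass n c ξ) = lowPass n (fun ξ => m ξ * c ξ) := by
  ext ξ
  rcases lt_or_ge ‖ξ‖ n with h | h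
  · rw [lowPass_of_lt h, lowPass_of_lt h]
  · rw [lowPass_of_le h, lowPass_of_le h, mul_zero]

theorem stronglyMeasurable_lowPass {c : E3 → ℂ} (hc : StronglyMeasurable c) (n : ℕ) :
    StronglyMeasurable (lowPass n c) := hc.indicator Metric.isOpen_ball.measurableSet

theorem memLp_lowPass {c : E3 → ℂ} (hc : MemLp c 2 volume) (n : ℕ) :
    MemLp (lowPass n c) 2 volume := hc.indicator Metric.isOpen_ball.measurableSet

theorem Damped.lowPass {c : E3 → ℂ} (hc : Damped c) (n : ℕ) : Damped (lowPass n c) := by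
  have hm := stronglyMeasurable_lowPass hc.1 n
  refine ⟨hm, fun t ht => ?_⟩
  obtain ⟨h1, h2⟩ := hc.2 t ht
  have hmeas : AEStronglyMeasurable (fun ξ => (damp t ξ : ℂ) * BosonStar.lowPass n c ξ) volume :=
    (Measurable.aestronglyMeasurable (by fun_prop)).mul hm.aestronglyMeasurable
  have hle : ∀ ξ, ‖(damp t ξ : ℂ) * BosonStar.lowPass n c ξ‖ ≤ ‖(damp t ξ : ℂ) * c ξ‖ := fun ξ => by
    rw [norm_mul, norm_mul]
    gcongr
    exact norm_lowPass_le n c ξ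
  exact ⟨h1.mono hmeas (Eventually.of_forall hle), h2.mono hmeas (Eventually.of_forall hle)⟩

theorem bandLimited_lowPass {c : E3 → ℂ} (hc : MemLp c 2 volume) (n : ℕ) :
    BandLimited (lowPass n c) := by
  refine ⟨?_, n, fun ξ hξ => lowPass_of_le hξ.le⟩
  have h1 : MemLp ((Metric.ball (0 : E3) (n : ℝ)).indicator (fun _ => (1 : ℂ))) 2 volume :=
    memLp_indicator_const _ Metric.isOpen_ball.measurableSet _ (Or.inr measure_ball_lt_top.ne)
  refine (h1.integrable_mul hc).congr (Eventually.of_forall fun ξ => ?_)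
  rcases lt_or_ge ‖ξ‖ n with h | h
  · simp [lowPass_of_lt h, h]
  · simp [lowPass_of_le h, h]

theorem Damped.integrable_exp_mul {c : E3 → ℂ} (hc : Damped c) {p : E3 × ℝ} (hp : 0 < p.2) :
    Integrable (fun ξ => Complex.exp (phase ξ p) * c ξ) := by
  refine (hc.2 p.2 hp).1.mono ((measurable_phase_left p).cexp.aestronglyMeasurable.mul
    hc.1.aestronglyMeasurable) (Eventually.of_forall fun ξ => ?_)
  rw [norm_mul, norm_mul, norm_exp_phase, Complex.norm_real,
    Real.norm_of_nonneg (damp_pos _ _).le]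

theorem Damped.sub {c d : E3 → ℂ} (hc : Damped c) (hd : Damped d) :
    Damped (fun ξ => c ξ - d ξ) := by
  refine ⟨hc.1.sub hd.1, fun t ht => ?_⟩
  simp_rw [mul_sub]
  exact ⟨(hc.2 t ht).1.sub (hd.2 t ht).1, (hc.2 t ht).2.sub (hd.2 t ht).2⟩

theorem synth_sub {c d : E3 → ℂ} (hc : Damped c) (hd : Damped d) {p : E3 × ℝ} (hp : 0 < p.2) :
    synth (fun ξ => c ξ - d ξ) p = synth c p - synth d p := by
  simp_rw [synth, mul_sub]
  exact integral_sub (hc.integrable_exp_mul hp) (hd.integrable_exp_mul hp)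

/-- The squared norm of `synth c` in `L²` of the half-space, by `lintegral_synth_sq`. At `ξ = 0` the
weight takes the junk value `0`, on a null set. -/
noncomputable def synthNormSq (c : E3 → ℂ) : ENNReal :=
  ∫⁻ ξ, ENNReal.ofReal (4 * Real.pi * ‖ξ‖)⁻¹ * ‖c ξ‖ₑ ^ 2

theorem tendsto_synthNormSq_tail {c : E3 → ℂ} (hc : StronglyMeasurable c)
    (hfin : synthNormSq c < ⊤) :
    Tendsto (fun n => synthNormSq (fun ξ => c ξ - lowPass n c ξ)) atTop (𝓝 0) := by
  have h := tendsto_lintegral_of_dominated_convergence (μ := (volume : Measure E3))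
    (F := fun n ξ => ENNReal.ofReal (4 * Real.pi * ‖ξ‖)⁻¹ * ‖c ξ - lowPass n c ξ‖ₑ ^ 2)
    (f := fun _ => 0) (fun ξ => ENNReal.ofReal (4 * Real.pi * ‖ξ‖)⁻¹ * ‖c ξ‖ₑ ^ 2)
    (fun n => ?_) (fun n => Eventually.of_forall fun ξ => ?_) hfin.ne
    (Eventually.of_forall fun ξ => ?_)
  · simpa [synthNormSq] using h
  · exact Measurable.mul (by fun_prop)
      ((hc.sub (stronglyMeasurable_lowPass hc n)).enorm.pow_const 2)
  · simp only
    gcongr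
    rcases lt_or_ge ‖ξ‖ n with h | h
    · simp [lowPass_of_lt h]
    · simp [lowPass_of_le h]
  · refine tendsto_const_nhds.congr' ?_
    filter_upwards [eventually_gt_atTop ⌈‖ξ‖⌉₊] with n hn
    have : ‖ξ‖ < n := (Nat.le_ceil _).trans_lt (by exact_mod_cast hn)
    simp [lowPass_of_lt this]

theorem synthNormSq_mono {c d : E3 → ℂ} (h : ∀ ξ, ‖c ξ‖ ≤ ‖d ξ‖) :
    synthNormSq c ≤ synthNormSq d := by
  refine lintegral_mono fun ξ => ?_
  gcongr
  exact enorm_le_iff_norm_le.2 (h ξ)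

theorem memLp_synth_of_synthNormSq {c : E3 → ℂ} (hc : Damped c) (hfin : synthNormSq c < ⊤) :
    MemLp (synth c) 2 halfVolume := memLp_synth hc hfin

/-- Superpositions are weakly approximated by their low-frequency parts. -/
theorem tendsto_integral_mul_synth {φ : E3 × ℝ → ℂ} {c : E3 → ℂ} (hc : Damped c)
    (hfin : synthNormSq c < ⊤) (hφ : MemLp φ 2 halfVolume) :
    Tendsto (fun n => ∫ p, φ p * synth (lowPass n c) p ∂halfVolume) atTop
      (𝓝 (∫ p, φ p * synth c p ∂halfVolume)) := by
  have hfin' : ∀ n, synthNormSq (lowPass n c) < ⊤ := fun n =>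
    (synthNormSq_mono (norm_lowPass_le n c)).trans_lt hfin
  rw [tendsto_iff_edist_tendsto_0]
  have hsq : Tendsto (fun n => (∫⁻ p, ‖φ p‖ₑ ^ 2 ∂halfVolume)
      * synthNormSq (fun ξ => c ξ - lowPass n c ξ)) atTop (𝓝 0) := by
    have := ENNReal.Tendsto.const_mul (tendsto_synthNormSq_tail hc.1 hfin)
      (Or.inr ((memLp_two_iff_lintegral hφ.1).1 hφ).ne)
    simpa using this
  have hle : ∀ n, edist (∫ p, φ p * synth (lowPass n c) p ∂halfVolume)
      (∫ p, φ p * synth c p ∂halfVolume) ^ 2 ≤ (∫⁻ p, ‖φ p‖ₑ ^ 2 ∂halfVolume)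
      * synthNormSq (fun ξ => c ξ - lowPass n c ξ) := by
    intro n
    have e1 : edist (∫ p, φ p * synth (lowPass n c) p ∂halfVolume)
        (∫ p, φ p * synth c p ∂halfVolume)
        = ‖∫ p, φ p * synth (fun ξ => c ξ - lowPass n c ξ) p ∂halfVolume‖ₑ := by
      rw [edist_comm, edist_eq_enorm_sub, ← integral_sub (integrable_half_mul hφ (memLp_synth_of_synthNormSq hc hfin))
        (integrable_half_mul hφ (memLp_synth_of_synthNormSq (hc.lowPass n) (hfin' n)))]
      congr 1
      refine integral_congr_ae ?_
      filter_upwards [ae_mem_halfSpace] with p hp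
      rw [synth_sub hc (hc.lowPass n) hp, mul_sub]
    rw [e1]
    have hm := hc.sub (hc.lowPass n)
    calc _ ≤ (∫⁻ p, ‖φ p‖ₑ * ‖synth (fun ξ => c ξ - lowPass n c ξ) p‖ₑ ∂halfVolume) ^ 2 := by
          gcongr
          refine (enorm_integral_le_lintegral_enorm _).trans_eq ?_
          simp_rw [enorm_mul]
      _ ≤ _ := lintegral_mul_sq_le hφ.1.enorm (stronglyMeasurable_synth hm.1).enorm.aemeasurable
      _ = _ := by rw [lintegral_synth_sq hm]; rfl
  have h0 := tendsto_of_tendsto_of_tendsto_of_le_of_le tendsto_const_nhds hsq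
    (fun n => zero_le) hle
  have := (ENNReal.continuous_rpow_const (y := 1 / 2)).tendsto 0 |>.comp h0
  rw [ENNReal.zero_rpow_of_pos (by norm_num)] at this
  refine this.congr fun n => ?_
  simp only [Function.comp]
  rw [← ENNReal.rpow_two, ← ENNReal.rpow_mul]
  norm_num

theorem weight_mul_enorm_phase_sq_le (v : E3 × ℝ) (c : E3 → ℂ) (ξ : E3) :
    ENNReal.ofReal (4 * Real.pi * ‖ξ‖)⁻¹ * ‖phase ξ v * c ξ‖ₑ ^ 2
      ≤ ENNReal.ofReal (4 * Real.pi * ‖v‖ ^ 2) * (ENNReal.ofReal ‖ξ‖ * ‖c ξ‖ₑ ^ 2) := by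
  have hpi := Real.pi_pos
  rw [enorm_mul, mul_pow, ← mul_assoc, ← mul_assoc]
  refine mul_le_mul' ?_ le_rfl
  rw [← ofReal_norm, ← ENNReal.ofReal_pow (norm_nonneg _), ← ENNReal.ofReal_mul (by positivity),
    ← ENNReal.ofReal_mul (by positivity)]
  apply ENNReal.ofReal_le_ofReal
  rcases eq_or_ne ξ 0 with rfl | hξ
  · simp
  · have hξ' := norm_pos_iff.2 hξ
    calc (4 * Real.pi * ‖ξ‖)⁻¹ * ‖phase ξ v‖ ^ 2
        ≤ (4 * Real.pi * ‖ξ‖)⁻¹ * (4 * Real.pi * ‖v‖ * ‖ξ‖) ^ 2 := by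
          gcongr; exact norm_phase_le ξ v
      _ = 4 * Real.pi * ‖v‖ ^ 2 * ‖ξ‖ := by field_simp

theorem synthNormSq_phase_lt_top {c : E3 → ℂ} (hfin : ∫⁻ ξ, ENNReal.ofReal ‖ξ‖ * ‖c ξ‖ₑ ^ 2 < ⊤)
    (v : E3 × ℝ) : synthNormSq (fun ξ => phase ξ v * c ξ) < ⊤ := by
  refine (lintegral_mono (weight_mul_enorm_phase_sq_le v c)).trans_lt ?_
  rw [lintegral_const_mul' _ _ ENNReal.ofReal_ne_top]
  exact ENNReal.mul_lt_top ENNReal.ofReal_lt_top hfin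

theorem isFourierPair_synth_zero {c : E3 → ℂ} (h1 : Integrable c) (h2 : MemLp c 2 volume) :
    IsFourierPair (fun x => synth c (x, 0)) c := by
  have := isFourierPair_synth (c := c) (t := 0) (by simpa [damp_zero] using h1)
    (by simpa [damp_zero] using h2)
  simpa [damp_zero] using this

theorem tendsto_lowPass (c : E3 → ℂ) (ξ : E3) :
    Tendsto (fun n => lowPass n c ξ) atTop (𝓝 (c ξ)) := by
  refine tendsto_const_nhds.congr' ?_
  filter_upwards [eventually_gt_atTop ⌈‖ξ‖⌉₊] with n hn
  have : ‖ξ‖ < n := (Nat.le_ceil _).trans_lt (by exact_mod_cast hn)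
  rw [lowPass_of_lt this]

theorem tendsto_integral_mul_lowPass {c F : E3 → ℂ} (hc : MemLp c 2 volume)
    (hF : MemLp F 2 volume) :
    Tendsto (fun n => ∫ ξ, F ξ * lowPass n c ξ) atTop (𝓝 (∫ ξ, F ξ * c ξ)) := by
  refine tendsto_integral_of_dominated_convergence (fun ξ => ‖F ξ‖ * ‖c ξ‖)
    (fun n => hF.1.mul (memLp_lowPass hc n).1) (hF.norm.integrable_mul hc.norm)
    (fun n => Eventually.of_forall fun ξ => ?_)
    (Eventually.of_forall fun ξ => (tendsto_lowPass c ξ).const_mul _)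
  rw [norm_mul]
  gcongr
  exact norm_lowPass_le n c ξ

/-- Green's formula for a superposition: it is proved for smooth, band-limited densities and
extended by Plancherel. -/
theorem integral_synth_by_parts {c g : E3 → ℂ} (hc : StronglyMeasurable c)
    (hgc : IsFourierPair g c) (h0 : synthNormSq c < ⊤)
    (h1 : ∫⁻ ξ, ENNReal.ofReal ‖ξ‖ * ‖c ξ‖ₑ ^ 2 < ⊤) (v : E3 × ℝ) {φ : E3 × ℝ → ℝ}
    (hφ : ContDiff ℝ ∞ φ) (hφc : HasCompactSupport φ) :
    (∫ p, fderiv ℝ φ p v • synth c p ∂halfVolume)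
      + ∫ p, φ p • synth (fun ξ => phase ξ v * c ξ) p ∂halfVolume
      = -(v.2 * ∫ x, φ (x, 0) • g x) := by
  have hc2 := hgc.memLp_right
  have hd : Damped c := damped_of_memLp hc hc2
  have hφ' : ContDiff ℝ ∞ (fun p => (φ p : ℂ)) := Complex.ofRealCLM.contDiff.comp hφ
  have hφc' : HasCompactSupport (fun p => (φ p : ℂ)) :=
    hφc.comp_left (g := fun r : ℝ => (r : ℂ)) rfl
  have hφd : ∀ p, HasFDerivAt (fun p => (φ p : ℂ))
      (Complex.ofRealCLM.comp (fderiv ℝ φ p)) p := fun p =>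
    Complex.ofRealCLM.hasFDerivAt.comp p (hφ.differentiable (by simp) p).hasFDerivAt
  have hφf : ∀ p, fderiv ℝ (fun p => (φ p : ℂ)) p v = (fderiv ℝ φ p v : ℂ) := fun p => by
    rw [(hφd p).fderiv]; rfl
  have hA : MemLp (fun p => (fderiv ℝ φ p v : ℂ)) 2 halfVolume := by
    simpa only [hφf] using memLp_fderiv_apply hφ' hφc' v
  have hB : MemLp (fun p => (φ p : ℂ)) 2 halfVolume :=
    memLp_half_of_continuous hφ'.continuous hφc'
  have hb0 : HasCompactSupport (fun x => (φ (x, 0) : ℂ)) :=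
    hφc'.comp_isClosedEmbedding (Function.LeftInverse.isClosedEmbedding
      (f := Prod.fst) (fun _ => rfl) continuous_fst (by fun_prop))
  have hb : MemLp (fun x => (φ (x, 0) : ℂ)) 2 volume :=
    Continuous.memLp_of_hasCompactSupport (hφ'.continuous.comp (by fun_prop)) hb0
  obtain ⟨F, -, hF⟩ := IsFourierPair.exists_right hb
  have hbl : ∀ n, BandLimited (lowPass n c) := bandLimited_lowPass hc2
  have hsm : ∀ n, ContDiff ℝ ∞ (synth (lowPass n c)) := fun n => (hbl n).contDiff_synth
  have key : ∀ n, (∫ p, (fderiv ℝ φ p v : ℂ) * synth (lowPass n c) p ∂halfVolume)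
      + ∫ p, (φ p : ℂ) * synth (lowPass n fun ξ => phase ξ v * c ξ) p ∂halfVolume
      = -(v.2 * ∫ ξ, conj (F ξ) * lowPass n c ξ) := by
    intro n
    have hi := integral_half_fderiv (f := fun p => (φ p : ℂ) * synth (lowPass n c) p)
      ((hφ'.mul (hsm n)).of_le (by simp)) hφc'.mul_right v
    have hfd : ∀ p, fderiv ℝ (fun p => (φ p : ℂ) * synth (lowPass n c) p) p v
        = (fderiv ℝ φ p v : ℂ) * synth (lowPass n c) p
          + (φ p : ℂ) * synth (lowPass n fun ξ => phase ξ v * c ξ) p := by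
      intro p
      rw [← mul_lowPass, ← (hbl n).fderiv_synth]
      have h2 := (hφd p).mul ((hsm n).differentiable (by simp) p).hasFDerivAt
      have h3 : HasFDerivAt (fun p => (φ p : ℂ) * synth (lowPass n c) p) _ p := h2
      rw [h3.fderiv]
      simp
      ring
    simp_rw [hfd] at hi
    rw [integral_add] at hi
    · rw [hi, ← hF.integral_conj_mul (isFourierPair_synth_zero (hbl n).1 (memLp_lowPass hc2 n))]
      simp
    · refine integrable_half_of_continuous ?_ ?_
      · simp_rw [← hφf]
        exact (continuous_fderiv_apply' hφ' v).mul (hsm n).continuous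
      · simp_rw [← hφf]
        exact (hφc'.fderiv_apply ℝ v).mul_right
    · refine integrable_half_of_continuous ?_ hφc'.mul_right
      rw [← mul_lowPass]
      exact hφ'.continuous.mul ((hbl n).phase_mul v).contDiff_synth.continuous
  -- let the cut-off frequency tend to infinity
  have hl1 := tendsto_integral_mul_synth hd h0 hA
  have hl2 := tendsto_integral_mul_synth (hd.phase_mul v) (synthNormSq_phase_lt_top h1 v) hB
  have hl3 := ((tendsto_integral_mul_lowPass hc2 hF.memLp_right.star).const_mul (v.2 : ℂ)).neg
  have := tendsto_nhds_unique ((hl1.add hl2).congr key) hl3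
  simp only [Complex.real_smul]
  rw [this]
  congr 2
  have h4 := hF.integral_conj_mul hgc
  simp only [Complex.conj_ofReal] at h4
  rw [h4]
  rfl

theorem isWeakDeriv_synth {c g : E3 → ℂ} (hc : StronglyMeasurable c)
    (hgc : IsFourierPair g c) (h0 : synthNormSq c < ⊤)
    (h1 : ∫⁻ ξ, ENNReal.ofReal ‖ξ‖ * ‖c ξ‖ₑ ^ 2 < ⊤) (v : E3 × ℝ) :
    IsWeakDeriv v (synth c) (synth fun ξ => phase ξ v * c ξ) := by
  intro φ hφ hφc hφs
  have h := integral_synth_by_parts hc hgc h0 h1 v hφ hφc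
  have hz : ∀ x, φ (x, 0) = 0 := fun x =>
    image_eq_zero_of_notMem_tsupport fun hx =>
      lt_irrefl (0 : ℝ) (show (0 : ℝ) < 0 from hφs hx)
  simp only [hz, zero_smul, integral_zero, mul_zero, neg_zero] at h
  exact eq_neg_of_add_eq_zero_left h

theorem memLp_synth_phase {c : E3 → ℂ} (hc : Damped c)
    (h1 : ∫⁻ ξ, ENNReal.ofReal ‖ξ‖ * ‖c ξ‖ₑ ^ 2 < ⊤) (v : E3 × ℝ) :
    MemLp (synth fun ξ => phase ξ v * c ξ) 2 halfVolume :=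
  memLp_synth_of_synthNormSq (hc.phase_mul v) (synthNormSq_phase_lt_top h1 v)

theorem memH1_synth {c g : E3 → ℂ} (hc : StronglyMeasurable c)
    (hgc : IsFourierPair g c) (h0 : synthNormSq c < ⊤)
    (h1 : ∫⁻ ξ, ENNReal.ofReal ‖ξ‖ * ‖c ξ‖ₑ ^ 2 < ⊤) : MemH1 (synth c) :=
  have hd := damped_of_memLp hc hgc.memLp_right
  ⟨memLp_synth_of_synthNormSq hd h0, fun v => ⟨_, memLp_synth_phase hd h1 v, isWeakDeriv_synth hc hgc h0 h1 v⟩⟩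

theorem isTrace_synth {c g : E3 → ℂ} (hc : StronglyMeasurable c)
    (hgc : IsFourierPair g c) (h0 : synthNormSq c < ⊤)
    (h1 : ∫⁻ ξ, ENNReal.ofReal ‖ξ‖ * ‖c ξ‖ₑ ^ 2 < ⊤) : IsTrace (synth c) g := by
  refine ⟨hgc.memLp_left, fun φ hφ hφc => ?_⟩
  have h := integral_synth_by_parts hc hgc h0 h1 (0, 1) hφ hφc
  have hd := damped_of_memLp hc hgc.memLp_right
  have hw := weakDeriv_ae_eq (isWeakDeriv_synth hc hgc h0 h1 (0, 1)) (memLp_synth_phase hd h1 _)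
  have e : ∫ p, φ p • weakDeriv (0, 1) (synth c) p ∂halfVolume
      = ∫ p, φ p • synth (fun ξ => phase ξ (0, 1) * c ξ) p ∂halfVolume := by
    refine integral_congr_ae ?_
    filter_upwards [hw] with p hp
    rw [hp]
  rw [e, h]
  simp

/-! ### The Dirichlet form against a superposition -/

/-- The four coordinate directions of `ℝ³ × ℝ`; `none` is the normal direction `t`. -/
noncomputable def axis : Option (Fin 3) → E3 × ℝ
  | none => (0, 1)
  | some i => (EuclideanSpace.single i 1, 0)

theorem gradSq_eq (ψ : E3 × ℝ → ℂ) (p : E3 × ℝ) :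
    gradSq ψ p = ∑ o, ‖weakDeriv (axis o) ψ p‖ ^ 2 := by
  rw [Fintype.sum_option, gradSq, add_comm]
  rfl

theorem phase_axis_none (ξ : E3) : phase ξ (axis none) = ((-(2 * Real.pi * ‖ξ‖) : ℝ) : ℂ) := by
  simp [phase, axis]

theorem phase_axis_some (ξ : E3) (i : Fin 3) :
    phase ξ (axis (some i)) = 2 * Real.pi * Complex.I * (ξ i : ℂ) := by
  simp [phase, axis, EuclideanSpace.inner_single_left]

/-- The exponentials `exp (phase ξ ·)` are harmonic. -/
theorem sum_phase_axis_sq (ξ : E3) : ∑ o, phase ξ (axis o) * phase ξ (axis o) = 0 := by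
  rw [Fintype.sum_option, phase_axis_none]
  simp_rw [phase_axis_some]
  have h : (‖ξ‖ : ℂ) ^ 2 = ∑ i, (ξ i : ℂ) ^ 2 := by
    have := EuclideanSpace.real_norm_sq_eq ξ
    exact_mod_cast this
  have e : ∀ i, 2 * (Real.pi : ℂ) * Complex.I * (ξ i : ℂ) * (2 * Real.pi * Complex.I * (ξ i : ℂ))
      = -(4 * Real.pi ^ 2) * (ξ i : ℂ) ^ 2 := fun i => by
    linear_combination (4 * (Real.pi : ℂ) ^ 2 * (ξ i : ℂ) ^ 2) * Complex.I_sq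
  simp_rw [e]
  rw [← Finset.mul_sum, ← h]
  push_cast
  ring

theorem memLp_phase_mul_lowPass {c : E3 → ℂ} (hc : MemLp c 2 volume) (n : ℕ) (v : E3 × ℝ) :
    MemLp (fun ξ => phase ξ v * lowPass n c ξ) 2 volume := by
  refine hc.of_le_mul (c := 4 * Real.pi * ‖v‖ * n)
    ((measurable_phase_left v).aestronglyMeasurable.mul (memLp_lowPass hc n).1)
    (Eventually.of_forall fun ξ => ?_)
  have hpi := Real.pi_pos
  rcases lt_or_ge ‖ξ‖ n with h | h
  · rw [lowPass_of_lt h, norm_mul]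
    gcongr
    refine (norm_phase_le ξ v).trans ?_
    gcongr
  · rw [lowPass_of_le h, mul_zero, norm_zero]
    positivity

theorem lintegral_norm_mul_lowPass_lt_top {c : E3 → ℂ} (hc : MemLp c 2 volume) (n : ℕ) :
    ∫⁻ ξ, ENNReal.ofReal ‖ξ‖ * ‖lowPass n c ξ‖ₑ ^ 2 < ⊤ := by
  have h2 := (memLp_two_iff_lintegral hc.1).1 hc
  refine lt_of_le_of_lt ?_ (ENNReal.mul_lt_top (ENNReal.ofReal_lt_top (r := n)) h2)
  rw [← lintegral_const_mul' _ _ ENNReal.ofReal_ne_top]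
  refine lintegral_mono fun ξ => ?_
  rcases lt_or_ge ‖ξ‖ n with h | h
  · rw [lowPass_of_lt h]
    gcongr
  · simp [lowPass_of_le h]

theorem sum_integral_conj_synth_lowPass {ψ : E3 × ℝ → ℂ} {f F : E3 → ℂ} (hψ : MemH1 ψ)
    (hf : IsTrace ψ f) (hfF : IsFourierPair f F) {c : E3 → ℂ} (hc : StronglyMeasurable c)
    (hc2 : MemLp c 2 volume) (n : ℕ) :
    ∑ o, ∫ p, conj (synth (fun ξ => phase ξ (axis o) * lowPass n c ξ) p)
        * weakDeriv (axis o) ψ p ∂halfVolume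
      = ∫ ξ, conj (((2 * Real.pi * ‖ξ‖ : ℝ) : ℂ) * lowPass n c ξ) * F ξ := by
  have hl2 := memLp_lowPass hc2 n
  have hls := stronglyMeasurable_lowPass hc n
  have hbl := bandLimited_lowPass hc2 n
  have hdl : Damped (lowPass n c) := damped_of_memLp hls hl2
  have hfin := lintegral_norm_mul_lowPass_lt_top hc2 n
  have hfin' : ∀ v, ∫⁻ ξ, ENNReal.ofReal ‖ξ‖ * ‖phase ξ v * lowPass n c ξ‖ₑ ^ 2 < ⊤ := by
    intro v
    have h1 := lintegral_norm_mul_lowPass_lt_top (memLp_phase_mul_lowPass hc2 n v) n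
    refine lt_of_eq_of_lt (lintegral_congr fun ξ => ?_) h1
    rcases lt_or_ge ‖ξ‖ n with h | h
    · rw [lowPass_of_lt h, lowPass_of_lt h, lowPass_of_lt h]
    · simp [lowPass_of_le h]
  -- integrate each direction by parts; the sum of the resulting interior terms is harmonicity
  have hibp : ∀ o, (∫ p, conj (synth (fun ξ => phase ξ (axis o) *
        (phase ξ (axis o) * lowPass n c ξ)) p) * ψ p ∂halfVolume)
      + ∫ p, conj (synth (fun ξ => phase ξ (axis o) * lowPass n c ξ) p)
        * weakDeriv (axis o) ψ p ∂halfVolume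
      = -((axis o).2 * ∫ ξ, conj (phase ξ (axis o) * lowPass n c ξ) * F ξ) := by
    intro o
    have hblo := hbl.phase_mul (axis o)
    have hsm : ContDiff ℝ ∞ (fun p => conj (synth (fun ξ => phase ξ (axis o) * lowPass n c ξ) p)) :=
      Complex.conjCLE.contDiff.comp hblo.contDiff_synth
    have hfd : ∀ p, fderiv ℝ (fun p => conj (synth (fun ξ => phase ξ (axis o) * lowPass n c ξ) p))
        p (axis o) = conj (synth (fun ξ => phase ξ (axis o) *
          (phase ξ (axis o) * lowPass n c ξ)) p) := by
      intro p
      have h1 : HasFDerivAt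
          (fun p => conj (synth (fun ξ => phase ξ (axis o) * lowPass n c ξ) p)) _ p :=
        Complex.conjCLE.hasFDerivAt.comp p
          (hblo.contDiff_synth.differentiable (by simp) p).hasFDerivAt
      rw [h1.fderiv, ← hblo.fderiv_synth]
      simp
    have hp0 := isFourierPair_synth_zero hblo.1 (memLp_phase_mul_lowPass hc2 n (axis o))
    have := hf.integral_by_parts hψ (v := axis o)
      (by cases o <;> simp [axis]) hsm
      (memLp_synth_phase hdl hfin _).star
      (by simp_rw [hfd]; exact (memLp_synth_phase (hdl.phase_mul _) (hfin' _) _).star)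
      hp0.memLp_left.star
    simp_rw [hfd] at this
    rw [this, hp0.integral_conj_mul hfF]
  have hsum := Finset.sum_congr (rfl : (Finset.univ : Finset (Option (Fin 3))) = _)
    fun o _ => hibp o
  rw [Finset.sum_add_distrib] at hsum
  have hzero : ∑ o, ∫ p, conj (synth (fun ξ => phase ξ (axis o) *
        (phase ξ (axis o) * lowPass n c ξ)) p) * ψ p ∂halfVolume = 0 := by
    rw [← integral_finsetSum]
    · refine integral_eq_zero_of_ae (Eventually.of_forall fun p => ?_)
      simp only [Pi.zero_apply]
      rw [← Finset.sum_mul, ← map_sum]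
      have : ∑ o, synth (fun ξ => phase ξ (axis o) * (phase ξ (axis o) * lowPass n c ξ)) p = 0 := by
        simp_rw [synth]
        rw [← integral_finsetSum _ fun o _ =>
          ((hbl.phase_mul (axis o)).phase_mul (axis o)).integrable_exp_mul p]
        refine integral_eq_zero_of_ae (Eventually.of_forall fun ξ => ?_)
        simp only [Pi.zero_apply]
        have e : ∀ o, Complex.exp (phase ξ p) * (phase ξ (axis o) * (phase ξ (axis o)
            * lowPass n c ξ)) = (Complex.exp (phase ξ p) * lowPass n c ξ)
              * (phase ξ (axis o) * phase ξ (axis o)) := fun o => by ring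
        simp_rw [e]
        rw [← Finset.mul_sum, sum_phase_axis_sq, mul_zero]
      rw [this]
      simp
    · intro o _
      exact integrable_half_mul (memLp_synth_phase (hdl.phase_mul _) (hfin' _) _).star hψ.1
  rw [hzero, zero_add] at hsum
  rw [hsum, Fintype.sum_option]
  simp_rw [phase_axis_none]
  simp only [axis, Complex.ofReal_one, one_mul, Complex.ofReal_zero, zero_mul, neg_zero,
    Finset.sum_const_zero, add_zero, ← integral_neg]
  congr 1 with ξ
  simp

/-- The Dirichlet form of `ψ ∈ H¹` with the superposition of density `c` is a boundary term: the
superposition is harmonic, and its normal derivative at `t = 0` is `-√(-Δ)` of its trace. -/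
theorem sum_integral_conj_synth {ψ : E3 × ℝ → ℂ} {f F : E3 → ℂ} (hψ : MemH1 ψ)
    (hf : IsTrace ψ f) (hfF : IsFourierPair f F) {c : E3 → ℂ} (hc : StronglyMeasurable c)
    (hc2 : MemLp c 2 volume) (hc1 : MemLp (fun ξ => ((2 * Real.pi * ‖ξ‖ : ℝ) : ℂ) * c ξ) 2 volume)
    (hfin : ∫⁻ ξ, ENNReal.ofReal ‖ξ‖ * ‖c ξ‖ₑ ^ 2 < ⊤) :
    ∑ o, ∫ p, conj (synth (fun ξ => phase ξ (axis o) * c ξ) p)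
        * weakDeriv (axis o) ψ p ∂halfVolume
      = ∫ ξ, conj (((2 * Real.pi * ‖ξ‖ : ℝ) : ℂ) * c ξ) * F ξ := by
  have hd : Damped c := damped_of_memLp hc hc2
  have hconj : ∀ (d : E3 → ℂ) (φ : E3 × ℝ → ℂ), ∫ p, conj (synth d p) * φ p ∂halfVolume
      = conj (∫ p, conj (φ p) * synth d p ∂halfVolume) := by
    intro d φ
    rw [← integral_conj]
    congr 1 with p
    simp [mul_comm]
  have hl1 : Tendsto (fun n => ∑ o, ∫ p, conj (synth (fun ξ => phase ξ (axis o) * lowPass n c ξ) p)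
        * weakDeriv (axis o) ψ p ∂halfVolume) atTop
      (𝓝 (∑ o, ∫ p, conj (synth (fun ξ => phase ξ (axis o) * c ξ) p)
        * weakDeriv (axis o) ψ p ∂halfVolume)) := by
    refine tendsto_finsetSum _ fun o _ => ?_
    simp_rw [hconj, mul_lowPass]
    exact (Complex.continuous_conj.tendsto _).comp
      (tendsto_integral_mul_synth (hd.phase_mul _) (synthNormSq_phase_lt_top hfin _)
        (hψ.weakDeriv_spec _).1.star)
  refine tendsto_nhds_unique hl1 ?_
  simp_rw [sum_integral_conj_synth_lowPass hψ hf hfF hc hc2]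
  have hc3 : ∀ (d : E3 → ℂ), ∫ ξ, conj (d ξ) * F ξ = conj (∫ ξ, conj (F ξ) * d ξ) := by
    intro d
    rw [← integral_conj]
    congr 1 with p
    simp [mul_comm]
  rw [hc3 fun ξ => ((2 * Real.pi * ‖ξ‖ : ℝ) : ℂ) * c ξ]
  have e : ∀ n : ℕ, ∫ ξ, conj (((2 * Real.pi * ‖ξ‖ : ℝ) : ℂ) * lowPass n c ξ) * F ξ
      = conj (∫ ξ, conj (F ξ) * lowPass n (fun ξ => ((2 * Real.pi * ‖ξ‖ : ℝ) : ℂ) * c ξ) ξ) := by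
    intro n
    rw [hc3 fun ξ => ((2 * Real.pi * ‖ξ‖ : ℝ) : ℂ) * lowPass n c ξ]
    rw [← mul_lowPass n (fun ξ => ((2 * Real.pi * ‖ξ‖ : ℝ) : ℂ))]
  simp_rw [e]
  exact (Complex.continuous_conj.tendsto _).comp
    (tendsto_integral_mul_lowPass hc1 hfF.memLp_right.star)

/-! ### Kato's inequality -/

theorem lintegral_inv_sq_Ioi {a : ℝ} (ha : 0 < a) :
    ∫⁻ r in Ioi a, ENNReal.ofReal (r ^ 2)⁻¹ = ENNReal.ofReal a⁻¹ := by
  have h1 : ∀ r : ℝ, r ∈ Ioi a → (r ^ 2)⁻¹ = r ^ (-2 : ℝ) := fun r hr => by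
    rw [Real.rpow_neg (ha.trans hr).le, Real.rpow_two]
  have h2 := integrableOn_Ioi_rpow_of_lt (a := -2) (by norm_num) ha
  rw [setLIntegral_congr_fun measurableSet_Ioi fun r hr => by rw [h1 r hr],
    ← ofReal_integral_eq_lintegral_ofReal h2, integral_Ioi_rpow_of_lt (by norm_num) ha]
  · congr 1
    norm_num
    rw [Real.rpow_neg_one]
  · refine (ae_restrict_iff' measurableSet_Ioi).2 (Eventually.of_forall fun r hr => ?_)
    exact Real.rpow_nonneg (ha.trans hr).le _

theorem lintegral_ball_inv_sq : ∃ C : ENNReal, C ≠ ⊤ ∧ ∀ R : ℝ, 0 < R →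
    ∫⁻ ξ in Metric.ball (0 : E3) R, ENNReal.ofReal (‖ξ‖ ^ 2)⁻¹ ≤ C * ENNReal.ofReal R := by
  refine ⟨ENNReal.ofReal (3 * (volume : Measure E3).real (Metric.ball 0 1)),
    ENNReal.ofReal_ne_top, fun R hR => le_of_eq ?_⟩
  have hint : Integrable (fun ξ : E3 => (Iio R).indicator (fun y : ℝ => (y ^ 2)⁻¹) ‖ξ‖) := by
    refine (integrable_fun_norm_addHaar (μ := (volume : Measure E3))).2 ?_
    have : IntegrableOn (fun _ : ℝ => (1 : ℝ)) (Ioo 0 R) := by simp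
    have h2 := (this.integrable_indicator measurableSet_Ioo).integrableOn (s := Ioi 0)
    refine h2.congr_fun (fun y hy => ?_) measurableSet_Ioi
    have hy : (0 : ℝ) < y := hy
    by_cases h : y < R
    · simp [h, hy, E3, hy.ne']
    · simp [h]
  have e : ∫⁻ ξ in Metric.ball (0 : E3) R, ENNReal.ofReal (‖ξ‖ ^ 2)⁻¹
      = ∫⁻ ξ : E3, ENNReal.ofReal ((Iio R).indicator (fun y : ℝ => (y ^ 2)⁻¹) ‖ξ‖) := by
    rw [← lintegral_indicator Metric.isOpen_ball.measurableSet]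
    congr 1 with ξ
    by_cases h : ‖ξ‖ < R
    · simp [h]
    · simp [h]
  rw [e, ← ofReal_integral_eq_lintegral_ofReal hint, integral_fun_norm_addHaar,
    ← ENNReal.ofReal_mul (by positivity)]
  · congr 1
    have : ∫ y in Ioi (0 : ℝ), y ^ (Module.finrank ℝ E3 - 1)
        • (Iio R).indicator (fun y : ℝ => (y ^ 2)⁻¹) y = R := by
      have h3 : ∀ y ∈ Ioi (0 : ℝ), y ^ (Module.finrank ℝ E3 - 1)
          • (Iio R).indicator (fun y : ℝ => (y ^ 2)⁻¹) y
          = (Iio R).indicator (fun _ => (1 : ℝ)) y := by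
        intro y hy
        have hy : (0 : ℝ) < y := hy
        by_cases h : y < R
        · simp [h, E3, hy.ne']
        · simp [h]
      rw [setIntegral_congr_fun measurableSet_Ioi h3, setIntegral_indicator measurableSet_Iio]
      simp [Ioi_inter_Iio, hR.le]
    rw [this]
    simp [E3]
    ring
  · refine Eventually.of_forall fun ξ => ?_
    exact indicator_nonneg (fun y _ => by positivity) _

theorem ennreal_add_sq_le (a b : ENNReal) : (a + b) ^ 2 ≤ 2 * (a ^ 2 + b ^ 2) := by
  wlog h : a ≤ b generalizing a b
  · rw [add_comm, add_comm (a ^ 2)]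
    exact this b a (not_le.1 h).le
  obtain ⟨d, rfl⟩ := exists_add_of_le h
  calc (a + (a + d)) ^ 2 ≤ (a + (a + d)) ^ 2 + d ^ 2 := le_self_add
    _ = _ := by ring

/-- The mass of `f` in a ball of radius `r`, from a splitting of `F` at `|ξ| = 1 / r`: the low
frequencies are bounded in `L^∞` by Cauchy–Schwarz against `|ξ|⁻²`, the high ones in `L²` by
Plancherel. -/
theorem lintegral_ball_sq_le {f F : E3 → ℂ} (h : IsFourierPair f F)
    {C : ENNReal} (hC : ∀ R : ℝ, 0 < R →
      ∫⁻ ξ in Metric.ball (0 : E3) R, ENNReal.ofReal (‖ξ‖ ^ 2)⁻¹ ≤ C * ENNReal.ofReal R)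
    {r : ℝ} (hr : 0 < r) :
    ∫⁻ x in Metric.ball (0 : E3) r, ‖f x‖ₑ ^ 2
      ≤ 2 * volume (Metric.ball (0 : E3) 1) * C * ENNReal.ofReal (r ^ 2)
          * (∫⁻ ξ in Metric.ball (0 : E3) r⁻¹, ENNReal.ofReal (‖ξ‖ ^ 2) * ‖F ξ‖ₑ ^ 2)
        + 2 * ∫⁻ ξ in (Metric.ball (0 : E3) r⁻¹)ᶜ, ‖F ξ‖ₑ ^ 2 := by
  set B := Metric.ball (0 : E3) r⁻¹ with hB
  have hBm : MeasurableSet B := Metric.isOpen_ball.measurableSet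
  have hF := h.memLp_right
  have hlo2 : MemLp (B.indicator F) 2 volume := hF.indicator hBm
  have hhi2 : MemLp (Bᶜ.indicator F) 2 volume := hF.indicator hBm.compl
  have hlo1 : Integrable (B.indicator F) := by
    rw [integrable_indicator_iff hBm]
    have : IsFiniteMeasure (volume.restrict B) := ⟨by simpa using measure_ball_lt_top⟩
    exact (hF.restrict B).integrable (by norm_num)
  -- `f` is the sum of its low-frequency part and of `g`
  obtain ⟨g, hg⟩ := IsFourierPair.exists_left hhi2
  have hlo := isFourierPair_fourierInv hlo1 hlo2
  have hsum := hlo.add hg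
  have hfe : f =ᵐ[volume] fun x => 𝓕⁻ (B.indicator F) x + g x := by
    refine h.left_unique hsum (Eventually.of_forall fun ξ => ?_)
    exact (congrFun (indicator_self_add_compl B F) ξ).symm
  have hsup : ∀ x, ‖𝓕⁻ (B.indicator F) x‖ₑ ≤ ∫⁻ ξ in B, ‖F ξ‖ₑ := by
    intro x
    rw [Real.fourierInv_eq', ← lintegral_indicator hBm]
    refine (enorm_integral_le_lintegral_enorm _).trans (lintegral_mono fun ξ => ?_)
    rw [enorm_smul, enorm_indicator_eq_indicator_enorm]
    have : ‖Complex.exp (((2 * Real.pi * inner ℝ ξ x : ℝ) : ℂ) * Complex.I)‖ₑ = 1 := by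
      rw [← ofReal_norm, Complex.norm_exp_ofReal_mul_I, ENNReal.ofReal_one]
    rw [this, one_mul]
  have hsup2 : (∫⁻ ξ in B, ‖F ξ‖ₑ) ^ 2
      ≤ C * ENNReal.ofReal r⁻¹ * ∫⁻ ξ in B, ENNReal.ofReal (‖ξ‖ ^ 2) * ‖F ξ‖ₑ ^ 2 := by
    have h0 : ∀ᵐ ξ : E3, ξ ≠ 0 := by simp [ae_iff, measure_singleton]
    have e1 : ∫⁻ ξ in B, ‖F ξ‖ₑ
        = ∫⁻ ξ in B, ENNReal.ofReal ‖ξ‖⁻¹ * (ENNReal.ofReal ‖ξ‖ * ‖F ξ‖ₑ) := by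
      refine lintegral_congr_ae ?_
      filter_upwards [ae_restrict_of_ae h0] with ξ hξ
      have hξ' := norm_pos_iff.2 hξ
      rw [← mul_assoc, ← ENNReal.ofReal_mul (by positivity), inv_mul_cancel₀ hξ'.ne']
      simp
    rw [e1]
    refine (lintegral_mul_sq_le (by fun_prop)
      ((by fun_prop : AEMeasurable (fun ξ : E3 => ENNReal.ofReal ‖ξ‖) _).mul
        hF.1.enorm.restrict)).trans ?_
    refine mul_le_mul' ?_ (le_of_eq ?_)
    · refine le_trans (le_of_eq ?_) (hC r⁻¹ (by positivity))
      congr 1 with ξ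
      rw [← ENNReal.ofReal_pow (by positivity), inv_pow]
    · congr 1 with ξ
      simp only [Pi.mul_apply]
      rw [mul_pow, ENNReal.ofReal_pow (norm_nonneg _)]
  calc ∫⁻ x in Metric.ball (0 : E3) r, ‖f x‖ₑ ^ 2
      ≤ ∫⁻ x in Metric.ball (0 : E3) r, (2 * (∫⁻ ξ in B, ‖F ξ‖ₑ) ^ 2 + 2 * ‖g x‖ₑ ^ 2) := by
        refine lintegral_mono_ae ?_
        filter_upwards [ae_restrict_of_ae hfe] with x hx
        rw [hx, ← mul_add]
        exact (pow_le_pow_left₀ bot_le ((enorm_add_le _ _).trans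
          (add_le_add (hsup x) le_rfl)) 2).trans (ennreal_add_sq_le _ _)
    _ ≤ volume (Metric.ball (0 : E3) r) * (2 * (∫⁻ ξ in B, ‖F ξ‖ₑ) ^ 2)
        + 2 * ∫⁻ ξ in Bᶜ, ‖F ξ‖ₑ ^ 2 := by
        rw [lintegral_add_left (by fun_prop), lintegral_const, Measure.restrict_apply_univ,
          mul_comm, lintegral_const_mul' _ _ (by norm_num)]
        refine add_le_add le_rfl (mul_le_mul' le_rfl ?_)
        calc ∫⁻ x in Metric.ball (0 : E3) r, ‖g x‖ₑ ^ 2 ≤ ∫⁻ x, ‖g x‖ₑ ^ 2 :=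
              setLIntegral_le_lintegral _ _
          _ = ∫⁻ ξ, ‖Bᶜ.indicator F ξ‖ₑ ^ 2 := hg.lintegral_enorm_sq
          _ = ∫⁻ ξ in Bᶜ, ‖F ξ‖ₑ ^ 2 := by
            rw [← lintegral_indicator hBm.compl]
            congr 1 with ξ
            by_cases hξ : ξ ∈ Bᶜ <;> simp [hξ]
    _ ≤ volume (Metric.ball (0 : E3) r) * (2 * (C * ENNReal.ofReal r⁻¹
        * ∫⁻ ξ in B, ENNReal.ofReal (‖ξ‖ ^ 2) * ‖F ξ‖ₑ ^ 2)) + 2 * ∫⁻ ξ in Bᶜ, ‖F ξ‖ₑ ^ 2 := by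
        gcongr
    _ = _ := by
        congr 1
        have hv : volume (Metric.ball (0 : E3) r)
            = ENNReal.ofReal (r ^ 3) * volume (Metric.ball (0 : E3) 1) := by
          rw [Measure.addHaar_ball_of_pos _ _ hr]
          simp [E3]
        have hr2 : ENNReal.ofReal (r ^ 2) = ENNReal.ofReal (r ^ 3) * ENNReal.ofReal r⁻¹ := by
          rw [← ENNReal.ofReal_mul (by positivity)]
          congr 1
          field_simp
        rw [hv, hr2]
        ring

/-- Since `|x|⁻¹ = ∫_{|x|}^∞ r⁻² dr`, the weighted integral of `|f|²` is a superposition of its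
integrals over balls. -/
theorem kato_of_stronglyMeasurable {f F : E3 → ℂ} (h : IsFourierPair f F) (hf : StronglyMeasurable f)
    (hF : StronglyMeasurable F) {C : ENNReal} (hC : ∀ R : ℝ, 0 < R →
      ∫⁻ ξ in Metric.ball (0 : E3) R, ENNReal.ofReal (‖ξ‖ ^ 2)⁻¹ ≤ C * ENNReal.ofReal R) :
    ∫⁻ x, ENNReal.ofReal ‖x‖⁻¹ * ‖f x‖ₑ ^ 2
      ≤ (2 * volume (Metric.ball (0 : E3) 1) * C + 2)
        * ∫⁻ ξ, ENNReal.ofReal ‖ξ‖ * ‖F ξ‖ₑ ^ 2 := by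
  have h0 : ∀ᵐ ξ : E3, ξ ≠ 0 := by simp [ae_iff, measure_singleton]
  have hfm : Measurable (fun x => ‖f x‖ₑ ^ 2) := hf.enorm.pow_const 2
  have hFm : Measurable (fun x => ‖F x‖ₑ ^ 2) := hF.enorm.pow_const 2
  set K : ENNReal := 2 * volume (Metric.ball (0 : E3) 1) * C
  -- Tonelli for integrals over balls and over their complements
  have hball : ∀ (w : ℝ → ENNReal) (k : E3 → ENNReal) (S : Set (ℝ × E3)), Measurable w →
      Measurable k → MeasurableSet S →
      ∫⁻ r in Ioi (0 : ℝ), w r * ∫⁻ x in {x | (r, x) ∈ S}, k x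
        = ∫⁻ x, (∫⁻ r in {r | (r, x) ∈ S} ∩ Ioi 0, w r) * k x := by
    intro w k S hw hk hS
    have hS1 : ∀ r, MeasurableSet {x | (r, x) ∈ S} := fun r => measurable_prodMk_left hS
    have hS2 : ∀ x, MeasurableSet {r | (r, x) ∈ S} := fun x => measurable_prodMk_right hS
    have e1 : ∀ r, w r * ∫⁻ x in {x | (r, x) ∈ S}, k x
        = ∫⁻ x, S.indicator (fun q => w q.1 * k q.2) (r, x) := by
      intro r
      rw [← lintegral_const_mul _ hk, ← lintegral_indicator (hS1 r)]
      rfl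
    have e2 : ∀ x, (∫⁻ r in {r | (r, x) ∈ S} ∩ Ioi 0, w r) * k x
        = ∫⁻ r in Ioi (0 : ℝ), S.indicator (fun q => w q.1 * k q.2) (r, x) := by
      intro x
      rw [← lintegral_mul_const _ hw, ← Measure.restrict_restrict (hS2 x),
        ← lintegral_indicator (hS2 x)]
      rfl
    simp_rw [e1, e2]
    refine lintegral_lintegral_swap ?_
    exact (Measurable.indicator (by fun_prop) hS).aemeasurable
  have hS1 : MeasurableSet {q : ℝ × E3 | ‖q.2‖ < q.1} :=
    measurableSet_lt (by fun_prop) (by fun_prop)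
  have hS2 : MeasurableSet {q : ℝ × E3 | ‖q.2‖ < q.1⁻¹} :=
    measurableSet_lt (by fun_prop) (by fun_prop)
  have hl := hball (fun r => ENNReal.ofReal (r ^ 2)⁻¹) (fun x => ‖f x‖ₑ ^ 2) _ (by fun_prop) hfm hS1
  have hr1 := hball (fun _ => 1) (fun ξ => ENNReal.ofReal (‖ξ‖ ^ 2) * ‖F ξ‖ₑ ^ 2) _ (by fun_prop)
    (Measurable.mul (by fun_prop) hFm) hS2
  have hr2 := hball (fun r => ENNReal.ofReal (r ^ 2)⁻¹) (fun x => ‖F x‖ₑ ^ 2) _ (by fun_prop) hFm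
    hS2.compl
  have hset1 : ∀ r : ℝ, {x : E3 | (r, x) ∈ {q : ℝ × E3 | ‖q.2‖ < q.1}} = Metric.ball 0 r := by
    intro r; ext x; simp
  have hset2 : ∀ r : ℝ, {x : E3 | (r, x) ∈ {q : ℝ × E3 | ‖q.2‖ < q.1⁻¹}} = Metric.ball 0 r⁻¹ := by
    intro r; ext x; simp
  have hset3 : ∀ r : ℝ, {x : E3 | (r, x) ∈ {q : ℝ × E3 | ‖q.2‖ < q.1⁻¹}ᶜ}
      = (Metric.ball 0 r⁻¹)ᶜ := by
    intro r; ext x; simp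
  simp only [hset1] at hl
  simp only [hset2, one_mul] at hr1
  simp only [hset3] at hr2
  -- carry out the radial integrals: `∫_{|x|}^∞ r⁻² dr = |x|⁻¹`, `∫_0^{1/|ξ|} dr = |ξ|⁻¹` and
  -- `∫_{1/|ξ|}^∞ r⁻² dr = |ξ|`
  have el : ∫⁻ x, ENNReal.ofReal ‖x‖⁻¹ * ‖f x‖ₑ ^ 2 = ∫⁻ x, (∫⁻ r in {r | (r, x) ∈
      {q : ℝ × E3 | ‖q.2‖ < q.1}} ∩ Ioi 0, ENNReal.ofReal (r ^ 2)⁻¹) * ‖f x‖ₑ ^ 2 := by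
    refine lintegral_congr_ae ?_
    filter_upwards [h0] with x hx
    have hx' := norm_pos_iff.2 hx
    have : {r : ℝ | ‖x‖ < r} ∩ Ioi 0 = Ioi ‖x‖ := by
      ext r
      simp only [mem_ofPred_eq, mem_inter_iff, mem_Ioi, and_iff_left_iff_imp]
      exact fun h => hx'.trans h
    rw [this, lintegral_inv_sq_Ioi hx']
  have er1 : ∫⁻ ξ, (∫⁻ r in {r | (r, ξ) ∈ {q : ℝ × E3 | ‖q.2‖ < q.1⁻¹}} ∩ Ioi 0, 1)
      * (ENNReal.ofReal (‖ξ‖ ^ 2) * ‖F ξ‖ₑ ^ 2) = ∫⁻ ξ, ENNReal.ofReal ‖ξ‖ * ‖F ξ‖ₑ ^ 2 := by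
    refine lintegral_congr_ae ?_
    filter_upwards [h0] with x hx
    have hx' := norm_pos_iff.2 hx
    have : {r : ℝ | ‖x‖ < r⁻¹} ∩ Ioi 0 = Ioo 0 ‖x‖⁻¹ := by
      ext r
      simp only [mem_ofPred_eq, mem_inter_iff, mem_Ioi, mem_Ioo]
      constructor
      · rintro ⟨h1, h2⟩
        exact ⟨h2, (lt_inv_comm₀ hx' h2).1 h1⟩
      · rintro ⟨h2, h1⟩
        exact ⟨(lt_inv_comm₀ hx' h2).2 h1, h2⟩
    rw [this, lintegral_one, Measure.restrict_apply_univ, Real.volume_Ioo, sub_zero, ← mul_assoc,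
      ← ENNReal.ofReal_mul (by positivity)]
    congr 2
    field_simp
  have er2 : ∫⁻ ξ, (∫⁻ r in {r | (r, ξ) ∈ {q : ℝ × E3 | ‖q.2‖ < q.1⁻¹}ᶜ} ∩ Ioi 0,
      ENNReal.ofReal (r ^ 2)⁻¹) * ‖F ξ‖ₑ ^ 2 = ∫⁻ ξ, ENNReal.ofReal ‖ξ‖ * ‖F ξ‖ₑ ^ 2 := by
    refine lintegral_congr_ae ?_
    filter_upwards [h0] with x hx
    have hx' := norm_pos_iff.2 hx
    have : {r | (r, x) ∈ {q : ℝ × E3 | ‖q.2‖ < q.1⁻¹}ᶜ} ∩ Ioi 0 = Ici ‖x‖⁻¹ := by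
      ext r
      simp only [mem_ofPred_eq, mem_inter_iff, mem_Ioi, mem_Ici, mem_compl_iff, not_lt]
      constructor
      · rintro ⟨h1, h2⟩
        exact (inv_le_comm₀ hx' h2).2 h1
      · intro h1
        have h2 : 0 < r := (inv_pos.2 hx').trans_le h1
        exact ⟨(inv_le_comm₀ hx' h2).1 h1, h2⟩
    rw [this, ← restrict_Ioi_eq_restrict_Ici, lintegral_inv_sq_Ioi (inv_pos.2 hx'), inv_inv]
  rw [el, ← hl]
  calc ∫⁻ r in Ioi (0 : ℝ), ENNReal.ofReal (r ^ 2)⁻¹ * ∫⁻ x in Metric.ball (0 : E3) r, ‖f x‖ₑ ^ 2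
      ≤ ∫⁻ r in Ioi (0 : ℝ), (K * (∫⁻ ξ in Metric.ball (0 : E3) r⁻¹,
            ENNReal.ofReal (‖ξ‖ ^ 2) * ‖F ξ‖ₑ ^ 2)
          + 2 * (ENNReal.ofReal (r ^ 2)⁻¹ * ∫⁻ ξ in (Metric.ball (0 : E3) r⁻¹)ᶜ, ‖F ξ‖ₑ ^ 2)) := by
        refine setLIntegral_mono' measurableSet_Ioi fun r hr => ?_
        have hr : 0 < r := hr
        refine (mul_le_mul' le_rfl (lintegral_ball_sq_le h hC hr)).trans_eq ?_
        have : ENNReal.ofReal (r ^ 2)⁻¹ * ENNReal.ofReal (r ^ 2) = 1 := by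
          rw [← ENNReal.ofReal_mul (by positivity), inv_mul_cancel₀ (by positivity),
            ENNReal.ofReal_one]
        rw [mul_add]
        congr 1
        · calc _ = (ENNReal.ofReal (r ^ 2)⁻¹ * ENNReal.ofReal (r ^ 2)) * (K *
                (∫⁻ ξ in Metric.ball (0 : E3) r⁻¹, ENNReal.ofReal (‖ξ‖ ^ 2) * ‖F ξ‖ₑ ^ 2)) := by
                ring
            _ = _ := by rw [this, one_mul]
        · ring
    _ = _ := by
      have hm : Measurable fun r : ℝ => ∫⁻ ξ in Metric.ball (0 : E3) r⁻¹,
          ENNReal.ofReal (‖ξ‖ ^ 2) * ‖F ξ‖ₑ ^ 2 := by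
        have e : ∀ r : ℝ, ∫⁻ ξ in Metric.ball (0 : E3) r⁻¹, ENNReal.ofReal (‖ξ‖ ^ 2) * ‖F ξ‖ₑ ^ 2
            = ∫⁻ ξ, {q : ℝ × E3 | ‖q.2‖ < q.1⁻¹}.indicator
              (fun q => ENNReal.ofReal (‖q.2‖ ^ 2) * ‖F q.2‖ₑ ^ 2) (r, ξ) := by
          intro r
          rw [← hset2, ← lintegral_indicator (hset2 r ▸ Metric.isOpen_ball.measurableSet)]
          rfl
        simp_rw [e]
        have : Measurable ({q : ℝ × E3 | ‖q.2‖ < q.1⁻¹}.indicator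
            fun q => ENNReal.ofReal (‖q.2‖ ^ 2) * ‖F q.2‖ₑ ^ 2) :=
          Measurable.indicator (Measurable.mul (by fun_prop) (hFm.comp measurable_snd)) hS2
        exact this.lintegral_prod_right'
      rw [lintegral_add_left (hm.const_mul K), lintegral_const_mul _ hm,
        lintegral_const_mul' _ _ (by norm_num), hr1, er1, hr2, er2]
      ring

/-- Kato's inequality: `∫ |f|² / |x| ≤ C ∫ |ξ| |f̂|²`. -/
theorem kato : ∃ C : ENNReal, C ≠ ⊤ ∧ ∀ f F : E3 → ℂ, IsFourierPair f F →
    ∫⁻ x, ENNReal.ofReal ‖x‖⁻¹ * ‖f x‖ₑ ^ 2 ≤ C * ∫⁻ ξ, ENNReal.ofReal ‖ξ‖ * ‖F ξ‖ₑ ^ 2 := by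
  obtain ⟨C, hC, hC'⟩ := lintegral_ball_inv_sq
  refine ⟨2 * volume (Metric.ball (0 : E3) 1) * C + 2, ?_, fun f F h => ?_⟩
  · exact ENNReal.add_ne_top.2 ⟨ENNReal.mul_ne_top
      (ENNReal.mul_ne_top (by norm_num) measure_ball_lt_top.ne) hC, by norm_num⟩
  have h1 := h.memLp_left.1
  have h2 := h.memLp_right.1
  have h' := h.congr h1.ae_eq_mk h2.ae_eq_mk
  refine le_trans (le_of_eq ?_) ((kato_of_stronglyMeasurable h' h1.stronglyMeasurable_mk h2.stronglyMeasurable_mk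
    hC').trans_eq ?_)
  · refine lintegral_congr_ae ?_
    filter_upwards [h1.ae_eq_mk] with x hx
    rw [← hx]
  · congr 1
    refine lintegral_congr_ae ?_
    filter_upwards [h2.ae_eq_mk] with x hx
    rw [← hx]

theorem IsFourierPair.integral_schwartz_mul {f F : E3 → ℂ} (h : IsFourierPair f F)
    (φ : 𝓢(E3, ℂ)) : ∫ ξ, φ ξ * F ξ = ∫ x, 𝓕 (φ : E3 → ℂ) x * f x := by
  obtain ⟨h1, h2, h3⟩ := h
  have h := congrArg (fun T : 𝓢'(E3, ℂ) => T φ)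
    (Lp.fourier_toTemperedDistribution_eq (h1.toLp f))
  simp only [TemperedDistribution.fourier_apply, Lp.toTemperedDistribution_apply, smul_eq_mul,
    h3] at h
  rw [← SchwartzMap.fourier_coe]
  calc ∫ ξ, φ ξ * F ξ = ∫ ξ, φ ξ * h2.toLp F ξ := by
        refine integral_congr_ae ?_
        filter_upwards [h2.coeFn_toLp] with x hx
        rw [hx]
    _ = ∫ x, 𝓕 φ x * h1.toLp f x := h.symm
    _ = _ := by
        refine integral_congr_ae ?_
        filter_upwards [h1.coeFn_toLp] with x hx
        rw [hx]

/-- The conjugate of `F` has Fourier transform the conjugate of `f`. -/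
theorem IsFourierPair.conj_swap {f F : E3 → ℂ} (h : IsFourierPair f F) :
    IsFourierPair (fun ξ => conj (F ξ)) (fun x => conj (f x)) := by
  have hF : MemLp (fun ξ => conj (F ξ)) 2 volume := h.memLp_right.star
  have hf : MemLp (fun x => conj (f x)) 2 volume := h.memLp_left.star
  obtain ⟨H, -, hH⟩ := IsFourierPair.exists_right hF
  refine hH.congr (EventuallyEq.refl _ _) (integral_schwartz_mul_eq_imp_ae_eq
    (hH.memLp_right.locallyIntegrable (by norm_num)) (hf.locallyIntegrable (by norm_num))
    fun φ => ?_)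
  rw [hH.integral_schwartz_mul]
  have := h.integral_conj_mul (isFourierPair_schwartz φ)
  simp_rw [mul_comm (φ _), mul_comm (𝓕 (φ : E3 → ℂ) _)]
  exact this.symm

/-- Kato's inequality with the roles of a function and its Fourier transform exchanged. -/
theorem kato_dual : ∃ C : ENNReal, C ≠ ⊤ ∧ ∀ f F : E3 → ℂ, IsFourierPair f F →
    ∫⁻ ξ, ENNReal.ofReal ‖ξ‖⁻¹ * ‖F ξ‖ₑ ^ 2 ≤ C * ∫⁻ x, ENNReal.ofReal ‖x‖ * ‖f x‖ₑ ^ 2 := by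
  obtain ⟨C, hC, hC'⟩ := kato
  refine ⟨C, hC, fun f F h => ?_⟩
  have e : ∀ z : ℂ, ‖conj z‖ₑ = ‖z‖ₑ := fun z => by
    rw [← ofReal_norm, Complex.norm_conj, ofReal_norm]
  simpa only [e] using hC' _ _ h.conj_swap

/-! ### Newton's theorem -/

/-- Integration in the coordinates `y₀` and `(y₁, y₂)` of a function of `(y₀, |y|)`. -/
theorem lintegral_cylindrical {F : ℝ × ℝ → ENNReal} (hF : Measurable F) :
    ∫⁻ y : E3, F (y 0, ‖y‖) = ∫⁻ z : ℝ, ∫⁻ q : ℝ × ℝ, F (z, √(z ^ 2 + (q.1 ^ 2 + q.2 ^ 2))) := by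
  have h1 := EuclideanSpace.volume_preserving_symm_measurableEquiv_toLp (Fin 3)
  have h2 := (volume_preserving_piFinSuccAbove (fun _ : Fin 3 => ℝ) 0)
  have h3 := (MeasurePreserving.id (volume : Measure ℝ)).prod
    (volume_preserving_finTwoArrow ℝ)
  have h := (h3.comp h2).comp h1
  have hm : Measurable fun p : ℝ × (ℝ × ℝ) => F (p.1, √(p.1 ^ 2 + (p.2.1 ^ 2 + p.2.2 ^ 2))) :=
    hF.comp (by fun_prop)
  rw [← lintegral_prod _ hm.aemeasurable]
  have := h.lintegral_comp hm
  rw [← Measure.volume_eq_prod] at this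
  rw [← Measure.volume_eq_prod, ← this]
  congr 1 with y
  congr 2
  rw [EuclideanSpace.norm_eq, Fin.sum_univ_three]
  simp [MeasurableEquiv.piFinSuccAbove, Fin.insertNthEquiv, add_assoc,
    MeasurableEquiv.finTwoArrow]
  rfl

theorem lintegral_polar {G : ℝ → ENNReal} (hG : Measurable G) :
    ∫⁻ q : ℝ × ℝ, G (q.1 ^ 2 + q.2 ^ 2)
      = ENNReal.ofReal (2 * Real.pi) * ∫⁻ ρ in Ioi (0 : ℝ), ENNReal.ofReal ρ * G (ρ ^ 2) := by
  rw [← lintegral_comp_polarCoord_symm, polarCoord_target, Measure.volume_eq_prod,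
    setLIntegral_prod]
  · rw [← lintegral_const_mul _ (by fun_prop)]
    refine setLIntegral_congr_fun measurableSet_Ioi fun ρ hρ => ?_
    have : ∀ θ : ℝ, (ρ * Real.cos θ) ^ 2 + (ρ * Real.sin θ) ^ 2 = ρ ^ 2 := fun θ => by
      linear_combination ρ ^ 2 * Real.sin_sq_add_cos_sq θ
    simp only [polarCoord_symm_apply, this, smul_eq_mul, lintegral_const,
      Measure.restrict_apply_univ, Real.volume_Ioo]
    rw [mul_comm]
    congr 2
    ring
  · refine Measurable.aemeasurable ?_
    simp only [polarCoord_symm_apply, smul_eq_mul]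
    fun_prop

theorem lintegral_half_polar {H : ℝ × ℝ → ENNReal} (hH : Measurable H) :
    ∫⁻ z : ℝ, ∫⁻ ρ in Ioi (0 : ℝ), H (z, ρ)
      = ∫⁻ r in Ioi (0 : ℝ), ∫⁻ α in Ioo 0 Real.pi,
        ENNReal.ofReal r * H (r * Real.cos α, r * Real.sin α) := by
  set S : Set (ℝ × ℝ) := {p | 0 < p.2} with hS
  have hSm : MeasurableSet S := measurableSet_lt measurable_const measurable_snd
  have hm : Measurable (S.indicator H) := hH.indicator hSm
  have e1 : ∫⁻ z : ℝ, ∫⁻ ρ in Ioi (0 : ℝ), H (z, ρ) = ∫⁻ p : ℝ × ℝ, S.indicator H p := by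
    rw [Measure.volume_eq_prod, lintegral_prod _ hm.aemeasurable]
    congr 1 with z
    rw [← lintegral_indicator measurableSet_Ioi]
    rfl
  rw [e1, ← lintegral_comp_polarCoord_symm, polarCoord_target, Measure.volume_eq_prod,
    setLIntegral_prod]
  · refine setLIntegral_congr_fun measurableSet_Ioi fun r hr => ?_
    have hr : 0 < r := hr
    simp only [polarCoord_symm_apply, smul_eq_mul]
    rw [← lintegral_indicator measurableSet_Ioo, ← lintegral_indicator measurableSet_Ioo]
    congr 1 with α
    by_cases hα : α ∈ Ioo 0 Real.pi
    · have h1 : α ∈ Ioo (-Real.pi) Real.pi := ⟨by linarith [hα.1, Real.pi_pos], hα.2⟩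
      have h2 : (r * Real.cos α, r * Real.sin α) ∈ S :=
        mul_pos hr (Real.sin_pos_of_mem_Ioo hα)
      rw [indicator_of_mem h1, indicator_of_mem hα, indicator_of_mem h2]
    · rw [indicator_of_notMem hα]
      by_cases h1 : α ∈ Ioo (-Real.pi) Real.pi
      · have h2 : (r * Real.cos α, r * Real.sin α) ∉ S := by
          simp only [hS, mem_ofPred_eq, not_lt]
          have : α ≤ 0 := by
            by_contra h
            exact hα ⟨not_le.1 h, h1.2⟩
          exact mul_nonpos_of_nonneg_of_nonpos hr.le
            (Real.sin_nonpos_of_nonpos_of_neg_pi_le this h1.1.le)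
        rw [indicator_of_mem h1, indicator_of_notMem h2, mul_zero]
      · rw [indicator_of_notMem h1]
  · refine Measurable.aemeasurable ?_
    simp only [polarCoord_symm_apply, smul_eq_mul]
    exact Measurable.mul (by fun_prop) (hm.comp (by fun_prop))

/-- Integration in spherical coordinates of a function of `(y₀, |y|)`. -/
theorem lintegral_spherical {F : ℝ × ℝ → ENNReal} (hF : Measurable F) :
    ∫⁻ y : E3, F (y 0, ‖y‖) = ENNReal.ofReal (2 * Real.pi) * ∫⁻ r in Ioi (0 : ℝ),
      ENNReal.ofReal (r ^ 2) * ∫⁻ α in Ioo 0 Real.pi,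
        ENNReal.ofReal (Real.sin α) * F (r * Real.cos α, r) := by
  rw [lintegral_cylindrical hF]
  have e1 : ∀ z : ℝ, ∫⁻ q : ℝ × ℝ, F (z, √(z ^ 2 + (q.1 ^ 2 + q.2 ^ 2)))
      = ENNReal.ofReal (2 * Real.pi)
        * ∫⁻ ρ in Ioi (0 : ℝ), ENNReal.ofReal ρ * F (z, √(z ^ 2 + ρ ^ 2)) := fun z =>
    lintegral_polar (G := fun s => F (z, √(z ^ 2 + s))) (hF.comp (by fun_prop))
  have hm : Measurable fun p : ℝ × ℝ => ENNReal.ofReal p.2 * F (p.1, √(p.1 ^ 2 + p.2 ^ 2)) :=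
    Measurable.mul (by fun_prop) (hF.comp (by fun_prop))
  simp_rw [e1]
  rw [lintegral_const_mul' _ _ ENNReal.ofReal_ne_top, lintegral_half_polar hm]
  congr 1
  refine setLIntegral_congr_fun measurableSet_Ioi fun r hr => ?_
  have hr : 0 < r := hr
  rw [← lintegral_const_mul' _ _ ENNReal.ofReal_ne_top]
  refine setLIntegral_congr_fun measurableSet_Ioo fun α hα => ?_
  have h1 : (r * Real.cos α) ^ 2 + (r * Real.sin α) ^ 2 = r ^ 2 := by
    linear_combination r ^ 2 * Real.sin_sq_add_cos_sq α
  simp only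
  rw [h1, Real.sqrt_sq hr.le, ← mul_assoc, ← mul_assoc, ← ENNReal.ofReal_mul hr.le,
    ← ENNReal.ofReal_mul (by positivity)]
  ring_nf

theorem lintegral_sin : ∫⁻ α in Ioo 0 Real.pi, ENNReal.ofReal (Real.sin α) = 2 := by
  rw [← ofReal_integral_eq_lintegral_ofReal, ← integral_Ioc_eq_integral_Ioo,
    ← intervalIntegral.integral_of_le Real.pi_pos.le, integral_sin]
  · norm_num
  · exact (Real.continuous_sin.integrableOn_Icc).mono_set Ioo_subset_Icc_self
  · refine (ae_restrict_iff' measurableSet_Ioo).2 (Eventually.of_forall fun α hα => ?_)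
    exact (Real.sin_pos_of_mem_Ioo hα).le

/-- The mean of `|x - y|⁻¹` over the sphere `|y| = r`, for `|x| = a`: the integrand has an explicit
primitive in the polar angle. -/
theorem lintegral_sin_div_sqrt {a r : ℝ} (ha : 0 < a) (hr : 0 < r) (har : r ≠ a) :
    ∫⁻ α in Ioo 0 Real.pi, ENNReal.ofReal (Real.sin α)
        * ENNReal.ofReal (√(a ^ 2 - 2 * a * (r * Real.cos α) + r ^ 2))⁻¹
      = 2 * ENNReal.ofReal (min a⁻¹ r⁻¹) := by
  have hpos : ∀ α, 0 < a ^ 2 - 2 * a * (r * Real.cos α) + r ^ 2 := fun α => by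
    have h1 : 0 < (r - a) ^ 2 := by
      have := sub_ne_zero.2 har
      positivity
    nlinarith [mul_nonneg (mul_pos ha hr).le (sub_nonneg.2 (Real.cos_le_one α))]
  have hc : Continuous fun α => Real.sin α * (√(a ^ 2 - 2 * a * (r * Real.cos α) + r ^ 2))⁻¹ :=
    Real.continuous_sin.mul (Continuous.inv₀ (by fun_prop) fun α => (Real.sqrt_pos.2 (hpos α)).ne')
  have hder : ∀ α : ℝ, HasDerivAt
      (fun α => √(a ^ 2 - 2 * a * (r * Real.cos α) + r ^ 2) / (a * r))
      (Real.sin α * (√(a ^ 2 - 2 * a * (r * Real.cos α) + r ^ 2))⁻¹) α := fun α => by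
    have h1 : HasDerivAt (fun α => a ^ 2 - 2 * a * (r * Real.cos α) + r ^ 2)
        (2 * a * (r * Real.sin α)) α := by
      have := (((Real.hasDerivAt_cos α).const_mul r).const_mul (2 * a)).const_sub (a ^ 2)
        |>.add_const (r ^ 2)
      exact this.congr_deriv (by ring)
    refine ((h1.sqrt (hpos α).ne').div_const (a * r)).congr_deriv ?_
    have := (Real.sqrt_pos.2 (hpos α)).ne'
    field_simp
  have e : ∀ α ∈ Ioo 0 Real.pi, ENNReal.ofReal (Real.sin α)
        * ENNReal.ofReal (√(a ^ 2 - 2 * a * (r * Real.cos α) + r ^ 2))⁻¹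
      = ENNReal.ofReal (Real.sin α * (√(a ^ 2 - 2 * a * (r * Real.cos α) + r ^ 2))⁻¹) :=
    fun α hα => (ENNReal.ofReal_mul (Real.sin_pos_of_mem_Ioo hα).le).symm
  rw [setLIntegral_congr_fun measurableSet_Ioo e, ← ofReal_integral_eq_lintegral_ofReal,
    ← integral_Ioc_eq_integral_Ioo, ← intervalIntegral.integral_of_le Real.pi_pos.le,
    intervalIntegral.integral_eq_sub_of_hasDerivAt (fun α _ => hder α)
      (hc.intervalIntegrable _ _)]
  · have h2 : (2 : ENNReal) = ENNReal.ofReal 2 := by norm_num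
    rw [h2, ← ENNReal.ofReal_mul (by norm_num)]
    congr 1
    have e1 : a ^ 2 - 2 * a * (r * Real.cos Real.pi) + r ^ 2 = (a + r) ^ 2 := by
      rw [Real.cos_pi]; ring
    have e2 : a ^ 2 - 2 * a * (r * Real.cos 0) + r ^ 2 = (a - r) ^ 2 := by
      rw [Real.cos_zero]; ring
    rw [e1, e2, Real.sqrt_sq (by positivity), Real.sqrt_sq_eq_abs]
    rcases le_total a r with h | h
    · rw [abs_of_nonpos (by linarith), min_eq_right (inv_anti₀ ha h)]
      field_simp
      ring
    · rw [abs_of_nonneg (by linarith), min_eq_left (inv_anti₀ hr h)]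
      field_simp
      ring
  · exact hc.integrableOn_Icc.mono_set Ioo_subset_Icc_self
  · refine (ae_restrict_iff' measurableSet_Ioo).2 (Eventually.of_forall fun α hα => ?_)
    exact mul_nonneg (Real.sin_pos_of_mem_Ioo hα).le (by positivity)

/-- Newton's theorem: the potential at `x` of a radial density, in which the mean of `|x - y|⁻¹` over a
sphere `|y| = r` is `min (|x|⁻¹) (r⁻¹)`. -/
theorem lintegral_newton {k : ℝ → ENNReal} (hk : Measurable k) {x : E3} (hx : x ≠ 0) :
    ∫⁻ y : E3, ENNReal.ofReal ‖x - y‖⁻¹ * k ‖y‖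
      = ∫⁻ y : E3, ENNReal.ofReal (min ‖x‖⁻¹ ‖y‖⁻¹) * k ‖y‖ := by
  set a := ‖x‖ with ha
  have ha0 : 0 < a := norm_pos_iff.2 hx
  -- a reflection moves `x` to the first coordinate axis
  obtain ⟨L, hL⟩ : ∃ L : E3 ≃ₗᵢ[ℝ] E3, L x = EuclideanSpace.single 0 a :=
    ⟨_, Submodule.reflection_sub (v := x) (w := EuclideanSpace.single 0 a) (by simp [ha])⟩
  have hrot : ∫⁻ y : E3, ENNReal.ofReal ‖x - y‖⁻¹ * k ‖y‖
      = ∫⁻ y : E3, ENNReal.ofReal (√(a ^ 2 - 2 * a * y 0 + ‖y‖ ^ 2))⁻¹ * k ‖y‖ := by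
    have hm : Measurable fun y : E3 =>
        ENNReal.ofReal (√(a ^ 2 - 2 * a * y 0 + ‖y‖ ^ 2))⁻¹ * k ‖y‖ :=
      Measurable.mul (by fun_prop) (hk.comp measurable_norm)
    rw [← L.measurePreserving.lintegral_comp hm]
    congr 1 with y
    rw [L.norm_map, ← L.norm_map (x - y), map_sub, hL]
    congr 3
    rw [← L.norm_map y, EuclideanSpace.norm_eq, EuclideanSpace.norm_eq,
      Real.sq_sqrt (Finset.sum_nonneg fun i _ => by positivity)]
    congr 1
    simp only [Fin.sum_univ_three, PiLp.sub_apply, Real.norm_eq_abs, sq_abs]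
    simp
    ring
  have e1 := lintegral_spherical (F := fun p =>
    ENNReal.ofReal (√(a ^ 2 - 2 * a * p.1 + p.2 ^ 2))⁻¹ * k p.2)
    (Measurable.mul (by fun_prop) (hk.comp measurable_snd))
  have e2 := lintegral_spherical (F := fun p => ENNReal.ofReal (min a⁻¹ p.2⁻¹) * k p.2)
    (Measurable.mul (by fun_prop) (hk.comp measurable_snd))
  rw [hrot, e1, e2]
  congr 1
  -- the spherical mean is computed for `r ≠ a`, where the kernel is bounded
  have h0 : ∀ᵐ r : ℝ, r ≠ a := by simp [ae_iff, measure_singleton]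
  refine lintegral_congr_ae ?_
  filter_upwards [ae_restrict_of_ae h0, ae_restrict_mem measurableSet_Ioi] with r hra hr
  have hr : 0 < r := hr
  congr 1
  simp_rw [← mul_assoc (ENNReal.ofReal _)]
  rw [lintegral_mul_const _ (by fun_prop), lintegral_mul_const _ (by fun_prop),
    lintegral_mul_const _ (by fun_prop), lintegral_sin_div_sqrt ha0 hr hra, lintegral_sin]

/-! ### The potential of a radial density -/

/-- The Newton potential of the spherical mean of `|u|²`. By Newton's theorem it agrees with
`|x|⁻¹ ∗ |u|²` for radial `u`. At `x = 0`, where `‖x‖⁻¹ = 0` by convention, it takes the junk value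
`0`; the value at the origin is `centralPotential`. -/
noncomputable def potential (u : E3 → ℝ) (x : E3) : ℝ :=
  ∫ y, min ‖x‖⁻¹ ‖y‖⁻¹ * |u y| ^ 2

/-- The potential of `|u|²` at the origin. -/
noncomputable def centralPotential (u : E3 → ℝ) : ℝ :=
  ∫ y, ‖y‖⁻¹ * |u y| ^ 2

section

variable {u : E3 → ℝ}

theorem integrable_min_mul (hK : Integrable fun y => ‖y‖⁻¹ * |u y| ^ 2)
    (h2 : Integrable fun y => |u y| ^ 2) (x : E3) :
    Integrable fun y => min ‖x‖⁻¹ ‖y‖⁻¹ * |u y| ^ 2 := by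
  refine hK.mono' (AEStronglyMeasurable.mul
    (by fun_prop : Measurable fun y : E3 => min ‖x‖⁻¹ ‖y‖⁻¹).aestronglyMeasurable
    h2.aestronglyMeasurable) (Eventually.of_forall fun y => ?_)
  rw [Real.norm_of_nonneg (by positivity)]
  gcongr
  exact min_le_right _ _

theorem potential_nonneg (x : E3) : 0 ≤ potential u x :=
  integral_nonneg fun y => by positivity

theorem potential_le_centralPotential (hK : Integrable fun y => ‖y‖⁻¹ * |u y| ^ 2)
    (h2 : Integrable fun y => |u y| ^ 2) (x : E3) : potential u x ≤ centralPotential u := by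
  refine integral_mono (integrable_min_mul hK h2 x) hK fun y => ?_
  show min ‖x‖⁻¹ ‖y‖⁻¹ * |u y| ^ 2 ≤ ‖y‖⁻¹ * |u y| ^ 2
  gcongr
  exact min_le_right _ _

theorem norm_mul_potential_le (hK : Integrable fun y => ‖y‖⁻¹ * |u y| ^ 2)
    (h2 : Integrable fun y => |u y| ^ 2) (x : E3) :
    ‖x‖ * potential u x ≤ ∫ y, |u y| ^ 2 := by
  rw [potential, ← integral_const_mul]
  refine integral_mono ((integrable_min_mul hK h2 x).const_mul _) h2 fun y => ?_
  show ‖x‖ * (min ‖x‖⁻¹ ‖y‖⁻¹ * |u y| ^ 2) ≤ |u y| ^ 2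
  rw [← mul_assoc]
  refine mul_le_of_le_one_left (by positivity) ?_
  exact (mul_le_mul_of_nonneg_left (min_le_left _ _) (norm_nonneg _)).trans (mul_inv_le_one)

theorem stronglyMeasurable_potential (h2 : Integrable fun y => |u y| ^ 2) :
    StronglyMeasurable (potential u) := by
  have e : potential u = fun x => ∫ y, min ‖x‖⁻¹ ‖y‖⁻¹ * h2.aestronglyMeasurable.mk _ y := by
    ext x
    refine integral_congr_ae ?_
    filter_upwards [h2.aestronglyMeasurable.ae_eq_mk] with y hy
    rw [← hy]
  rw [e]
  refine StronglyMeasurable.integral_prod_right (f := fun x y =>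
    min ‖x‖⁻¹ ‖y‖⁻¹ * h2.aestronglyMeasurable.mk _ y) ?_
  exact (by fun_prop : Measurable fun p : E3 × E3 => min ‖p.1‖⁻¹ ‖p.2‖⁻¹).stronglyMeasurable.mul
    (h2.aestronglyMeasurable.stronglyMeasurable_mk.comp_measurable measurable_snd)

theorem potential_pos (hK : Integrable fun y => ‖y‖⁻¹ * |u y| ^ 2)
    (h2 : Integrable fun y => |u y| ^ 2) (hpos : ∀ᵐ y, 0 < u y) {x : E3} (hx : x ≠ 0) :
    0 < potential u x := by
  refine (potential_nonneg x).lt_of_ne fun h => ?_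
  have h0 : ∀ᵐ ξ : E3, ξ ≠ 0 := by simp [ae_iff, measure_singleton]
  have h1 := (integral_eq_zero_iff_of_nonneg (fun y => by positivity)
    (integrable_min_mul hK h2 x)).1 h.symm
  have : ∀ᵐ y : E3, False := by
    filter_upwards [h0, h1, hpos] with y hy hy1 hy2
    have : 0 < min ‖x‖⁻¹ ‖y‖⁻¹ * |u y| ^ 2 := by
      have := abs_pos.2 hy2.ne'
      have := norm_pos_iff.2 hx
      have := norm_pos_iff.2 hy
      positivity
    exact this.ne' hy1
  exact (NeZero.ne (volume : Measure E3)) (by simpa using this)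

/-- Newton's theorem for the radial density `|u|²` turns `Φ_u` into a constant minus a decaying
potential. -/
theorem phi_eq (hK : Integrable fun y => ‖y‖⁻¹ * |u y| ^ 2)
    (h2 : Integrable fun y => |u y| ^ 2) {x : E3} (hx : x ≠ 0) :
    Phi u x = centralPotential u - potential u x := by
  have h0 : ∀ᵐ ξ : E3, ξ ≠ 0 := by simp [ae_iff, measure_singleton]
  have hm : MeasurableSet {y : E3 | ‖y‖ < ‖x‖} :=
    measurableSet_lt measurable_norm measurable_const
  rw [Phi, centralPotential, potential, ← integral_sub hK (integrable_min_mul hK h2 x),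
    ← integral_indicator hm]
  refine integral_congr_ae ?_
  filter_upwards [h0] with y hy
  have hx' := norm_pos_iff.2 hx
  have hy' := norm_pos_iff.2 hy
  by_cases h : ‖y‖ < ‖x‖
  · rw [indicator_of_mem (by exact h), min_eq_left (inv_anti₀ hy' h.le)]
    ring
  · rw [indicator_of_notMem (by exact h), min_eq_right (inv_anti₀ hx' (not_lt.1 h))]
    ring

end

/-- A radial function is almost everywhere equal to a measurable function of `|x|`: restrict a measurable
representative to a ray in almost any direction `θ`. -/
theorem IsRadial.exists_measurable {w : E3 → ℝ} (hw : AEMeasurable w) (h : IsRadial w) :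
    ∃ g : ℝ → ℝ, Measurable g ∧ ∀ᵐ x, w x = g ‖x‖ := by
  obtain ⟨g, hg⟩ := h
  have hmp := (volume : Measure E3).measurePreserving_homeomorphUnitSphereProd
  set v := hw.mk w
  have hv : Measurable v := hw.measurable_mk
  have hvg : ∀ᵐ x, v x = g ‖x‖ := by
    filter_upwards [hg, hw.ae_eq_mk] with x h1 h2
    exact h2.symm.trans h1
  have h1 : ∀ᵐ p ∂(volume : Measure E3).toSphere.prod (Measure.volumeIoiPow (Module.finrank ℝ E3 - 1)),
      v ((p.2 : ℝ) • (p.1 : E3)) = g p.2 := by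
    have hcomap := (ae_restrict_iff_subtype (measurableSet_singleton (0 : E3)).compl).1
      (ae_restrict_of_ae (s := {0}ᶜ) hvg)
    rw [← hmp.map_eq]
    refine ((homeomorphUnitSphereProd E3).measurableEmbedding.ae_map_iff).2 ?_
    filter_upwards [hcomap] with y hy
    have : ‖(y : E3)‖ ≠ 0 := norm_ne_zero_iff.2 y.2
    simp only [homeomorphUnitSphereProd_apply_fst_coe, homeomorphUnitSphereProd_apply_snd_coe]
    rw [smul_smul, mul_inv_cancel₀ this, one_smul, hy]
  have : NeBot (ae (volume : Measure E3).toSphere) := ae_neBot.2 (Measure.toSphere_ne_zero _)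
  -- polar coordinates: for almost every direction `θ`, the identity holds along the ray
  obtain ⟨θ, hθ⟩ := (Measure.ae_ae_of_ae_prod h1).exists
  refine ⟨fun r => v (r • (θ : E3)), hv.comp (by fun_prop), ?_⟩
  have h2 : ∀ᵐ p ∂(volume : Measure E3).toSphere.prod (Measure.volumeIoiPow (Module.finrank ℝ E3 - 1)),
      v ((p.2 : ℝ) • (θ : E3)) = g p.2 :=
    Measure.quasiMeasurePreserving_snd.ae hθ
  rw [← hmp.map_eq, (homeomorphUnitSphereProd E3).measurableEmbedding.ae_map_iff] at h2
  simp only [homeomorphUnitSphereProd_apply_snd_coe] at h2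
  have h3 := (ae_restrict_iff_subtype (μ := (volume : Measure E3))
    (p := fun y => v (‖y‖ • (θ : E3)) = g ‖y‖) (measurableSet_singleton (0 : E3)).compl).2 h2
  rw [ae_restrict_iff' (measurableSet_singleton _).compl] at h3
  have h0 : ∀ᵐ ξ : E3, ξ ≠ 0 := by simp [ae_iff, measure_singleton]
  filter_upwards [hg, h3, h0] with y h4 h5 h6
  rw [h4, h5 h6]

theorem newtonPotential_eq {w : E3 → ℝ} (hw : AEMeasurable w) (hrad : IsRadial w)
    (hK : Integrable fun y => ‖y‖⁻¹ * |w y| ^ 2) (h2 : Integrable fun y => |w y| ^ 2)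
    {x : E3} (hx : x ≠ 0) : newtonPotential w x = potential w x := by
  obtain ⟨g, hg, hwg⟩ := hrad.exists_measurable hw
  have key := lintegral_newton (k := fun r => ENNReal.ofReal (|g r| ^ 2)) (by fun_prop) hx
  have hm2 := h2.aestronglyMeasurable
  have hm3 : AEStronglyMeasurable (fun y => ‖x - y‖⁻¹ * |w y| ^ 2) volume :=
    (by fun_prop : Measurable fun y : E3 => ‖x - y‖⁻¹).aestronglyMeasurable.mul hm2
  rw [newtonPotential, potential, integral_eq_lintegral_of_nonneg_ae
    (Eventually.of_forall fun y => by positivity) hm3, integral_eq_lintegral_of_nonneg_ae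
    (Eventually.of_forall fun y => by positivity)
    (integrable_min_mul hK h2 x).aestronglyMeasurable]
  congr 1
  calc _ = ∫⁻ y : E3, ENNReal.ofReal ‖x - y‖⁻¹ * ENNReal.ofReal (|g ‖y‖| ^ 2) := by
        refine lintegral_congr_ae ?_
        filter_upwards [hwg] with y hy
        rw [ENNReal.ofReal_mul (by positivity), hy]
    _ = _ := key
    _ = _ := by
        refine lintegral_congr_ae ?_
        filter_upwards [hwg] with y hy
        rw [ENNReal.ofReal_mul (by positivity), hy]

/-! ### The equation in Fourier space -/

theorem locallyIntegrable_continuous_mul {m f : E3 → ℂ} (hm : Continuous m)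
    (hf : MemLp f 2 volume) : LocallyIntegrable (fun x => m x * f x) := by
  rw [locallyIntegrable_iff]
  exact fun k hk => ((hf.locallyIntegrable (by norm_num)).integrableOn_isCompact hk).continuousOn_mul
    hm.continuousOn hk

/-- A real distributional solution of `√(-Δ) u = q` in `L²` satisfies the equation for the
Fourier transforms. -/
theorem symbol_mul_ae_eq {u q : E3 → ℝ} {U Q : E3 → ℂ}
    (hu : IsFourierPair (fun x => (u x : ℂ)) U) (hq : IsFourierPair (fun x => (q x : ℂ)) Q)
    (h : ∀ φ : 𝓢(E3, ℂ), ∫ x, (u x : ℂ) * sqrtLaplacian φ x = ∫ x, (q x : ℂ) * φ x) :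
    ∀ᵐ ξ, ((2 * Real.pi * ‖ξ‖ : ℝ) : ℂ) * U ξ = Q ξ := by
  have key : (fun ξ => conj (((2 * Real.pi * ‖ξ‖ : ℝ) : ℂ) * U ξ)) =ᵐ[volume]
      fun ξ => conj (Q ξ) := by
    refine integral_schwartz_mul_eq_imp_ae_eq ?_ ?_ fun θ => ?_
    · have hc : Continuous fun ξ : E3 => ((2 * Real.pi * ‖ξ‖ : ℝ) : ℂ) := by fun_prop
      have := locallyIntegrable_continuous_mul hc hu.memLp_right.star
      refine LocallyIntegrable.congr this (Eventually.of_forall fun ξ => ?_)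
      simp only [map_mul, Complex.conj_ofReal]
      rfl
    · exact (hq.memLp_right.star : MemLp (fun ξ => conj (Q ξ)) 2 volume).locallyIntegrable
        (by norm_num)
    · set φ : 𝓢(E3, ℂ) := 𝓕⁻ θ
      have hφ : 𝓕 (φ : E3 → ℂ) = θ := by
        rw [← SchwartzMap.fourier_coe]
        simp [φ]
      have h1 := hu.integral_conj_mul (isFourierPair_sqrtLaplacian φ)
      have h2 := hq.integral_conj_mul (isFourierPair_schwartz φ)
      rw [hφ] at h1 h2
      simp only [Complex.conj_ofReal] at h1 h2
      calc _ = ∫ ξ, conj (U ξ) * (((2 * Real.pi * ‖ξ‖ : ℝ) : ℂ) * θ ξ) := by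
            congr 1 with ξ
            rw [map_mul, Complex.conj_ofReal]
            ring
        _ = ∫ ξ, conj (Q ξ) * θ ξ := by rw [← h1, ← h2, h φ]
        _ = _ := by simp_rw [mul_comm]
  filter_upwards [key] with ξ hξ
  exact (starRingEnd ℂ).injective hξ

/-- The Fourier transform of a function in `H^{1/2}` is square integrable against `|ξ|`. -/
theorem lintegral_norm_mul_fourier_lt_top {f F : E3 → ℂ} (h : IsFourierPair f F)
    (hs : TemperedDistribution.MemSobolev (1 / 2) 2 (h.memLp_left.toLp : 𝓢'(E3, ℂ))) :
    ∫⁻ ξ, ENNReal.ofReal ‖ξ‖ * ‖F ξ‖ₑ ^ 2 < ⊤ := by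
  obtain ⟨g, hg⟩ := TemperedDistribution.memSobolev_iff_exists_smulLeftCLM_fourier.1 hs
  have hm : (fun x : E3 => (((1 + ‖x‖ ^ 2) ^ ((1 / 2 : ℝ) / 2) : ℝ) : ℂ)).HasTemperateGrowth := by
    fun_prop
  have hc : Continuous (fun x : E3 => (((1 + ‖x‖ ^ 2) ^ ((1 / 2 : ℝ) / 2) : ℝ) : ℂ)) :=
    hm.1.continuous
  have key : (fun x : E3 => (((1 + ‖x‖ ^ 2) ^ ((1 / 2 : ℝ) / 2) : ℝ) : ℂ) * F x) =ᵐ[volume] g := by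
    refine integral_schwartz_mul_eq_imp_ae_eq ?_ ((Lp.memLp g).locallyIntegrable (by norm_num))
      fun φ => ?_
    · exact locallyIntegrable_continuous_mul hc h.memLp_right
    · have h1 := congrArg (fun T : 𝓢'(E3, ℂ) => T φ) hg
      simp only [TemperedDistribution.smulLeftCLM_apply_apply,
        TemperedDistribution.fourier_apply, Lp.toTemperedDistribution_apply, smul_eq_mul] at h1
      rw [← h1]
      have h2 := h.integral_schwartz_mul (SchwartzMap.smulLeftCLM ℂ
        (fun x : E3 => (((1 + ‖x‖ ^ 2) ^ ((1 / 2 : ℝ) / 2) : ℝ) : ℂ)) φ)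
      rw [← SchwartzMap.fourier_coe] at h2
      calc _ = _ := by
            refine integral_congr_ae (Eventually.of_forall fun x => ?_)
            simp only [SchwartzMap.smulLeftCLM_apply_apply hm, smul_eq_mul]
            ring
        _ = _ := h2
        _ = _ := by
            refine integral_congr_ae ?_
            filter_upwards [h.memLp_left.coeFn_toLp] with x hx
            rw [hx]
  have hg2 := (memLp_two_iff_lintegral (Lp.memLp g).1).1 (Lp.memLp g)
  -- `|ξ| ≤ (1 + |ξ|²)^{1/2}`
  refine lt_of_le_of_lt (lintegral_mono_ae ?_) hg2
  filter_upwards [key] with ξ hξ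
  rw [← hξ, enorm_mul, mul_pow]
  refine mul_le_mul' ?_ le_rfl
  rw [← ofReal_norm, ← ENNReal.ofReal_pow (norm_nonneg _), Complex.norm_real,
    Real.norm_of_nonneg (by positivity), ← Real.rpow_natCast, ← Real.rpow_mul (by positivity)]
  refine ENNReal.ofReal_le_ofReal ?_
  have : (1 / 2 : ℝ) / 2 * (2 : ℕ) = 1 / 2 := by norm_num
  rw [this, ← Real.sqrt_eq_rpow]
  exact Real.le_sqrt_of_sq_le (by linarith)

theorem memLp_ofReal_mul_of_bound {u V : E3 → ℝ} (hu : MemLp (fun x => (u x : ℂ)) 2 volume)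
    (hV : Measurable V) {C : ℝ} (hC : ∀ x, |V x| ≤ C) :
    MemLp (fun x => ((V x * u x : ℝ) : ℂ)) 2 volume := by
  have hm : AEStronglyMeasurable (fun x => ((V x * u x : ℝ) : ℂ)) volume := by
    have : (fun x => ((V x * u x : ℝ) : ℂ)) = fun x => (V x : ℂ) * (u x : ℂ) := by
      ext x; push_cast; ring
    rw [this]
    exact (Complex.measurable_ofReal.comp hV).aestronglyMeasurable.mul hu.1
  refine hu.of_le_mul (c := C) hm (Eventually.of_forall fun x => ?_)
  rw [Complex.ofReal_mul, norm_mul, Complex.norm_real]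
  exact mul_le_mul_of_nonneg_right (hC x) (norm_nonneg _)

theorem integrable_sq_of_memLp {u : E3 → ℝ} (hu : MemLp (fun x => (u x : ℂ)) 2 volume) :
    Integrable fun x => |u x| ^ 2 := by
  simpa using (memLp_two_iff_integrable_sq_norm hu.1).1 hu

/-- `w` has finite potential at the origin, by Kato's inequality. -/
theorem IsGroundState.integrable_inv_mul {w : E3 → ℝ} (hw : IsGroundState w) :
    Integrable fun y => ‖y‖⁻¹ * |w y| ^ 2 := by
  obtain ⟨C, hC, hkato⟩ := kato
  obtain ⟨W, -, hW⟩ := IsFourierPair.exists_right hw.memLp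
  have h1 := hkato _ _ hW
  have h2 := lintegral_norm_mul_fourier_lt_top hW hw.memSobolev
  refine ⟨(by fun_prop : Measurable fun y : E3 => ‖y‖⁻¹).aestronglyMeasurable.mul
    (integrable_sq_of_memLp hw.memLp).aestronglyMeasurable, ?_⟩
  refine lt_of_le_of_lt (le_of_eq ?_) (h1.trans_lt (ENNReal.mul_lt_top hC.lt_top h2))
  refine lintegral_congr fun y => ?_
  rw [enorm_mul, Real.enorm_of_nonneg (by positivity), Real.enorm_of_nonneg (by positivity),
    ← ofReal_norm, Complex.norm_real, Real.norm_eq_abs, ENNReal.ofReal_pow (abs_nonneg _)]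

/-- The equation with the Newton potential replaced by that of Newton's theorem. -/
theorem IsGroundState.integral_mul_sqrtLaplacian {w : E3 → ℝ} (hw : IsGroundState w)
    (hrad : IsRadial w) (φ : 𝓢(E3, ℂ)) :
    ∫ x, (w x : ℂ) * sqrtLaplacian φ x
      = ∫ x, (((potential w x - 1) * w x : ℝ) : ℂ) * φ x := by
  have h2 := integrable_sq_of_memLp hw.memLp
  have hK := hw.integrable_inv_mul
  have hwm : AEMeasurable w := by
    have := hw.memLp.1.aemeasurable
    exact Complex.measurable_re.comp_aemeasurable this
  have h0 : ∀ᵐ ξ : E3, ξ ≠ 0 := by simp [ae_iff, measure_singleton]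
  have e1 : ∫ x, ((newtonPotential w x * w x : ℝ) : ℂ) * φ x
      = ∫ x, ((potential w x * w x : ℝ) : ℂ) * φ x := by
    refine integral_congr_ae ?_
    filter_upwards [h0] with x hx
    rw [newtonPotential_eq hwm hrad hK h2 hx]
  have hVw : MemLp (fun x => ((potential w x * w x : ℝ) : ℂ)) 2 volume :=
    memLp_ofReal_mul_of_bound hw.memLp (stronglyMeasurable_potential h2).measurable fun x => by
      rw [abs_of_nonneg (potential_nonneg x)]
      exact potential_le_centralPotential hK h2 x
  have h := hw.equation φ
  rw [e1] at h
  have i1 : Integrable fun x => ((potential w x * w x : ℝ) : ℂ) * φ x :=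
    hVw.integrable_mul (φ.memLp 2)
  have i2 : Integrable fun x => (w x : ℂ) * φ x := hw.memLp.integrable_mul (φ.memLp 2)
  rw [sub_eq_iff_eq_add.1 h, neg_add_eq_sub, ← integral_sub i1 i2]
  congr 1 with x
  push_cast
  ring

/-- The number `e` is positive: testing the equation with `w` gives
`∫ 2π|ξ||ŵ|² = ∫ (V - 1) w²`. Since `V` is at most its value `e + 1` at the origin, the right side
would be nonpositive for `e ≤ 0`, and `w` would vanish. -/
theorem IsGroundState.one_lt_centralPotential {w : E3 → ℝ} (hw : IsGroundState w)
    (hrad : IsRadial w) : 1 < centralPotential w := by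
  by_contra! hle
  have h2 := integrable_sq_of_memLp hw.memLp
  have hK := hw.integrable_inv_mul
  have hVb := potential_le_centralPotential hK h2
  have hq : MemLp (fun x => (((potential w x - 1) * w x : ℝ) : ℂ)) 2 volume :=
    memLp_ofReal_mul_of_bound (C := 1) hw.memLp
      ((stronglyMeasurable_potential h2).measurable.sub_const 1) fun x => by
      rw [abs_le]
      constructor <;> linarith [potential_nonneg (u := w) x, hVb x]
  obtain ⟨W, -, hW⟩ := IsFourierPair.exists_right hw.memLp
  obtain ⟨Q, -, hQ⟩ := IsFourierPair.exists_right hq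
  have hsym := symbol_mul_ae_eq hW hQ (hw.integral_mul_sqrtLaplacian hrad)
  have hfin := lintegral_norm_mul_fourier_lt_top hW hw.memSobolev
  have hpair := hW.integral_conj_mul hQ
  have e1 : ∫ ξ, conj (W ξ) * Q ξ = ((∫ ξ, 2 * Real.pi * ‖ξ‖ * ‖W ξ‖ ^ 2 : ℝ) : ℂ) := by
    rw [← integral_complex_ofReal]
    refine integral_congr_ae ?_
    filter_upwards [hsym] with ξ hξ
    rw [← hξ, mul_left_comm, mul_comm (conj (W ξ)), Complex.mul_conj, Complex.normSq_eq_norm_sq]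
    push_cast
    ring
  have e2 : ∫ x, conj (w x : ℂ) * (((potential w x - 1) * w x : ℝ) : ℂ)
      = ((∫ x, (potential w x - 1) * |w x| ^ 2 : ℝ) : ℂ) := by
    rw [← integral_complex_ofReal]
    congr 1 with x
    rw [Complex.conj_ofReal, sq_abs]
    push_cast
    ring
  have hint : Integrable fun ξ => 2 * Real.pi * ‖ξ‖ * ‖W ξ‖ ^ 2 := by
    have : Integrable fun ξ => ‖ξ‖ * ‖W ξ‖ ^ 2 := by
      refine ⟨(by fun_prop : Measurable fun y : E3 => ‖y‖).aestronglyMeasurable.mul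
        (hW.memLp_right.1.norm.pow 2), ?_⟩
      refine lt_of_le_of_lt (le_of_eq ?_) hfin
      refine lintegral_congr fun y => ?_
      rw [enorm_mul, enorm_norm, enorm_pow, enorm_norm, ofReal_norm]
    simpa [mul_assoc] using this.const_mul (2 * Real.pi)
  have hle0 : ∫ ξ, 2 * Real.pi * ‖ξ‖ * ‖W ξ‖ ^ 2 ≤ 0 := by
    have : ∫ ξ, 2 * Real.pi * ‖ξ‖ * ‖W ξ‖ ^ 2 = ∫ x, (potential w x - 1) * |w x| ^ 2 := by
      exact_mod_cast (e1.symm.trans hpair.symm).trans e2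
    rw [this]
    refine integral_nonpos fun x => ?_
    exact mul_nonpos_of_nonpos_of_nonneg (by linarith [hVb x]) (by positivity)
  have hz := (integral_eq_zero_iff_of_nonneg (fun ξ => by positivity) hint).1
    (le_antisymm hle0 (integral_nonneg fun ξ => by positivity))
  have h0 : ∀ᵐ ξ : E3, ξ ≠ 0 := by simp [ae_iff, measure_singleton]
  have hW0 : W =ᵐ[volume] fun _ => 0 := by
    filter_upwards [hz, h0] with ξ h1 h3
    have := norm_pos_iff.2 h3
    have h1 : 2 * Real.pi * ‖ξ‖ * ‖W ξ‖ ^ 2 = 0 := h1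
    have hp : 2 * Real.pi * ‖ξ‖ ≠ 0 := by positivity
    simpa using (mul_eq_zero.1 h1).resolve_left hp
  have hz2 : IsFourierPair (fun _ => 0) fun _ => 0 := by simpa using hW.const_mul 0
  refine hw.ne_zero ?_
  filter_upwards [hW.left_unique hz2 hW0] with x hx
  exact_mod_cast hx

/-! ### Rescaling -/

theorem quasiMeasurePreserving_smul {e : ℝ} (he : e ≠ 0) :
    Measure.QuasiMeasurePreserving (fun x : E3 => e • x) volume volume :=
  ⟨by fun_prop, by
    rw [Measure.map_addHaar_smul _ he]
    exact Measure.smul_absolutelyContinuous⟩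

theorem integral_comp_inv_smul_E3 {F : Type*} [NormedAddCommGroup F] [NormedSpace ℝ F]
    (f : E3 → F) {e : ℝ} (he : 0 < e) : ∫ x, f (e⁻¹ • x) = e ^ 3 • ∫ x, f x := by
  rw [Measure.integral_comp_inv_smul_of_nonneg _ _ he.le]
  simp [E3]

theorem fourier_dilation (φ : E3 → ℂ) {e : ℝ} (he : 0 < e) (ξ : E3) :
    𝓕 (fun x => φ (e • x)) ξ = ((e ^ 3)⁻¹ : ℝ) • 𝓕 φ (e⁻¹ • ξ) := by
  have h := integral_comp_inv_smul_E3
    (fun v => Complex.exp (((-2 * Real.pi * inner ℝ v ξ : ℝ) : ℂ) * Complex.I) • φ (e • v)) he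
  rw [eq_inv_smul_iff₀ (by positivity), Real.fourier_eq', Real.fourier_eq']
  refine h.symm.trans (integral_congr_ae (Eventually.of_forall fun v => ?_))
  simp only
  rw [smul_smul, mul_inv_cancel₀ he.ne', one_smul, real_inner_smul_left, real_inner_smul_right]

theorem sqrtLaplacian_dilation (φ φe : 𝓢(E3, ℂ)) {e : ℝ} (he : 0 < e)
    (h : ∀ x, φe x = φ (e • x)) (x : E3) :
    sqrtLaplacian φe x = (e : ℂ) * sqrtLaplacian φ (e • x) := by
  have h1 : 𝓕 (φe : E3 → ℂ) = fun ξ => ((e ^ 3)⁻¹ : ℝ) • 𝓕 (φ : E3 → ℂ) (e⁻¹ • ξ) := by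
    have h0 : (φe : E3 → ℂ) = fun x => φ (e • x) := funext h
    ext ξ
    rw [h0, fourier_dilation _ he]
  have h2 := integral_comp_inv_smul_E3
    (fun η => Complex.exp (((2 * Real.pi * inner ℝ η (e • x) : ℝ) : ℂ) * Complex.I)
      • (((2 * Real.pi * ‖η‖ : ℝ) : ℂ) * 𝓕 (φ : E3 → ℂ) η)) he
  rw [sqrtLaplacian, sqrtLaplacian, Real.fourierInv_eq', Real.fourierInv_eq', h1]
  have h3 : ∀ ξ : E3, Complex.exp (((2 * Real.pi * inner ℝ ξ x : ℝ) : ℂ) * Complex.I)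
      • (((2 * Real.pi * ‖ξ‖ : ℝ) : ℂ) * ((e ^ 3)⁻¹ : ℝ) • 𝓕 (φ : E3 → ℂ) (e⁻¹ • ξ))
      = ((e ^ 2)⁻¹ : ℝ) • (Complex.exp (((2 * Real.pi * inner ℝ (e⁻¹ • ξ) (e • x) : ℝ) : ℂ)
        * Complex.I) • (((2 * Real.pi * ‖e⁻¹ • ξ‖ : ℝ) : ℂ) * 𝓕 (φ : E3 → ℂ) (e⁻¹ • ξ))) := by
    intro ξ
    rw [real_inner_smul_left, real_inner_smul_right, ← mul_assoc e⁻¹, inv_mul_cancel₀ he.ne',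
      one_mul, norm_smul, Real.norm_of_nonneg (by positivity)]
    simp only [smul_eq_mul, Complex.real_smul]
    push_cast
    have : (e : ℂ) ≠ 0 := by exact_mod_cast he.ne'
    field_simp
  simp_rw [h3]
  rw [integral_smul, h2, smul_smul, Complex.real_smul]
  congr 1
  have : (e : ℂ) ≠ 0 := by exact_mod_cast he.ne'
  push_cast
  field_simp

section

variable {w : E3 → ℝ} {e : ℝ}

theorem abs_rescale_sq (he : 0 < e) (x : E3) :
    |rescale e w x| ^ 2 = (e ^ 3)⁻¹ * |w (e⁻¹ • x)| ^ 2 := by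
  rw [rescale, sq_abs, sq_abs, mul_pow, ← Real.rpow_natCast (e ^ _), ← Real.rpow_mul he.le]
  congr 1
  have : (-(3 / 2) : ℝ) * ((2 : ℕ) : ℝ) = -((3 : ℕ) : ℝ) := by norm_num
  rw [this, Real.rpow_neg he.le, Real.rpow_natCast]

theorem memLp_rescale (he : 0 < e) (hw : MemLp (fun x => (w x : ℂ)) 2 volume) :
    MemLp (fun x => (rescale e w x : ℂ)) 2 volume := by
  have h1 : AEStronglyMeasurable (fun x => (rescale e w x : ℂ)) volume := by
    have := (hw.1.comp_quasiMeasurePreserving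
      (quasiMeasurePreserving_smul (inv_ne_zero he.ne'))).const_mul ((e ^ (-(3 / 2) : ℝ) : ℝ) : ℂ)
    refine this.congr (Eventually.of_forall fun x => ?_)
    simp [rescale]
  rw [memLp_two_iff_integrable_sq_norm h1]
  have h2 := ((integrable_sq_of_memLp hw).comp_smul (inv_ne_zero he.ne')).const_mul (e ^ 3)⁻¹
  refine h2.congr (Eventually.of_forall fun x => ?_)
  simp only
  rw [← abs_rescale_sq he, Complex.norm_real, Real.norm_eq_abs]

theorem inv_norm_mul_rescale (he : 0 < e) (y : E3) : ‖y‖⁻¹ * |rescale e w y| ^ 2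
    = (e ^ 4)⁻¹ * (‖e⁻¹ • y‖⁻¹ * |w (e⁻¹ • y)| ^ 2) := by
  rw [abs_rescale_sq he, norm_smul, Real.norm_of_nonneg (by positivity), mul_inv]
  field_simp

theorem integrable_inv_mul_rescale (he : 0 < e) (hK : Integrable fun y => ‖y‖⁻¹ * |w y| ^ 2) :
    Integrable fun y => ‖y‖⁻¹ * |rescale e w y| ^ 2 := by
  simp_rw [inv_norm_mul_rescale he]
  exact (hK.comp_smul (inv_ne_zero he.ne')).const_mul _

theorem centralPotential_rescale (he : 0 < e) :
    centralPotential (rescale e w) = e⁻¹ * centralPotential w := by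
  simp_rw [centralPotential, inv_norm_mul_rescale he]
  rw [integral_const_mul, integral_comp_inv_smul_E3 (fun y => ‖y‖⁻¹ * |w y| ^ 2) he, smul_eq_mul,
    ← mul_assoc]
  congr 1
  field_simp

theorem potential_rescale (he : 0 < e) (x : E3) :
    potential (rescale e w) x = e⁻¹ * potential w (e⁻¹ • x) := by
  have h : ∀ y : E3, min ‖x‖⁻¹ ‖y‖⁻¹ * |rescale e w y| ^ 2
      = (e ^ 4)⁻¹ * (min ‖e⁻¹ • x‖⁻¹ ‖e⁻¹ • y‖⁻¹ * |w (e⁻¹ • y)| ^ 2) := by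
    intro y
    rw [abs_rescale_sq he, norm_smul, norm_smul, Real.norm_of_nonneg (by positivity), mul_inv,
      mul_inv, inv_inv, ← mul_min_of_nonneg _ _ he.le]
    field_simp
  simp_rw [potential, h]
  rw [integral_const_mul, integral_comp_inv_smul_E3
    (fun y => min ‖e⁻¹ • x‖⁻¹ ‖y‖⁻¹ * |w y| ^ 2) he, smul_eq_mul, ← mul_assoc]
  congr 1
  field_simp

/-- The scale `e` is chosen so that `Φ_u(∞) - 1 = 1 / e`, which turns the term `-w` of the original
equation into `Φ_u - 1`. -/
theorem solvesNormalized_rescale (he : 0 < e) (hw : IsGroundState w) (hrad : IsRadial w)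
    (hK : centralPotential w = e + 1) : SolvesNormalized (rescale e w) := by
  intro φ
  set c : ℝ := e ^ (-(3 / 2) : ℝ)
  have h2 := integrable_sq_of_memLp (memLp_rescale he hw.memLp)
  have hKi := integrable_inv_mul_rescale he hw.integrable_inv_mul
  set φe : 𝓢(E3, ℂ) := SchwartzMap.compCLMOfContinuousLinearEquiv ℂ
    (ContinuousLinearEquiv.smulLeft (Units.mk0 e he.ne')) φ
  have hφe : ∀ x, φe x = φ (e • x) := fun x => rfl
  have hee : ∀ x : E3, e • e⁻¹ • x = x := fun x => by
    rw [smul_smul, mul_inv_cancel₀ he.ne', one_smul]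
  have a1 : ∫ x, (rescale e w x : ℂ) * sqrtLaplacian φ x
      = e ^ 3 • ∫ z, ((c * e⁻¹ : ℝ) : ℂ) * ((w z : ℂ) * sqrtLaplacian φe z) := by
    rw [← integral_comp_inv_smul_E3 _ he]
    congr 1 with x
    rw [sqrtLaplacian_dilation φ φe he hφe, hee, rescale]
    have : (e : ℂ) ≠ 0 := by exact_mod_cast he.ne'
    simp only [c]
    push_cast
    field_simp
  have h0 : ∀ᵐ ξ : E3, ξ ≠ 0 := by simp [ae_iff, measure_singleton]
  have a2 : ∫ x, (((Phi (rescale e w) x - 1) * rescale e w x : ℝ) : ℂ) * φ x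
      = e ^ 3 • ∫ z, (-(c * e⁻¹ : ℝ) : ℂ) * ((((potential w z - 1) * w z : ℝ) : ℂ) * φe z) := by
    rw [← integral_comp_inv_smul_E3 _ he]
    refine integral_congr_ae ?_
    filter_upwards [h0] with x hx
    rw [phi_eq hKi h2 hx, centralPotential_rescale he, potential_rescale he, hφe, hee, hK, rescale]
    have : (e : ℂ) ≠ 0 := by exact_mod_cast he.ne'
    push_cast
    field_simp
    ring
  rw [a1, a2, integral_const_mul, integral_const_mul, hw.integral_mul_sqrtLaplacian hrad,
    ← smul_add, ← add_mul]
  simp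

end

/-! ### The resolvent of `√(-Δ)` -/

/-- The Fourier transform of `(√(-Δ) + κ)⁻¹ h`, for `H` the Fourier transform of `h`. -/
noncomputable def resolventSymbol (κ : ℝ) (H : E3 → ℂ) (ξ : E3) : ℂ :=
  (((2 * Real.pi * ‖ξ‖ + κ)⁻¹ : ℝ) : ℂ) * H ξ

section

variable {κ : ℝ} {H : E3 → ℂ}

theorem norm_resolventSymbol (hκ : 0 < κ) (ξ : E3) :
    ‖resolventSymbol κ H ξ‖ = (2 * Real.pi * ‖ξ‖ + κ)⁻¹ * ‖H ξ‖ := by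
  rw [resolventSymbol, norm_mul, Complex.norm_real, Real.norm_of_nonneg (by positivity)]

theorem norm_resolventSymbol_le (hκ : 0 < κ) (ξ : E3) :
    ‖resolventSymbol κ H ξ‖ ≤ κ⁻¹ * ‖H ξ‖ := by
  rw [norm_resolventSymbol hκ]
  gcongr
  have : 0 ≤ 2 * Real.pi * ‖ξ‖ := by positivity
  linarith

theorem symbol_mul_resolventSymbol (hκ : 0 < κ) (ξ : E3) :
    ((2 * Real.pi * ‖ξ‖ + κ : ℝ) : ℂ) * resolventSymbol κ H ξ = H ξ := by
  have : (2 * Real.pi * ‖ξ‖ + κ : ℝ) ≠ 0 := by positivity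
  rw [resolventSymbol, ← mul_assoc, ← Complex.ofReal_mul, mul_inv_cancel₀ this,
    Complex.ofReal_one, one_mul]

theorem stronglyMeasurable_resolventSymbol (hH : StronglyMeasurable H) :
    StronglyMeasurable (resolventSymbol κ H) :=
  (by fun_prop : Measurable fun ξ : E3 => (((2 * Real.pi * ‖ξ‖ + κ)⁻¹ : ℝ) : ℂ)).stronglyMeasurable.mul
    hH

theorem aestronglyMeasurable_resolventSymbol (hH : AEStronglyMeasurable H) :
    AEStronglyMeasurable (resolventSymbol κ H) :=
  (by fun_prop : Measurable fun ξ : E3 =>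
    (((2 * Real.pi * ‖ξ‖ + κ)⁻¹ : ℝ) : ℂ)).aestronglyMeasurable.mul hH

theorem memLp_resolventSymbol (hκ : 0 < κ) (hH : MemLp H 2 volume) :
    MemLp (resolventSymbol κ H) 2 volume :=
  hH.of_le_mul (aestronglyMeasurable_resolventSymbol hH.1)
    (Eventually.of_forall fun ξ => norm_resolventSymbol_le hκ ξ)

theorem memLp_norm_mul_resolventSymbol (hκ : 0 < κ) (hH : MemLp H 2 volume) :
    MemLp (fun ξ => ((2 * Real.pi * ‖ξ‖ : ℝ) : ℂ) * resolventSymbol κ H ξ) 2 volume := by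
  refine hH.of_le ((by fun_prop : Measurable fun ξ : E3 =>
    ((2 * Real.pi * ‖ξ‖ : ℝ) : ℂ)).aestronglyMeasurable.mul
    (aestronglyMeasurable_resolventSymbol hH.1)) (Eventually.of_forall fun ξ => ?_)
  rw [norm_mul, norm_resolventSymbol hκ, Complex.norm_real, Real.norm_of_nonneg (by positivity),
    ← mul_assoc]
  refine mul_le_of_le_one_left (norm_nonneg _) ?_
  rw [← div_eq_mul_inv]
  exact div_le_one_of_le₀ (by linarith) (by positivity)

theorem enorm_resolventSymbol_sq (hκ : 0 < κ) (ξ : E3) : ‖resolventSymbol κ H ξ‖ₑ ^ 2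
    = ENNReal.ofReal ((2 * Real.pi * ‖ξ‖ + κ)⁻¹ ^ 2) * ‖H ξ‖ₑ ^ 2 := by
  rw [resolventSymbol, enorm_mul, mul_pow, ENNReal.ofReal_pow (by positivity), ← ofReal_norm,
    Complex.norm_real, Real.norm_of_nonneg (by positivity)]

theorem lintegral_norm_mul_resolventSymbol_lt_top (hκ : 0 < κ) (hH : MemLp H 2 volume) :
    ∫⁻ ξ, ENNReal.ofReal ‖ξ‖ * ‖resolventSymbol κ H ξ‖ₑ ^ 2 < ⊤ := by
  have hb : ∀ ξ : E3, ENNReal.ofReal ‖ξ‖ * ‖resolventSymbol κ H ξ‖ₑ ^ 2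
      ≤ ENNReal.ofReal κ⁻¹ * ‖H ξ‖ₑ ^ 2 := fun ξ => by
    rw [enorm_resolventSymbol_sq hκ, ← mul_assoc, ← ENNReal.ofReal_mul (norm_nonneg _)]
    refine mul_le_mul' (ENNReal.ofReal_le_ofReal ?_) le_rfl
    have h0 : 0 ≤ 2 * Real.pi * ‖ξ‖ := by positivity
    have h1 : ‖ξ‖ * (2 * Real.pi * ‖ξ‖ + κ)⁻¹ ≤ 1 := by
      rw [← div_eq_mul_inv]
      refine div_le_one_of_le₀ ?_ (by positivity)
      nlinarith [Real.pi_gt_three, norm_nonneg ξ]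
    have h2 : (2 * Real.pi * ‖ξ‖ + κ)⁻¹ ≤ κ⁻¹ := inv_anti₀ hκ (by linarith)
    calc ‖ξ‖ * (2 * Real.pi * ‖ξ‖ + κ)⁻¹ ^ 2
        = (‖ξ‖ * (2 * Real.pi * ‖ξ‖ + κ)⁻¹) * (2 * Real.pi * ‖ξ‖ + κ)⁻¹ := by ring
      _ ≤ 1 * κ⁻¹ := mul_le_mul h1 h2 (by positivity) (by norm_num)
      _ = κ⁻¹ := one_mul _
  refine lt_of_le_of_lt (lintegral_mono hb) ?_
  rw [lintegral_const_mul' _ _ ENNReal.ofReal_ne_top]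
  exact ENNReal.mul_lt_top ENNReal.ofReal_lt_top ((memLp_two_iff_lintegral hH.1).1 hH)

theorem synthNormSq_resolventSymbol_lt_top (hκ : 0 < κ)
    (hfin : ∫⁻ ξ, ENNReal.ofReal ‖ξ‖⁻¹ * ‖H ξ‖ₑ ^ 2 < ⊤) :
    synthNormSq (resolventSymbol κ H) < ⊤ := by
  have hb : ∀ ξ : E3, ENNReal.ofReal (4 * Real.pi * ‖ξ‖)⁻¹ * ‖resolventSymbol κ H ξ‖ₑ ^ 2
      ≤ ENNReal.ofReal ((4 * Real.pi)⁻¹ * κ⁻¹ ^ 2)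
        * (ENNReal.ofReal ‖ξ‖⁻¹ * ‖H ξ‖ₑ ^ 2) := fun ξ => by
    rw [enorm_resolventSymbol_sq hκ, ← mul_assoc, ← mul_assoc, ← ENNReal.ofReal_mul (by positivity),
      ← ENNReal.ofReal_mul (by positivity), mul_inv, mul_right_comm]
    have h0 : 0 ≤ 2 * Real.pi * ‖ξ‖ := by positivity
    have h2 : (2 * Real.pi * ‖ξ‖ + κ)⁻¹ ≤ κ⁻¹ := inv_anti₀ hκ (by linarith)
    gcongr
  refine lt_of_le_of_lt (lintegral_mono hb) ?_
  rw [lintegral_const_mul' _ _ ENNReal.ofReal_ne_top]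
  exact ENNReal.mul_lt_top ENNReal.ofReal_lt_top hfin

end

/-! ### Positive solutions of the normalised equation -/

/-- A positive, square integrable solution of `√(-Δ) u + (Φ_u - 1) u = 0` for which
`Φ_u(∞) = ∫ |u|² / |y|` is finite and exceeds `1`. -/
structure IsPositiveSolution (u : E3 → ℝ) : Prop where
  memLp : MemLp (fun x => (u x : ℂ)) 2 volume
  integrable_inv_mul : Integrable fun y => ‖y‖⁻¹ * |u y| ^ 2
  one_lt : 1 < centralPotential u
  pos : ∀ᵐ x, 0 < u x
  solves : SolvesNormalized u

/-- The constant `κ = Φ_u(∞) - 1`. It is positive, and `Φ_u - 1 = κ - V` with `V` the potential of `u`. -/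
noncomputable def gap (u : E3 → ℝ) : ℝ := centralPotential u - 1

theorem IsGroundState.isPositiveSolution_rescale {w : E3 → ℝ} (hw : IsGroundState w)
    (hpos : ∀ᵐ x, 0 < w x) (hrad : IsRadial w) :
    0 < scale w ∧ IsPositiveSolution (rescale (scale w) w) := by
  have hK : centralPotential w = scale w + 1 := by simp [scale, centralPotential]
  have he : 0 < scale w := by linarith [hw.one_lt_centralPotential hrad]
  refine ⟨he, memLp_rescale he hw.memLp, integrable_inv_mul_rescale he hw.integrable_inv_mul, ?_,
    ?_, solvesNormalized_rescale he hw hrad hK⟩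
  · rw [centralPotential_rescale he, hK, mul_add, inv_mul_cancel₀ he.ne']
    have := inv_pos.2 he
    linarith
  · have h := (quasiMeasurePreserving_smul (inv_ne_zero he.ne')).ae hpos
    filter_upwards [h] with x hx
    exact mul_pos (Real.rpow_pos_of_pos he _) hx

namespace IsPositiveSolution

variable {u : E3 → ℝ}

theorem gap_pos (hu : IsPositiveSolution u) : 0 < gap u := sub_pos.2 hu.one_lt

theorem integrable_sq (hu : IsPositiveSolution u) : Integrable fun y => |u y| ^ 2 :=
  integrable_sq_of_memLp hu.memLp

theorem measurable_potential (hu : IsPositiveSolution u) : Measurable (potential u) :=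
  (stronglyMeasurable_potential hu.integrable_sq).measurable

theorem potential_le (hu : IsPositiveSolution u) (x : E3) :
    potential u x ≤ centralPotential u :=
  potential_le_centralPotential hu.integrable_inv_mul hu.integrable_sq x

theorem ae_potential_pos (hu : IsPositiveSolution u) : ∀ᵐ x, 0 < potential u x := by
  have h0 : ∀ᵐ ξ : E3, ξ ≠ 0 := by simp [ae_iff, measure_singleton]
  filter_upwards [h0] with x hx
  exact potential_pos hu.integrable_inv_mul hu.integrable_sq hu.pos hx

/-- The identity `Φ_u - 1 = κ - V`. -/
theorem ae_phi_sub_one (hu : IsPositiveSolution u) :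
    ∀ᵐ x, Phi u x - 1 = gap u - potential u x := by
  have h0 : ∀ᵐ ξ : E3, ξ ≠ 0 := by simp [ae_iff, measure_singleton]
  filter_upwards [h0] with x hx
  rw [phi_eq hu.integrable_inv_mul hu.integrable_sq hx, gap]
  ring

theorem memLp_potential_mul (hu : IsPositiveSolution u) {f : E3 → ℂ} (hf : MemLp f 2 volume) :
    MemLp (fun x => (potential u x : ℂ) * f x) 2 volume := by
  refine hf.of_le_mul (c := centralPotential u)
    ((Complex.measurable_ofReal.comp hu.measurable_potential).aestronglyMeasurable.mul hf.1)
    (Eventually.of_forall fun x => ?_)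
  rw [norm_mul, Complex.norm_real, Real.norm_of_nonneg (potential_nonneg x)]
  exact mul_le_mul_of_nonneg_right (hu.potential_le x) (norm_nonneg _)

/-- `V ^ 2` decays at least like `|x|⁻¹`, as `V` is bounded and `|x| V(x) ≤ ∫ |u|²`. -/
theorem lintegral_norm_mul_potential_lt_top (hu : IsPositiveSolution u) {f : E3 → ℂ}
    (hf : MemLp f 2 volume) :
    ∫⁻ x, ENNReal.ofReal ‖x‖ * ‖(potential u x : ℂ) * f x‖ₑ ^ 2 < ⊤ := by
  have hb : ∀ x : E3, ENNReal.ofReal ‖x‖ * ‖(potential u x : ℂ) * f x‖ₑ ^ 2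
      ≤ ENNReal.ofReal ((∫ y, |u y| ^ 2) * centralPotential u) * ‖f x‖ₑ ^ 2 := fun x => by
    have h1 := norm_mul_potential_le hu.integrable_inv_mul hu.integrable_sq x
    have h2 := hu.potential_le x
    have h3 := potential_nonneg (u := u) x
    rw [enorm_mul, mul_pow, ← ofReal_norm, Complex.norm_real, Real.norm_of_nonneg h3,
      ← ENNReal.ofReal_pow h3, ← mul_assoc, ← ENNReal.ofReal_mul (norm_nonneg _)]
    refine mul_le_mul' (ENNReal.ofReal_le_ofReal ?_) le_rfl
    calc ‖x‖ * potential u x ^ 2 = (‖x‖ * potential u x) * potential u x := by ring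
      _ ≤ _ := mul_le_mul h1 h2 h3 (integral_nonneg fun y => by positivity)
  refine lt_of_le_of_lt (lintegral_mono hb) ?_
  rw [lintegral_const_mul' _ _ ENNReal.ofReal_ne_top]
  exact ENNReal.mul_lt_top ENNReal.ofReal_lt_top ((memLp_two_iff_lintegral hf.1).1 hf)

/-- The harmonic extension of `(√(-Δ) + κ)⁻¹ V f` is square integrable: since `V` decays like `|x|⁻¹`,
the dual Kato inequality makes the Fourier transform of `V f` square integrable against `|ξ|⁻¹`. -/
theorem synthNormSq_lt_top (hu : IsPositiveSolution u) {f H : E3 → ℂ}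
    (hf : MemLp f 2 volume) (hH : IsFourierPair (fun x => (potential u x : ℂ) * f x) H) :
    synthNormSq (resolventSymbol (gap u) H) < ⊤ := by
  obtain ⟨C, hC, hkato⟩ := kato_dual
  exact synthNormSq_resolventSymbol_lt_top hu.gap_pos ((hkato _ _ hH).trans_lt
    (ENNReal.mul_lt_top hC.lt_top (hu.lintegral_norm_mul_potential_lt_top hf)))

/-- The equation in the form `u = (√(-Δ) + κ)⁻¹ (V u)`. -/
theorem isFourierPair_resolventSymbol (hu : IsPositiveSolution u) {H : E3 → ℂ}
    (hH : IsFourierPair (fun x => (potential u x : ℂ) * (u x : ℂ)) H) :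
    IsFourierPair (fun x => (u x : ℂ)) (resolventSymbol (gap u) H) := by
  obtain ⟨F, -, hF⟩ := IsFourierPair.exists_right hu.memLp
  have hq := hH.add (hF.const_mul (-(gap u : ℂ)))
  have e : (fun x => (potential u x : ℂ) * (u x : ℂ) + -(gap u : ℂ) * (u x : ℂ))
      = fun x => (((potential u x - gap u) * u x : ℝ) : ℂ) := by
    ext x
    push_cast
    ring
  rw [e] at hq
  have hs := symbol_mul_ae_eq hF hq fun φ => by
    have h := hu.solves φ
    rw [add_eq_zero_iff_eq_neg, ← integral_neg] at h
    rw [h]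
    refine integral_congr_ae ?_
    filter_upwards [hu.ae_phi_sub_one] with x hx
    rw [hx]
    push_cast
    ring
  refine hF.congr (EventuallyEq.refl _ _) ?_
  filter_upwards [hs] with ξ hξ
  have h1 := symbol_mul_resolventSymbol (H := H) hu.gap_pos ξ
  have h2 : ((2 * Real.pi * ‖ξ‖ + gap u : ℝ) : ℂ) * F ξ = H ξ := by
    rw [Complex.ofReal_add, add_mul, hξ]
    ring
  have h3 : ((2 * Real.pi * ‖ξ‖ + gap u : ℝ) : ℂ) ≠ 0 := by
    have := hu.gap_pos
    exact_mod_cast (by positivity : (2 * Real.pi * ‖ξ‖ + gap u : ℝ) ≠ 0)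
  exact mul_left_cancel₀ h3 (h2.trans h1.symm)

end IsPositiveSolution

/-! ### The integral kernel of the resolvent -/

theorem isFourierPair_poisson {q Q : E3 → ℂ} (hq : IsFourierPair q Q) {s : ℝ} (hs : 0 < s) :
    IsFourierPair (fun x => ∫ y, (poissonKernel s (x - y) : ℂ) * q y)
      (fun ξ => (damp s ξ : ℂ) * Q ξ) := by
  simp_rw [integral_poissonKernel_mul hq hs]
  refine isFourierPair_synth ((memLp_damp hs).integrable_mul hq.memLp_right) ?_
  refine hq.memLp_right.of_le ((memLp_damp hs).1.mul hq.memLp_right.1)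
    (Eventually.of_forall fun ξ => ?_)
  rw [norm_mul, Complex.norm_real, Real.norm_of_nonneg (damp_pos s ξ).le]
  exact mul_le_of_le_one_left (norm_nonneg _) (damp_le_one hs.le ξ)

theorem integral_exp_mul_damp {κ : ℝ} (hκ : 0 < κ) (ξ : E3) :
    ∫ s in Ioi (0 : ℝ), Real.exp (-κ * s) * damp s ξ = (2 * Real.pi * ‖ξ‖ + κ)⁻¹ := by
  have hpos : 0 < 2 * Real.pi * ‖ξ‖ + κ := by positivity
  have e : ∀ s : ℝ, Real.exp (-κ * s) * damp s ξ
      = Real.exp (-(2 * Real.pi * ‖ξ‖ + κ) * s) := fun s => by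
    rw [damp, ← Real.exp_add]
    congr 1
    ring
  simp_rw [e]
  rw [integral_eq_lintegral_of_nonneg_ae (Eventually.of_forall fun s => (Real.exp_pos _).le)
    (by fun_prop), lintegral_exp_neg_Ioi hpos, ENNReal.toReal_ofReal (by positivity)]

/-- The resolvent as a Laplace transform of the Poisson semigroup:
`(√(-Δ) + κ)⁻¹ = ∫₀^∞ e^{-κs} e^{-s√(-Δ)} ds`. -/
theorem integral_resolvent_pairing {p q P Q : E3 → ℂ} (hp : IsFourierPair p P)
    (hq : IsFourierPair q Q) {κ : ℝ} (hκ : 0 < κ) :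
    IntegrableOn (fun s : ℝ => (Real.exp (-κ * s) : ℂ)
        * ∫ x, conj (p x) * ∫ y, (poissonKernel s (x - y) : ℂ) * q y) (Ioi 0) ∧
    ∫ s in Ioi (0 : ℝ), (Real.exp (-κ * s) : ℂ)
        * (∫ x, conj (p x) * ∫ y, (poissonKernel s (x - y) : ℂ) * q y)
      = ∫ ξ, conj (P ξ) * resolventSymbol κ Q ξ := by
  set Ψ : ℝ → E3 → ℂ := fun s ξ =>
    (Real.exp (-κ * s) : ℂ) * (conj (P ξ) * ((damp s ξ : ℂ) * Q ξ)) with hΨ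
  have hPQ : Integrable (fun ξ => conj (P ξ) * Q ξ) :=
    hp.memLp_right.star.integrable_mul hq.memLp_right
  have hexp : IntegrableOn (fun s : ℝ => Real.exp (-κ * s)) (Ioi 0) := by
    simpa using integrableOn_pow_mul_exp_neg hκ 0
  have hmeas : AEStronglyMeasurable (Function.uncurry Ψ)
      ((volume.restrict (Ioi (0 : ℝ))).prod (volume : Measure E3)) := by
    have h1 : AEStronglyMeasurable (fun z : ℝ × E3 => conj (P z.2) * Q z.2)
        ((volume.restrict (Ioi (0 : ℝ))).prod (volume : Measure E3)) := hPQ.1.comp_snd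
    have h2 : Measurable fun z : ℝ × E3 => (Real.exp (-κ * z.1) : ℂ) * (damp z.1 z.2 : ℂ) := by
      unfold damp
      fun_prop
    refine (h2.aestronglyMeasurable.mul h1).congr (Eventually.of_forall fun z => ?_)
    simp only [hΨ, Function.uncurry, Pi.mul_apply]
    ring
  have hint : Integrable (Function.uncurry Ψ)
      ((volume.restrict (Ioi (0 : ℝ))).prod (volume : Measure E3)) := by
    refine (hexp.mul_prod hPQ.norm).mono' hmeas ?_
    have hpos : ∀ᵐ z ∂(volume.restrict (Ioi (0 : ℝ))).prod (volume : Measure E3), 0 < z.1 :=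
      Measure.quasiMeasurePreserving_fst.ae (ae_restrict_mem measurableSet_Ioi)
    filter_upwards [hpos] with z hz
    simp only [hΨ, Function.uncurry]
    rw [norm_mul, Complex.norm_real, Real.norm_of_nonneg (Real.exp_pos _).le, mul_left_comm,
      norm_mul _ (_ * _), Complex.norm_real, Real.norm_of_nonneg (damp_pos _ _).le]
    gcongr
    exact mul_le_of_le_one_left (norm_nonneg _) (damp_le_one hz.le _)
  have e1 : ∀ s ∈ Ioi (0 : ℝ), (Real.exp (-κ * s) : ℂ)
      * (∫ x, conj (p x) * ∫ y, (poissonKernel s (x - y) : ℂ) * q y) = ∫ ξ, Ψ s ξ := by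
    intro s hs
    rw [hp.integral_conj_mul (isFourierPair_poisson hq hs), ← integral_const_mul]
  refine ⟨?_, ?_⟩
  · exact IntegrableOn.congr_fun hint.integral_prod_left (fun s hs => (e1 s hs).symm)
      measurableSet_Ioi
  · rw [setIntegral_congr_fun measurableSet_Ioi e1, integral_integral_swap hint]
    congr 1 with ξ
    have e2 : ∀ s, Ψ s ξ = ((Real.exp (-κ * s) * damp s ξ : ℝ) : ℂ) * (conj (P ξ) * Q ξ) := by
      intro s
      simp only [hΨ]
      push_cast
      ring
    simp_rw [e2]
    rw [integral_mul_const, integral_complex_ofReal, integral_exp_mul_damp hκ, resolventSymbol]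
    ring

/-- The density `e^{-κs} 𝒫_s(x - y)` at `(s, x, y)`, whose integral over `s > 0` is the kernel of
`(√(-Δ) + κ)⁻¹`. -/
noncomputable def kernel (κ : ℝ) (z : ℝ × E3 × E3) : ℝ :=
  Real.exp (-κ * z.1) * poissonKernel z.1 (z.2.1 - z.2.2)

/-- Lebesgue measure `ds dx dy` on `(0, ∞) × ℝ³ × ℝ³`. -/
noncomputable def kernelVolume : Measure (ℝ × E3 × E3) :=
  (volume.restrict (Ioi 0)).prod (volume.prod volume)

theorem measurable_kernel (κ : ℝ) : Measurable (kernel κ) := by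
  unfold kernel poissonKernel
  fun_prop

theorem poissonKernel_pos {t : ℝ} (ht : 0 < t) (x : E3) : 0 < poissonKernel t x := by
  unfold poissonKernel
  positivity

theorem ae_kernel_pos (κ : ℝ) : ∀ᵐ z ∂kernelVolume, 0 < kernel κ z := by
  have hpos : ∀ᵐ z ∂kernelVolume, 0 < z.1 :=
    Measure.quasiMeasurePreserving_fst.ae (ae_restrict_mem measurableSet_Ioi)
  filter_upwards [hpos] with z hz
  exact mul_pos (Real.exp_pos _) (poissonKernel_pos hz _)

theorem kernel_swap (κ s : ℝ) (x y : E3) : kernel κ (s, x, y) = kernel κ (s, y, x) := by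
  simp only [kernel, poissonKernel, norm_sub_rev x y]

theorem lintegral_kernelVolume {g : ℝ × E3 × E3 → ENNReal} (hg : Measurable g) :
    ∫⁻ z, g z ∂kernelVolume = ∫⁻ s in Ioi (0 : ℝ), ∫⁻ x, ∫⁻ y, g (s, x, y) := by
  rw [kernelVolume, lintegral_prod _ hg.aemeasurable]
  congr 1 with s
  rw [lintegral_prod _ (by fun_prop)]

theorem lintegral_kernel_swap {κ : ℝ} {g : E3 × E3 → ENNReal} (hg : Measurable g) :
    ∫⁻ z, ENNReal.ofReal (kernel κ z) * g (z.2.2, z.2.1) ∂kernelVolume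
      = ∫⁻ z, ENNReal.ofReal (kernel κ z) * g z.2 ∂kernelVolume := by
  have hk := measurable_kernel κ
  rw [lintegral_kernelVolume (by fun_prop), lintegral_kernelVolume (by fun_prop)]
  congr 1 with s
  rw [lintegral_lintegral_swap (by fun_prop)]
  simp_rw [kernel_swap κ s]

/-- For nonnegative functions the form of the resolvent is a convergent triple integral. -/
theorem lintegral_kernel_mul_mul {p q : E3 → ℝ} {P Q : E3 → ℂ} (hpm : Measurable p)
    (hqm : Measurable q) (hp0 : ∀ x, 0 ≤ p x) (hq0 : ∀ x, 0 ≤ q x)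
    (hp : IsFourierPair (fun x => (p x : ℂ)) P) (hq : IsFourierPair (fun x => (q x : ℂ)) Q)
    {κ : ℝ} (hκ : 0 < κ) :
    ∫⁻ z, ENNReal.ofReal (kernel κ z * p z.2.1 * q z.2.2) ∂kernelVolume
      = ENNReal.ofReal (∫ ξ, conj (P ξ) * resolventSymbol κ Q ξ).re := by
  have hk := measurable_kernel κ
  obtain ⟨h1, h2⟩ := integral_resolvent_pairing hp hq hκ
  have hr : ∀ s : ℝ, (Real.exp (-κ * s) : ℂ)
        * (∫ x, conj (p x : ℂ) * ∫ y, (poissonKernel s (x - y) : ℂ) * (q y : ℂ))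
      = ((Real.exp (-κ * s) * ∫ x, p x * ∫ y, poissonKernel s (x - y) * q y : ℝ) : ℂ) := by
    intro s
    rw [Complex.ofReal_mul, ← integral_complex_ofReal]
    congr 2 with x
    rw [Complex.conj_ofReal, Complex.ofReal_mul, ← integral_complex_ofReal]
    push_cast
    rfl
  simp_rw [hr] at h1 h2
  rw [← h2, integral_complex_ofReal, Complex.ofReal_re, lintegral_kernelVolume (by fun_prop),
    ofReal_integral_eq_lintegral_ofReal]
  · refine setLIntegral_congr_fun measurableSet_Ioi fun s hs => ?_
    have hs : 0 < s := hs
    have hy : ∀ x, Integrable fun y => poissonKernel s (x - y) * q y := fun x => by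
      have := ((isFourierPair_poissonKernel hs x).memLp_left.integrable_mul hq.memLp_left).re
      refine this.congr (Eventually.of_forall fun y => ?_)
      simp
    have hx : Integrable fun x => p x * ∫ y, poissonKernel s (x - y) * q y := by
      have := (hp.memLp_left.integrable_mul (isFourierPair_poisson hq hs).memLp_left).re
      refine this.congr (Eventually.of_forall fun x => ?_)
      have e : ∫ y, (poissonKernel s (x - y) : ℂ) * (q y : ℂ)
          = ((∫ y, poissonKernel s (x - y) * q y : ℝ) : ℂ) := by
        rw [← integral_complex_ofReal]
        push_cast
        rfl
      simp only [Pi.mul_apply]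
      rw [e, ← Complex.ofReal_mul]
      exact Complex.ofReal_re _
    rw [← integral_const_mul, ofReal_integral_eq_lintegral_ofReal (hx.const_mul _)]
    · refine lintegral_congr fun x => ?_
      rw [← integral_const_mul, ← integral_const_mul, ofReal_integral_eq_lintegral_ofReal
        (((hy x).const_mul _).const_mul _)]
      · refine lintegral_congr fun y => ?_
        simp only [kernel]
        congr 1
        ring
      · refine Eventually.of_forall fun y => ?_
        exact mul_nonneg (Real.exp_pos _).le
          (mul_nonneg (hp0 x) (mul_nonneg (poissonKernel_pos hs _).le (hq0 y)))
    · refine Eventually.of_forall fun x => ?_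
      exact mul_nonneg (Real.exp_pos _).le (mul_nonneg (hp0 x) (integral_nonneg fun y =>
        mul_nonneg (poissonKernel_pos hs _).le (hq0 y)))
  · exact h1.re.congr (Eventually.of_forall fun s => Complex.ofReal_re _)
  · refine (ae_restrict_iff' measurableSet_Ioi).2 (Eventually.of_forall fun s hs => ?_)
    exact mul_nonneg (Real.exp_pos _).le (integral_nonneg fun x => mul_nonneg (hp0 x)
      (integral_nonneg fun y => mul_nonneg (poissonKernel_pos hs _).le (hq0 y)))

/-! ### The ground state substitution -/

/-- The product `V u` of the potential and the solution. The substitution `f = η u` turns quadratic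
forms in `V f` into double integrals of `η` against this weight. -/
noncomputable def weight (u : E3 → ℝ) (x : E3) : ℝ := potential u x * u x

namespace IsPositiveSolution

variable {u : E3 → ℝ}

theorem measurable_weight (hu : IsPositiveSolution u) (hm : Measurable u) :
    Measurable (weight u) := hu.measurable_potential.mul hm

theorem weight_nonneg (h0 : ∀ x, 0 < u x) (x : E3) : 0 ≤ weight u x :=
  mul_nonneg (potential_nonneg x) (h0 x).le

theorem memLp_weight (hu : IsPositiveSolution u) :
    MemLp (fun x => (weight u x : ℂ)) 2 volume := by
  refine (hu.memLp_potential_mul hu.memLp).ae_eq (Eventually.of_forall fun x => ?_)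
  simp [weight]

/-- The equation `u = (√(-Δ) + κ)⁻¹ (V u)` in terms of the kernel, tested against `g`. -/
theorem lintegral_kernel_mul_weight (hu : IsPositiveSolution u) (hm : Measurable u)
    (h0 : ∀ x, 0 < u x) {g : E3 → ENNReal} (hg : Measurable g) :
    ∫⁻ z, ENNReal.ofReal (kernel (gap u) z) * (g z.2.1 * ENNReal.ofReal (weight u z.2.2))
        ∂kernelVolume = ∫⁻ x, g x * ENNReal.ofReal (u x) := by
  have hw := hu.measurable_weight hm
  have hk := measurable_kernel (gap u)
  -- the potential generated by `V u`
  set v : E3 → ENNReal := fun x => ∫⁻ s in Ioi (0 : ℝ), ∫⁻ y,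
    ENNReal.ofReal (kernel (gap u) (s, x, y)) * ENNReal.ofReal (weight u y) with hv
  have hvm : Measurable v := by
    refine Measurable.lintegral_prod_right' (f := fun q : E3 × ℝ => ∫⁻ y,
      ENNReal.ofReal (kernel (gap u) (q.2, q.1, y)) * ENNReal.ofReal (weight u y)) ?_
    refine Measurable.lintegral_prod_right' (f := fun q : (E3 × ℝ) × E3 =>
      ENNReal.ofReal (kernel (gap u) (q.1.2, q.1.1, q.2)) * ENNReal.ofReal (weight u q.2)) ?_
    fun_prop
  have hT : ∀ g : E3 → ENNReal, Measurable g →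
      ∫⁻ z, ENNReal.ofReal (kernel (gap u) z) * (g z.2.1 * ENNReal.ofReal (weight u z.2.2))
        ∂kernelVolume = ∫⁻ x, g x * v x := by
    intro g hg
    rw [lintegral_kernelVolume (by fun_prop), lintegral_lintegral_swap]
    · refine lintegral_congr fun x => ?_
      rw [hv, ← lintegral_const_mul]
      · refine lintegral_congr fun s => ?_
        rw [← lintegral_const_mul _ (by fun_prop)]
        refine lintegral_congr fun y => ?_
        ring
      · exact Measurable.lintegral_prod_right' (f := fun q : ℝ × E3 =>
          ENNReal.ofReal (kernel (gap u) (q.1, x, q.2)) * ENNReal.ofReal (weight u q.2))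
          (by fun_prop)
    · refine Measurable.aemeasurable ?_
      exact Measurable.lintegral_prod_right' (f := fun q : (ℝ × E3) × E3 =>
        ENNReal.ofReal (kernel (gap u) (q.1.1, q.1.2, q.2))
          * (g q.1.2 * ENNReal.ofReal (weight u q.2))) (by fun_prop)
  have key : v =ᵐ[volume] fun x => ENNReal.ofReal (u x) := by
    refine ae_eq_of_forall_setLIntegral_eq_of_sigmaFinite hvm hm.ennreal_ofReal fun S hS hSf => ?_
    -- pair the equation with the indicator function of `S`
    obtain ⟨H, -, hH⟩ := IsFourierPair.exists_right hu.memLp_weight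
    have hH' : IsFourierPair (fun x => (potential u x : ℂ) * (u x : ℂ)) H := by
      refine hH.congr (Eventually.of_forall fun x => ?_) (EventuallyEq.refl _ _)
      simp [weight]
    have hp2 : MemLp (fun x => ((S.indicator (fun _ => (1 : ℝ)) x : ℝ) : ℂ)) 2 volume := by
      have := memLp_indicator_const (μ := (volume : Measure E3)) 2 hS (1 : ℝ) (Or.inr hSf.ne)
      exact this.ofReal
    obtain ⟨P, -, hP⟩ := IsFourierPair.exists_right hp2
    have h1 := lintegral_kernel_mul_mul (measurable_const.indicator hS) hw
      (fun x => indicator_nonneg (fun _ _ => zero_le_one) x) (weight_nonneg h0) hP hH hu.gap_pos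
    have h2 := hP.integral_conj_mul (hu.isFourierPair_resolventSymbol hH')
    rw [← h2] at h1
    have h3 : ∫ x, conj ((S.indicator (fun _ => (1 : ℝ)) x : ℝ) : ℂ) * (u x : ℂ)
        = ((∫ x in S, u x : ℝ) : ℂ) := by
      rw [← integral_indicator hS, ← integral_complex_ofReal]
      refine integral_congr_ae (Eventually.of_forall fun x => ?_)
      by_cases hx : x ∈ S <;> simp [hx]
    rw [h3, Complex.ofReal_re] at h1
    have hui : IntegrableOn u S := by
      have : IsFiniteMeasure (volume.restrict S) := ⟨by simpa using hSf⟩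
      have := ((hu.memLp.restrict S).integrable (by norm_num)).re
      exact this.congr (Eventually.of_forall fun x => Complex.ofReal_re _)
    rw [ofReal_integral_eq_lintegral_ofReal hui (Eventually.of_forall fun x => (h0 x).le)] at h1
    rw [← h1, ← lintegral_indicator hS]
    have h4 := hT (S.indicator fun _ => 1) (measurable_const.indicator hS)
    calc _ = ∫⁻ x, S.indicator (fun _ => 1) x * v x := by
          refine lintegral_congr fun x => ?_
          by_cases hx : x ∈ S <;> simp [hx]
      _ = _ := h4.symm
      _ = _ := by
          refine lintegral_congr_ae ?_
          filter_upwards [ae_kernel_pos (gap u)] with z hz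
          by_cases hx : z.2.1 ∈ S
          · simp [hx, ENNReal.ofReal_mul hz.le]
          · simp [hx]
  rw [hT g hg]
  refine lintegral_congr_ae ?_
  filter_upwards [key] with x hx
  rw [hx]

end IsPositiveSolution

namespace IsPositiveSolution

variable {u : E3 → ℝ}

/-- The diagonal terms of the double integral: by the equation, one integration of the kernel against
`V u` gives `u` and leaves `∫ V u² |η|² = ∫ V |f|²`. -/
theorem integrable_kernel_weight_mul_sq (hu : IsPositiveSolution u) (hm : Measurable u)
    (h0 : ∀ x, 0 < u x) {η : E3 → ℂ} (hη : Measurable η)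
    (hη2 : Integrable fun x => potential u x * ‖η x * u x‖ ^ 2) :
    (Integrable (fun z => kernel (gap u) z * (weight u z.2.1 * weight u z.2.2) * ‖η z.2.1‖ ^ 2)
        kernelVolume ∧
      ∫ z, kernel (gap u) z * (weight u z.2.1 * weight u z.2.2) * ‖η z.2.1‖ ^ 2 ∂kernelVolume
        = ∫ x, potential u x * ‖η x * u x‖ ^ 2) ∧
    (Integrable (fun z => kernel (gap u) z * (weight u z.2.1 * weight u z.2.2) * ‖η z.2.2‖ ^ 2)
        kernelVolume ∧
      ∫ z, kernel (gap u) z * (weight u z.2.1 * weight u z.2.2) * ‖η z.2.2‖ ^ 2 ∂kernelVolume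
        = ∫ x, potential u x * ‖η x * u x‖ ^ 2) := by
  have hw := hu.measurable_weight hm
  have hw0 := weight_nonneg h0
  have hk := measurable_kernel (gap u)
  have hbase := hu.lintegral_kernel_mul_weight hm h0
    (g := fun x => ENNReal.ofReal (weight u x * ‖η x‖ ^ 2)) (by fun_prop)
  have hR : ∫⁻ x, ENNReal.ofReal (weight u x * ‖η x‖ ^ 2) * ENNReal.ofReal (u x)
      = ∫⁻ x, ENNReal.ofReal (potential u x * ‖η x * u x‖ ^ 2) := by
    refine lintegral_congr fun x => ?_
    rw [← ENNReal.ofReal_mul (by have := hw0 x; positivity), norm_mul, Complex.norm_real,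
      Real.norm_of_nonneg (h0 x).le, weight]
    congr 1
    ring
  rw [hR] at hbase
  have hnn1 : ∀ᵐ z ∂kernelVolume,
      0 ≤ kernel (gap u) z * (weight u z.2.1 * weight u z.2.2) * ‖η z.2.1‖ ^ 2 := by
    filter_upwards [ae_kernel_pos (gap u)] with z hz
    have := hw0 z.2.1
    have := hw0 z.2.2
    positivity
  have hnn2 : ∀ᵐ z ∂kernelVolume,
      0 ≤ kernel (gap u) z * (weight u z.2.1 * weight u z.2.2) * ‖η z.2.2‖ ^ 2 := by
    filter_upwards [ae_kernel_pos (gap u)] with z hz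
    have := hw0 z.2.1
    have := hw0 z.2.2
    positivity
  have hl1 : ∫⁻ z, ENNReal.ofReal
      (kernel (gap u) z * (weight u z.2.1 * weight u z.2.2) * ‖η z.2.1‖ ^ 2) ∂kernelVolume
      = ∫⁻ x, ENNReal.ofReal (potential u x * ‖η x * u x‖ ^ 2) := by
    rw [← hbase]
    refine lintegral_congr_ae ?_
    filter_upwards [ae_kernel_pos (gap u)] with z hz
    have := hw0 z.2.1
    rw [← ENNReal.ofReal_mul (by positivity), ← ENNReal.ofReal_mul hz.le]
    congr 1
    ring
  have hl2 : ∫⁻ z, ENNReal.ofReal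
      (kernel (gap u) z * (weight u z.2.1 * weight u z.2.2) * ‖η z.2.2‖ ^ 2) ∂kernelVolume
      = ∫⁻ x, ENNReal.ofReal (potential u x * ‖η x * u x‖ ^ 2) := by
    rw [← hbase, ← lintegral_kernel_swap (g := fun q => ENNReal.ofReal (weight u q.1 * ‖η q.1‖ ^ 2)
      * ENNReal.ofReal (weight u q.2)) (by fun_prop)]
    refine lintegral_congr_ae ?_
    filter_upwards [ae_kernel_pos (gap u)] with z hz
    have := hw0 z.2.2
    rw [← ENNReal.ofReal_mul (by positivity), ← ENNReal.ofReal_mul hz.le]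
    congr 1
    ring
  have hnn : ∀ x, 0 ≤ potential u x * ‖η x * u x‖ ^ 2 := fun x => by
    have := potential_nonneg (u := u) x
    positivity
  have hfin : ∫⁻ x, ENNReal.ofReal (potential u x * ‖η x * u x‖ ^ 2) ≠ ⊤ :=
    (lintegral_ofReal_ne_top_iff_integrable hη2.1 (Eventually.of_forall hnn)).2 hη2
  have m1 : AEStronglyMeasurable (fun z : ℝ × E3 × E3 =>
      kernel (gap u) z * (weight u z.2.1 * weight u z.2.2) * ‖η z.2.1‖ ^ 2) kernelVolume :=
    Measurable.aestronglyMeasurable (by fun_prop)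
  have m2 : AEStronglyMeasurable (fun z : ℝ × E3 × E3 =>
      kernel (gap u) z * (weight u z.2.1 * weight u z.2.2) * ‖η z.2.2‖ ^ 2) kernelVolume :=
    Measurable.aestronglyMeasurable (by fun_prop)
  have e := integral_eq_lintegral_of_nonneg_ae (Eventually.of_forall hnn) hη2.1
  refine ⟨⟨?_, ?_⟩, ?_, ?_⟩
  · exact (lintegral_ofReal_ne_top_iff_integrable m1 hnn1).1 (hl1 ▸ hfin)
  · rw [e, integral_eq_lintegral_of_nonneg_ae hnn1 m1, hl1]
  · exact (lintegral_ofReal_ne_top_iff_integrable m2 hnn2).1 (hl2 ▸ hfin)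
  · rw [e, integral_eq_lintegral_of_nonneg_ae hnn2 m2, hl2]

theorem integrable_potential_mul_sq (hu : IsPositiveSolution u) {f : E3 → ℂ}
    (hf : MemLp f 2 volume) : Integrable fun x => potential u x * ‖f x‖ ^ 2 := by
  have h1 := (memLp_two_iff_integrable_sq_norm hf.1).1 hf
  refine (h1.const_mul (centralPotential u)).mono'
    (hu.measurable_potential.aestronglyMeasurable.mul h1.1) (Eventually.of_forall fun x => ?_)
  rw [Real.norm_of_nonneg (mul_nonneg (potential_nonneg x) (by positivity))]
  exact mul_le_mul_of_nonneg_right (hu.potential_le x) (by positivity)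

/-- The defect in Schur's test with weight `u`: writing `f = η u`,
`∫ V |f|² - ⟨V f, (√(-Δ) + κ)⁻¹ V f⟩` is a double integral of `|η(x) - η(y)|²`. -/
theorem integral_kernel_mul_sq_sub (hu : IsPositiveSolution u) (hm : Measurable u)
    (h0 : ∀ x, 0 < u x) {η H : E3 → ℂ} (hη : Measurable η)
    (hf : MemLp (fun x => η x * (u x : ℂ)) 2 volume)
    (hH : IsFourierPair (fun x => (potential u x : ℂ) * (η x * (u x : ℂ))) H) :
    Integrable (fun z => kernel (gap u) z * (weight u z.2.1 * weight u z.2.2)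
        * ‖η z.2.1 - η z.2.2‖ ^ 2) kernelVolume ∧
    ∫ z, kernel (gap u) z * (weight u z.2.1 * weight u z.2.2) * ‖η z.2.1 - η z.2.2‖ ^ 2
        ∂kernelVolume
      = 2 * ((∫ x, potential u x * ‖η x * (u x : ℂ)‖ ^ 2)
        - (∫ ξ, conj (H ξ) * resolventSymbol (gap u) H ξ).re) := by
  have hw := hu.measurable_weight hm
  have hw0 := weight_nonneg h0
  have hk := measurable_kernel (gap u)
  obtain ⟨⟨i1, e1⟩, i2, e2⟩ := hu.integrable_kernel_weight_mul_sq hm h0 hη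
    (hu.integrable_potential_mul_sq hf)
  set X : ℝ × E3 × E3 → ℂ := fun z =>
    ((kernel (gap u) z * (weight u z.2.1 * weight u z.2.2) : ℝ) : ℂ)
      * (conj (η z.2.1) * η z.2.2) with hX
  have i3 : Integrable X kernelVolume := by
    refine (i1.add i2).mono' (Measurable.aestronglyMeasurable ?_) ?_
    · have : Measurable fun z => conj (η z) := Complex.continuous_conj.measurable.comp hη
      fun_prop
    · filter_upwards [ae_kernel_pos (gap u)] with z hz
      have h1 := hw0 z.2.1
      have h2 := hw0 z.2.2
      simp only [hX, Pi.add_apply]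
      rw [norm_mul, Complex.norm_real, Real.norm_of_nonneg (by positivity), norm_mul,
        Complex.norm_conj, ← mul_add]
      gcongr
      nlinarith [sq_nonneg (‖η z.2.1‖ - ‖η z.2.2‖), norm_nonneg (η z.2.1), norm_nonneg (η z.2.2)]
  -- the cross term is the form of the resolvent
  have e3 : ∫ z, X z ∂kernelVolume = ∫ ξ, conj (H ξ) * resolventSymbol (gap u) H ξ := by
    rw [← (integral_resolvent_pairing hH hH hu.gap_pos).2, kernelVolume, integral_prod _ i3]
    refine integral_congr_ae ?_
    filter_upwards [Integrable.prod_right_ae i3] with s hs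
    rw [integral_prod _ hs, ← integral_const_mul]
    congr 1 with x
    rw [← integral_const_mul, ← integral_const_mul]
    congr 1 with y
    simp only [hX, kernel, weight, map_mul, Complex.conj_ofReal]
    push_cast
    ring
  have hpt : ∀ z : ℝ × E3 × E3, kernel (gap u) z * (weight u z.2.1 * weight u z.2.2)
        * ‖η z.2.1 - η z.2.2‖ ^ 2
      = kernel (gap u) z * (weight u z.2.1 * weight u z.2.2) * ‖η z.2.1‖ ^ 2
        + kernel (gap u) z * (weight u z.2.1 * weight u z.2.2) * ‖η z.2.2‖ ^ 2
        - 2 * (X z).re := by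
    intro z
    simp only [hX]
    rw [Complex.re_ofReal_mul, ← Complex.normSq_eq_norm_sq, Complex.normSq_sub,
      ← Complex.normSq_eq_norm_sq, ← Complex.normSq_eq_norm_sq]
    have : (conj (η z.2.1) * η z.2.2).re = (η z.2.1 * conj (η z.2.2)).re := by
      simp
    rw [this]
    ring
  simp_rw [hpt]
  have i4 : Integrable (fun z => 2 * (X z).re) kernelVolume := i3.re.const_mul 2
  have i12 : Integrable (fun z =>
      kernel (gap u) z * (weight u z.2.1 * weight u z.2.2) * ‖η z.2.1‖ ^ 2
        + kernel (gap u) z * (weight u z.2.1 * weight u z.2.2) * ‖η z.2.2‖ ^ 2) kernelVolume :=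
    i1.add i2
  refine ⟨i12.sub i4, ?_⟩
  rw [integral_sub i12 i4, integral_add i1 i2, e1, e2, integral_const_mul, ← e3]
  have : ∫ z, (X z).re ∂kernelVolume = (∫ z, X z ∂kernelVolume).re := integral_re i3
  rw [this]
  ring

/-- The Birman–Schwinger inequality for `f = η u`, for everywhere positive measurable `u`. -/
theorem resolvent_form_le_of_measurable (hu : IsPositiveSolution u) (hm : Measurable u)
    (h0 : ∀ x, 0 < u x) {η H : E3 → ℂ} (hη : Measurable η)
    (hf : MemLp (fun x => η x * (u x : ℂ)) 2 volume)
    (hH : IsFourierPair (fun x => (potential u x : ℂ) * (η x * (u x : ℂ))) H) :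
    (∫ ξ, conj (H ξ) * resolventSymbol (gap u) H ξ).re
        ≤ ∫ x, potential u x * ‖η x * (u x : ℂ)‖ ^ 2 ∧
    ((∫ ξ, conj (H ξ) * resolventSymbol (gap u) H ξ).re
        = ∫ x, potential u x * ‖η x * (u x : ℂ)‖ ^ 2 → ∃ c : ℂ, ∀ᵐ x, η x = c) := by
  obtain ⟨hi, he⟩ := hu.integral_kernel_mul_sq_sub hm h0 hη hf hH
  have hw0 := weight_nonneg h0
  have hnn : ∀ᵐ z ∂kernelVolume, 0 ≤ kernel (gap u) z * (weight u z.2.1 * weight u z.2.2)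
        * ‖η z.2.1 - η z.2.2‖ ^ 2 := by
    filter_upwards [ae_kernel_pos (gap u)] with z hz
    have := hw0 z.2.1
    have := hw0 z.2.2
    positivity
  refine ⟨?_, fun heq => ?_⟩
  · have := integral_nonneg_of_ae hnn
    linarith
  · rw [heq, sub_self, mul_zero] at he
    have hz := (integral_eq_zero_iff_of_nonneg_ae hnn hi).1 he
    have hwpos : ∀ᵐ x, 0 < weight u x := by
      filter_upwards [hu.ae_potential_pos] with x hx
      exact mul_pos hx (h0 x)
    have hp1 : ∀ᵐ z ∂kernelVolume, 0 < weight u z.2.1 :=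
      Measure.quasiMeasurePreserving_snd.ae (Measure.quasiMeasurePreserving_fst.ae hwpos)
    have hp2 : ∀ᵐ z ∂kernelVolume, 0 < weight u z.2.2 :=
      Measure.quasiMeasurePreserving_snd.ae (Measure.quasiMeasurePreserving_snd.ae hwpos)
    -- kernel and weights are positive almost everywhere, so `η` must be constant
    have hall : ∀ᵐ z ∂kernelVolume, η z.2.1 = η z.2.2 := by
      filter_upwards [hz, hp1, hp2, ae_kernel_pos (gap u)] with z a1 a2 a3 a4
      have a1 : kernel (gap u) z * (weight u z.2.1 * weight u z.2.2)
        * ‖η z.2.1 - η z.2.2‖ ^ 2 = 0 := a1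
      have a5 : kernel (gap u) z * (weight u z.2.1 * weight u z.2.2) ≠ 0 := by positivity
      exact sub_eq_zero.1 (by simpa using (mul_eq_zero.1 a1).resolve_left a5)
    have h1 := Measure.ae_ae_of_ae_prod hall
    have hne : NeBot (ae (volume.restrict (Ioi (0 : ℝ)))) := by
      rw [ae_neBot, Ne, Measure.restrict_eq_zero]
      simp
    obtain ⟨s, hs⟩ := h1.exists
    have h2 : ∀ᵐ x : E3, ∀ᵐ y : E3, η x = η y := Measure.ae_ae_of_ae_prod hs
    obtain ⟨x, hx⟩ := h2.exists
    exact ⟨η x, hx.mono fun y hy => hy.symm⟩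

/-- Positivity of a solution and its potential depend on `u` only up to null sets, so that a measurable,
everywhere positive representative may be used. -/
theorem congr (hu : IsPositiveSolution u) {v : E3 → ℝ} (h : u =ᵐ[volume] v) :
    IsPositiveSolution v ∧ potential v = potential u ∧ gap v = gap u := by
  have hpot : potential v = potential u := by
    ext x
    refine integral_congr_ae ?_
    filter_upwards [h] with y hy
    rw [hy]
  have hc : centralPotential v = centralPotential u := by
    refine integral_congr_ae ?_
    filter_upwards [h] with y hy
    rw [hy]
  have hphi : Phi v = Phi u := by
    ext x
    refine integral_congr_ae (ae_restrict_of_ae ?_)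
    filter_upwards [h] with y hy
    rw [hy]
  refine ⟨⟨hu.memLp.ae_eq ?_, hu.integrable_inv_mul.congr ?_, hc ▸ hu.one_lt, ?_, fun φ => ?_⟩,
    hpot, by rw [gap, gap, hc]⟩
  · filter_upwards [h] with x hx
    rw [hx]
  · filter_upwards [h] with x hx
    rw [hx]
  · filter_upwards [h, hu.pos] with x hx hp
    rwa [← hx]
  · rw [← hu.solves φ, hphi]
    congr 1
    · refine integral_congr_ae ?_
      filter_upwards [h] with x hx
      rw [hx]
    · refine integral_congr_ae ?_
      filter_upwards [h] with x hx
      rw [hx]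

/-- The Birman–Schwinger inequality `⟨V f, (√(-Δ) + κ)⁻¹ V f⟩ ≤ ⟨f, V f⟩`, with equality only for
multiples of `u`. -/
theorem resolvent_form_le (hu : IsPositiveSolution u) {f H : E3 → ℂ} (hf : MemLp f 2 volume)
    (hH : IsFourierPair (fun x => (potential u x : ℂ) * f x) H) :
    (∫ ξ, conj (H ξ) * resolventSymbol (gap u) H ξ).re ≤ ∫ x, potential u x * ‖f x‖ ^ 2 ∧
    ((∫ ξ, conj (H ξ) * resolventSymbol (gap u) H ξ).re = ∫ x, potential u x * ‖f x‖ ^ 2 →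
      ∃ c : ℂ, ∀ᵐ x, f x = c * (u x : ℂ)) := by
  have hum : AEMeasurable u := Complex.measurable_re.comp_aemeasurable hu.memLp.1.aemeasurable
  -- a measurable, everywhere positive representative of `u`
  set v : E3 → ℝ := fun x => if 0 < hum.mk u x then hum.mk u x else 1 with hv
  have hvm : Measurable v := Measurable.ite (measurableSet_lt measurable_const hum.measurable_mk)
    hum.measurable_mk measurable_const
  have hv0 : ∀ x, 0 < v x := fun x => by
    simp only [hv]
    split_ifs with h
    · exact h
    · exact one_pos
  have huv : u =ᵐ[volume] v := by
    filter_upwards [hum.ae_eq_mk, hu.pos] with x h1 h2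
    simp only [hv]
    rw [if_pos (h1 ▸ h2), ← h1]
  obtain ⟨hvs, hpot, hgap⟩ := hu.congr huv
  set η : E3 → ℂ := fun x => hf.1.mk f x / (v x : ℂ) with hη
  have hηm : Measurable η := hf.1.stronglyMeasurable_mk.measurable.div
    (Complex.measurable_ofReal.comp hvm)
  have hfe : f =ᵐ[volume] fun x => η x * (v x : ℂ) := by
    filter_upwards [hf.1.ae_eq_mk] with x hx
    have : (v x : ℂ) ≠ 0 := by exact_mod_cast (hv0 x).ne'
    simp only [hη]
    rw [div_mul_cancel₀ _ this, hx]
  have key := hvs.resolvent_form_le_of_measurable (H := H) hvm hv0 hηm (hf.ae_eq hfe) (hH.congr (by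
    filter_upwards [hfe] with x hx
    rw [hx, hpot]) (EventuallyEq.refl _ _))
  rw [hpot, hgap] at key
  have e : ∫ x, potential u x * ‖η x * (v x : ℂ)‖ ^ 2 = ∫ x, potential u x * ‖f x‖ ^ 2 := by
    refine integral_congr_ae ?_
    filter_upwards [hfe] with x hx
    rw [hx]
  rw [e] at key
  refine ⟨key.1, fun h => ?_⟩
  obtain ⟨c, hc⟩ := key.2 h
  refine ⟨c, ?_⟩
  filter_upwards [hc, hfe, huv] with x h1 h2 h3
  rw [h2, h1, h3]

end IsPositiveSolution

/-! ### Uniqueness of traces and functions with vanishing gradient -/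

section

variable {ψ χ : E3 × ℝ → ℂ}

theorem isWeakDeriv_congr (h : ψ =ᵐ[halfVolume] χ) (v : E3 × ℝ) :
    IsWeakDeriv v ψ = IsWeakDeriv v χ := by
  have e : ∀ φ : E3 × ℝ → ℝ, ∫ p, fderiv ℝ φ p v • ψ p ∂halfVolume
      = ∫ p, fderiv ℝ φ p v • χ p ∂halfVolume := fun φ => by
    refine integral_congr_ae ?_
    filter_upwards [h] with p hp
    rw [hp]
  ext g
  simp only [IsWeakDeriv, e]

theorem weakDeriv_congr (h : ψ =ᵐ[halfVolume] χ) (v : E3 × ℝ) :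
    weakDeriv v ψ = weakDeriv v χ := by
  rw [weakDeriv, weakDeriv, isWeakDeriv_congr h]

theorem isTrace_congr (h : ψ =ᵐ[halfVolume] χ) : IsTrace ψ = IsTrace χ := by
  have e : ∀ φ : E3 × ℝ → ℝ, ∫ p, fderiv ℝ φ p (0, 1) • ψ p ∂halfVolume
      = ∫ p, fderiv ℝ φ p (0, 1) • χ p ∂halfVolume := fun φ => by
    refine integral_congr_ae ?_
    filter_upwards [h] with p hp
    rw [hp]
  ext f
  simp only [IsTrace, e, weakDeriv_congr h]

theorem quadForm_congr (u : E3 → ℝ) (h : ψ =ᵐ[halfVolume] χ) :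
    quadForm u ψ = quadForm u χ := by
  have e : gradSq ψ = gradSq χ := by
    ext p
    simp only [gradSq, weakDeriv_congr h]
  rw [quadForm, quadForm, e, trace, trace, isTrace_congr h]

theorem MemH1.congr (hψ : MemH1 ψ) (h : ψ =ᵐ[halfVolume] χ) : MemH1 χ := by
  refine ⟨hψ.1.ae_eq h, fun v => ?_⟩
  rw [← isWeakDeriv_congr h]
  exact hψ.2 v

theorem MemH1.isTrace_trace (hψ : MemH1 ψ) : IsTrace ψ (trace ψ) :=
  Classical.epsilon_spec hψ.exists_trace

/-- Traces are unique: test with products `φ(x) b(t)`, `b(0) = 1`. -/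
theorem IsTrace.ae_eq {f g : E3 → ℂ} (hf : IsTrace ψ f) (hg : IsTrace ψ g) :
    f =ᵐ[volume] g := by
  refine ae_eq_of_integral_contDiff_smul_eq (hf.1.locallyIntegrable (by norm_num))
    (hg.1.locallyIntegrable (by norm_num)) fun φ hφ hc => ?_
  let b : ContDiffBump (0 : ℝ) := ⟨1, 2, one_pos, one_lt_two⟩
  have hb0 : b 0 = 1 := b.one_of_mem_closedBall (by simp [b])
  have hΦ : ContDiff ℝ ∞ fun p : E3 × ℝ => φ p.1 * b p.2 :=
    (hφ.comp contDiff_fst).mul (b.contDiff.comp contDiff_snd)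
  have hΦc : HasCompactSupport fun p : E3 × ℝ => φ p.1 * b p.2 := by
    refine HasCompactSupport.intro (hc.isCompact.prod b.hasCompactSupport.isCompact) fun p hp => ?_
    by_cases h1 : p.1 ∈ tsupport φ
    · have h2 : p.2 ∉ tsupport b := fun h2 => hp ⟨h1, h2⟩
      simp [image_eq_zero_of_notMem_tsupport h2]
    · simp [image_eq_zero_of_notMem_tsupport h1]
  have := (hf.2 _ hΦ hΦc).symm.trans (hg.2 _ hΦ hΦc)
  simpa [hb0] using this

theorem IsWeakDeriv.sub {v : E3 × ℝ} {g h : E3 × ℝ → ℂ} (hψ : MemLp ψ 2 halfVolume)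
    (hχ : MemLp χ 2 halfVolume) (hg2 : MemLp g 2 halfVolume) (hh2 : MemLp h 2 halfVolume)
    (hg : IsWeakDeriv v ψ g) (hh : IsWeakDeriv v χ h) :
    IsWeakDeriv v (fun p => ψ p - χ p) (fun p => g p - h p) := by
  intro φ h1 h2 h3
  have hφ : MemLp (fun p => (φ p : ℂ)) 2 halfVolume :=
    memLp_half_of_continuous (Complex.continuous_ofReal.comp h1.continuous)
      (h2.comp_left (g := fun r : ℝ => (r : ℂ)) rfl)
  have hd : MemLp (fun p => (fderiv ℝ φ p v : ℂ)) 2 halfVolume :=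
    memLp_half_of_continuous (Complex.continuous_ofReal.comp
      ((h1.continuous_fderiv (by simp)).clm_apply continuous_const))
      ((h2.fderiv_apply ℝ v).comp_left (g := fun r : ℝ => (r : ℂ)) rfl)
  have e1 := hg φ h1 h2 h3
  have e2 := hh φ h1 h2 h3
  simp only [Complex.real_smul] at e1 e2 ⊢
  simp_rw [mul_sub]
  rw [integral_sub (integrable_half_mul hd hψ) (integrable_half_mul hd hχ),
    integral_sub (integrable_half_mul hφ hg2) (integrable_half_mul hφ hh2), e1, e2]
  ring

/-- A square integrable function on the half-space with `∂_t χ = 0` vanishes: its integral against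
a test function does not change when the test function is moved up, and then tends to zero. -/
theorem ae_eq_zero_of_isWeakDeriv_zero (hχ : MemLp χ 2 halfVolume)
    (h : IsWeakDeriv (0, 1) χ fun _ => 0) : χ =ᵐ[halfVolume] fun _ => 0 := by
  refine ae_eq_of_integral_test_eq hχ (by simp) fun φ h1 h2 h3 => ?_
  set v : E3 × ℝ := (0, 1) with hv
  have hvn : ∀ s : ℝ, ‖s • v‖ = |s| := fun s => by simp [hv, Prod.norm_def]
  -- the integral against the test function moved up by `s`
  set I : ℝ → ℂ := fun s => ∫ p, φ (p - s • v) • χ p ∂halfVolume with hI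
  have hφd : Continuous fun p => fderiv ℝ φ p v :=
    (h1.continuous_fderiv (by simp)).clm_apply continuous_const
  obtain ⟨M, hM⟩ := (h2.fderiv_apply ℝ v).exists_bound_of_continuous hφd
  obtain ⟨R, hR⟩ := h2.isCompact.isBounded.subset_closedBall (0 : E3 × ℝ)
  have hχm := hχ.1
  have hint : ∀ (φ' : E3 × ℝ → ℝ), Continuous φ' → HasCompactSupport φ' →
      Integrable (fun p => φ' p • χ p) halfVolume := fun φ' hc hs => by
    have : MemLp (fun p => (φ' p : ℂ)) 2 halfVolume :=
      memLp_half_of_continuous (Complex.continuous_ofReal.comp hc)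
        (hs.comp_left (g := fun r : ℝ => (r : ℂ)) rfl)
    simpa using integrable_half_mul this hχ
  have hsub : ∀ s : ℝ, HasCompactSupport fun p => φ (p - s • v) := fun s =>
    h2.comp_homeomorph (Homeomorph.subRight (s • v))
  have hder : ∀ s, HasDerivAt I (∫ p, (-fderiv ℝ φ (p - s • v) v) • χ p ∂halfVolume) s := by
    intro s
    refine (hasDerivAt_integral_of_dominated_loc_of_deriv_le (μ := halfVolume)
      (F := fun s p => φ (p - s • v) • χ p)
      (F' := fun s p => (-fderiv ℝ φ (p - s • v) v) • χ p)
      (bound := (Metric.closedBall 0 (R + |s| + 1)).indicator fun p => M * ‖χ p‖)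
      (Metric.ball_mem_nhds s one_pos) ?_ ?_ ?_ ?_ ?_ ?_).2
    · refine Eventually.of_forall fun r => ?_
      exact ((h1.continuous.comp (by fun_prop :
        Continuous fun p : E3 × ℝ => p - r • v)).aestronglyMeasurable).smul hχm
    · exact hint _ (h1.continuous.comp (by fun_prop)) (hsub s)
    · exact ((hφd.comp (by fun_prop :
        Continuous fun p : E3 × ℝ => p - s • v)).neg.aestronglyMeasurable).smul hχm
    · refine Eventually.of_forall fun p r hr => ?_
      rw [norm_smul, norm_neg]
      by_cases hp : p ∈ Metric.closedBall (0 : E3 × ℝ) (R + |s| + 1)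
      · rw [indicator_of_mem hp]
        exact mul_le_mul_of_nonneg_right (hM _) (norm_nonneg _)
      · have : p - r • v ∉ tsupport fun p => fderiv ℝ φ p v := fun hmem => hp (by
          have h4 := hR ((tsupport_fderiv_apply_subset ℝ v) hmem)
          rw [mem_closedBall_zero_iff] at h4 ⊢
          have h5 : ‖p‖ ≤ ‖p - r • v‖ + |r| := by
            rw [← hvn r]
            calc ‖p‖ = ‖(p - r • v) + r • v‖ := by rw [sub_add_cancel]
              _ ≤ _ := norm_add_le _ _
          have h6 : |r| ≤ |s| + 1 := by
            have h7 : |r - s| < 1 := by simpa [Real.dist_eq] using hr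
            have h8 : |r| ≤ |s| + |r - s| := by
              calc |r| = |s + (r - s)| := by rw [add_sub_cancel]
                _ ≤ _ := abs_add_le _ _
            linarith
          linarith)
        rw [indicator_of_notMem hp, image_eq_zero_of_notMem_tsupport this]
        simp
    · rw [integrable_indicator_iff Metric.isClosed_closedBall.measurableSet]
      exact (((hχ.locallyIntegrable (by norm_num)).integrableOn_isCompact
        (isCompact_closedBall _ _)).norm).const_mul M
    · refine Eventually.of_forall fun p r _ => ?_
      have a1 : HasDerivAt (fun r : ℝ => p - r • v) (-v) r := by
        simpa using ((hasDerivAt_id r).smul_const v).const_sub p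
      have a2 := ((h1.differentiable (by simp)) (p - r • v)).hasFDerivAt.comp_hasDerivAt r a1
      rw [map_neg] at a2
      exact a2.smul_const (χ p)
  have hsupp : ∀ s, 0 ≤ s → ∀ p, φ (p - s • v) ≠ 0 → s < p.2 := fun s _ p hp => by
    have : p - s • v ∈ halfSpace := h3 (subset_tsupport _ hp)
    simpa [halfSpace, hv] using this
  have hder0 : ∀ s, 0 ≤ s → HasDerivAt I 0 s := by
    intro s hs
    refine (hder s).congr_deriv ?_
    have hc : ContDiff ℝ ∞ fun p => φ (p - s • v) := h1.comp (by fun_prop)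
    have ht : tsupport (fun p => φ (p - s • v)) ⊆ halfSpace := by
      have : tsupport (fun p => φ (p - s • v)) = (fun p => p - s • v) ⁻¹' tsupport φ :=
        tsupport_comp_eq_preimage φ (Homeomorph.subRight (s • v))
      rw [this]
      intro p hp
      have : p - s • v ∈ halfSpace := h3 hp
      have : 0 < p.2 - s := by simpa [halfSpace, hv] using this
      exact hs.trans_lt (sub_pos.1 this)
    have := h _ hc (hsub s) ht
    simp only [smul_zero, integral_zero, neg_zero] at this
    simp_rw [neg_smul]
    rw [integral_neg, neg_eq_zero, ← this]
    congr 1 with p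
    rw [fderiv_comp_sub]
  have hconst : ∀ n : ℕ, I n = I 0 := fun n =>
    constant_of_has_deriv_right_zero (a := 0) (b := n)
      (fun s hs => (hder0 s hs.1).continuousAt.continuousWithinAt)
      (fun s hs => (hder0 s hs.1).hasDerivWithinAt) n ⟨n.cast_nonneg, le_rfl⟩
  -- the mass of `χ` above height `n` bounds the integral against the test function moved up by `n`
  set B : ℕ → ENNReal := fun n => ∫⁻ p, ({p : E3 × ℝ | (n : ℝ) < p.2}.indicator
    (fun p => ‖χ p‖ₑ) p) ^ 2 ∂halfVolume with hB
  have hmS : ∀ n : ℕ, MeasurableSet {p : E3 × ℝ | (n : ℝ) < p.2} := fun n =>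
    measurableSet_lt measurable_const measurable_snd
  have hbound : ∀ n : ℕ, ‖I 0‖ₑ ^ 2 ≤ (∫⁻ p, ‖φ p‖ₑ ^ 2) * B n := by
    intro n
    rw [← hconst n]
    have b1 : ‖I n‖ₑ ≤ ∫⁻ p, ‖φ (p - (n : ℝ) • v)‖ₑ
        * {p : E3 × ℝ | (n : ℝ) < p.2}.indicator (fun p => ‖χ p‖ₑ) p ∂halfVolume := by
      refine (enorm_integral_le_lintegral_enorm _).trans (lintegral_mono fun p => ?_)
      rw [enorm_smul]
      by_cases hp : φ (p - (n : ℝ) • v) = 0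
      · simp [hp]
      · have : p ∈ {p : E3 × ℝ | (n : ℝ) < p.2} := hsupp n n.cast_nonneg p hp
        rw [indicator_of_mem this]
    have hm1 : AEMeasurable (fun p => ‖φ (p - (n : ℝ) • v)‖ₑ) halfVolume :=
      (h1.continuous.comp (by fun_prop :
        Continuous fun p : E3 × ℝ => p - (n : ℝ) • v)).measurable.enorm.aemeasurable
    refine (pow_le_pow_left₀ bot_le b1 2).trans ((lintegral_mul_sq_le hm1
      (hχm.enorm.indicator (hmS n))).trans (mul_le_mul' ?_ le_rfl))
    have : (volume : Measure (E3 × ℝ)).IsAddRightInvariant :=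
      inferInstanceAs ((volume : Measure E3).prod (volume : Measure ℝ)).IsAddRightInvariant
    calc _ ≤ ∫⁻ p, ‖φ (p - (n : ℝ) • v)‖ₑ ^ 2 := setLIntegral_le_lintegral _ _
      _ = _ := lintegral_sub_right_eq_self (fun p => ‖φ p‖ₑ ^ 2) ((n : ℝ) • v)
  have hχ2 := (memLp_two_iff_lintegral hχm).1 hχ
  have hB0 : Tendsto B atTop (𝓝 0) := by
    have := tendsto_lintegral_of_dominated_convergence' (μ := halfVolume)
      (F := fun (n : ℕ) p => ({p : E3 × ℝ | (n : ℝ) < p.2}.indicator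
        (fun p => ‖χ p‖ₑ) p) ^ 2) (f := fun _ => 0) (fun p => ‖χ p‖ₑ ^ 2)
      (fun n => (hχm.enorm.indicator (hmS n)).pow_const 2)
      (fun n => Eventually.of_forall fun p => by
        by_cases hp : p ∈ {p : E3 × ℝ | (n : ℝ) < p.2} <;> simp [hp])
      hχ2.ne (Eventually.of_forall fun p => by
        obtain ⟨N, hN⟩ := exists_nat_ge p.2
        refine tendsto_const_nhds.congr' ?_
        filter_upwards [eventually_ge_atTop N] with n hn
        have : p ∉ {p : E3 × ℝ | (n : ℝ) < p.2} := by
          have : (N : ℝ) ≤ n := by exact_mod_cast hn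
          simp only [mem_ofPred_eq, not_lt]
          linarith
        rw [indicator_of_notMem this]
        simp)
    simpa using this
  have hφ2 : ∫⁻ p, ‖φ p‖ₑ ^ 2 ≠ ⊤ := by
    have hm : MemLp (fun p => (φ p : ℂ)) 2 (volume : Measure (E3 × ℝ)) :=
      (Complex.continuous_ofReal.comp h1.continuous).memLp_of_hasCompactSupport
        (h2.comp_left (g := fun r : ℝ => (r : ℂ)) rfl)
    have := ((memLp_two_iff_lintegral hm.1).1 hm).ne
    simpa only [← ofReal_norm, Complex.norm_real] using this
  have hlim : Tendsto (fun n => (∫⁻ p, ‖φ p‖ₑ ^ 2) * B n) atTop (𝓝 0) := by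
    simpa using ENNReal.Tendsto.const_mul hB0 (Or.inr hφ2)
  have hz : ‖I 0‖ₑ ^ 2 = 0 := le_antisymm (ge_of_tendsto' hlim hbound) bot_le
  have hz' : I 0 = 0 := by simpa using hz
  simpa [hI] using hz'

end

/-! ### Completing the square -/

theorem integral_conj_mul_self {α : Type*} [MeasurableSpace α] {μ : Measure α} (f : α → ℂ) :
    ∫ x, conj (f x) * f x ∂μ = ((∫ x, ‖f x‖ ^ 2 ∂μ : ℝ) : ℂ) := by
  rw [← integral_complex_ofReal]
  congr 1 with x
  rw [mul_comm, Complex.mul_conj, Complex.normSq_eq_norm_sq]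

theorem integral_norm_sub_sq {α : Type*} [MeasurableSpace α] {μ : Measure α} {f g : α → ℂ}
    (hf : MemLp f 2 μ) (hg : MemLp g 2 μ) :
    ∫ x, ‖f x - g x‖ ^ 2 ∂μ = (∫ x, ‖f x‖ ^ 2 ∂μ) + (∫ x, ‖g x‖ ^ 2 ∂μ)
      - 2 * (∫ x, conj (g x) * f x ∂μ).re := by
  have i1 := (memLp_two_iff_integrable_sq_norm hf.1).1 hf
  have i2 := (memLp_two_iff_integrable_sq_norm hg.1).1 hg
  have i3 : Integrable (fun x => conj (g x) * f x) μ := hg.star.integrable_mul hf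
  have i12 : Integrable (fun x => ‖f x‖ ^ 2 + ‖g x‖ ^ 2) μ := i1.add i2
  have i4 : Integrable (fun x => 2 * (conj (g x) * f x).re) μ := i3.re.const_mul 2
  have e : ∀ x, ‖f x - g x‖ ^ 2 = ‖f x‖ ^ 2 + ‖g x‖ ^ 2 - 2 * (conj (g x) * f x).re := fun x => by
    rw [← Complex.normSq_eq_norm_sq, Complex.normSq_sub, ← Complex.normSq_eq_norm_sq,
      ← Complex.normSq_eq_norm_sq, mul_comm (conj (g x))]
  simp_rw [e]
  rw [integral_sub i12 i4, integral_add i1 i2, integral_const_mul]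
  congr 2
  exact integral_re i3

namespace IsPositiveSolution

variable {u : E3 → ℝ}

theorem integrable_phi_sub_one_mul (hu : IsPositiveSolution u) {f : E3 → ℂ}
    (hf : MemLp f 2 volume) :
    Integrable (fun x => (Phi u x - 1) * ‖f x‖ ^ 2) ∧
    ∫ x, (Phi u x - 1) * ‖f x‖ ^ 2
      = gap u * (∫ x, ‖f x‖ ^ 2) - ∫ x, potential u x * ‖f x‖ ^ 2 := by
  have i1 := ((memLp_two_iff_integrable_sq_norm hf.1).1 hf).const_mul (gap u)
  have i2 := hu.integrable_potential_mul_sq hf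
  have e : (fun x => gap u * ‖f x‖ ^ 2 - potential u x * ‖f x‖ ^ 2)
      =ᵐ[volume] fun x => (Phi u x - 1) * ‖f x‖ ^ 2 := by
    filter_upwards [hu.ae_phi_sub_one] with x hx
    rw [hx]
    ring
  refine ⟨(i1.sub i2).congr e, ?_⟩
  rw [← integral_congr_ae e, integral_sub i1 i2, integral_const_mul]

/-- Completing the square. With `f` the trace of `ψ`, `a = (√(-Δ) + κ)⁻¹ V f` and `Θ` the harmonic
extension of `a`, the quadratic form is the sum of `∬ |∇(ψ - Θ)|²`, `κ ∫ |f - a|²` and the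
defect in the Birman–Schwinger inequality for `f`. -/
theorem quadForm_eq (hu : IsPositiveSolution u) {ψ : E3 × ℝ → ℂ} (hψ : MemH1 ψ)
    {f a H : E3 → ℂ} (hf : IsTrace ψ f) (hHm : StronglyMeasurable H)
    (hH : IsFourierPair (fun x => (potential u x : ℂ) * f x) H)
    (ha : IsFourierPair a (resolventSymbol (gap u) H)) :
    quadForm u ψ = (∑ o, ∫ p, ‖weakDeriv (axis o) ψ p
          - synth (fun ξ => phase ξ (axis o) * resolventSymbol (gap u) H ξ) p‖ ^ 2 ∂halfVolume)
      + gap u * (∫ x, ‖f x - a x‖ ^ 2)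
      + ((∫ x, potential u x * ‖f x‖ ^ 2)
        - (∫ ξ, conj (H ξ) * resolventSymbol (gap u) H ξ).re) := by
  have hκ := hu.gap_pos
  set c := resolventSymbol (gap u) H with hc
  obtain ⟨F, -, hF⟩ := IsFourierPair.exists_right hf.1
  have hcm : StronglyMeasurable c := stronglyMeasurable_resolventSymbol hHm
  have hc2 : MemLp c 2 volume := ha.memLp_right
  have hc1 := memLp_norm_mul_resolventSymbol hκ hH.memLp_right
  have hfin := lintegral_norm_mul_resolventSymbol_lt_top hκ hH.memLp_right
  have hns := hu.synthNormSq_lt_top hf.1 hH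
  have hΘ := memH1_synth hcm ha hns hfin
  have hΘt := isTrace_synth hcm ha hns hfin
  have hd : Damped c := damped_of_memLp hcm hc2
  set g : Option (Fin 3) → E3 × ℝ → ℂ := fun o => weakDeriv (axis o) ψ with hg
  set G : Option (Fin 3) → E3 × ℝ → ℂ := fun o => synth fun ξ => phase ξ (axis o) * c ξ with hGd
  have hg2 : ∀ o, MemLp (g o) 2 halfVolume := fun o => (hψ.weakDeriv_spec (axis o)).1
  have hG2 : ∀ o, MemLp (G o) 2 halfVolume := fun o => memLp_synth_phase hd hfin (axis o)
  have hGw : ∀ o, weakDeriv (axis o) (synth c) =ᵐ[halfVolume] G o := fun o =>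
    weakDeriv_ae_eq (isWeakDeriv_synth hcm ha hns hfin (axis o)) (hG2 o)
  -- the two Dirichlet pairings, reduced to the boundary
  have k1 : ∑ o, ∫ p, conj (G o p) * g o p ∂halfVolume
      = ∫ ξ, conj (((2 * Real.pi * ‖ξ‖ : ℝ) : ℂ) * c ξ) * F ξ :=
    sum_integral_conj_synth hψ hf hF hcm hc2 hc1 hfin
  have k2 : ∑ o, ((∫ p, ‖G o p‖ ^ 2 ∂halfVolume : ℝ) : ℂ)
      = ∫ ξ, conj (((2 * Real.pi * ‖ξ‖ : ℝ) : ℂ) * c ξ) * c ξ := by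
    rw [← sum_integral_conj_synth hΘ hΘt ha hcm hc2 hc1 hfin]
    refine Finset.sum_congr rfl fun o _ => ?_
    rw [← integral_conj_mul_self]
    refine integral_congr_ae ?_
    filter_upwards [hGw o] with p hp
    rw [hp]
  have k3 : ∫ x, conj (a x) * f x = ∫ ξ, conj (c ξ) * F ξ := ha.integral_conj_mul hF
  have k4 : ((∫ x, ‖a x‖ ^ 2 : ℝ) : ℂ) = ∫ ξ, conj (c ξ) * c ξ := by
    rw [← integral_conj_mul_self, ha.integral_conj_mul ha]
  have k5 : ((∫ x, potential u x * ‖f x‖ ^ 2 : ℝ) : ℂ) = ∫ ξ, conj (H ξ) * F ξ := by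
    rw [← hH.integral_conj_mul hF, ← integral_complex_ofReal]
    congr 1 with x
    rw [map_mul, Complex.conj_ofReal, mul_assoc, mul_comm (conj (f x)), Complex.mul_conj,
      Complex.normSq_eq_norm_sq, Complex.ofReal_mul]
  -- pairings with `H = (2π|ξ| + κ) c`, the equation for `a`
  have hsplit : ∀ K : E3 → ℂ, MemLp K 2 volume → ∫ ξ, conj (H ξ) * K ξ
      = (∫ ξ, conj (((2 * Real.pi * ‖ξ‖ : ℝ) : ℂ) * c ξ) * K ξ)
        + (gap u : ℂ) * ∫ ξ, conj (c ξ) * K ξ := by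
    intro K hK
    have i1 : Integrable fun ξ => conj (((2 * Real.pi * ‖ξ‖ : ℝ) : ℂ) * c ξ) * K ξ :=
      hc1.star.integrable_mul hK
    have i2 : Integrable fun ξ => conj (c ξ) * K ξ := hc2.star.integrable_mul hK
    rw [← integral_const_mul, ← integral_add i1 (i2.const_mul _)]
    congr 1 with ξ
    rw [← symbol_mul_resolventSymbol (H := H) hκ ξ, ← hc]
    simp only [map_mul, Complex.conj_ofReal]
    push_cast
    ring
  -- pair with the transforms of `f` and of `a`, and collect terms
  have s1 := congrArg Complex.re (hsplit F hF.memLp_right)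
  have s2 := congrArg Complex.re (hsplit c hc2)
  have hSH : (∫ ξ, conj (H ξ) * c ξ).re = (∫ ξ, conj (H ξ) * resolventSymbol (gap u) H ξ).re := rfl
  rw [← k1, ← k3, ← k5, Complex.ofReal_re, Complex.add_re, Complex.re_ofReal_mul,
    Complex.re_sum] at s1
  rw [← k2, ← k4, Complex.add_re, Complex.re_ofReal_mul, Complex.re_sum] at s2
  simp only [Complex.ofReal_re] at s2
  have e1 : ∫ p, gradSq ψ p ∂halfVolume = ∑ o, ∫ p, ‖g o p‖ ^ 2 ∂halfVolume := by
    rw [← integral_finsetSum _ fun o _ => (memLp_two_iff_integrable_sq_norm (hg2 o).1).1 (hg2 o)]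
    congr 1 with p
    exact gradSq_eq ψ p
  have htr := hψ.isTrace_trace.ae_eq hf
  have e2 : ∫ x, (Phi u x - 1) * ‖trace ψ x‖ ^ 2
      = gap u * (∫ x, ‖f x‖ ^ 2) - ∫ x, potential u x * ‖f x‖ ^ 2 := by
    rw [← (hu.integrable_phi_sub_one_mul hf.1).2]
    refine integral_congr_ae ?_
    filter_upwards [htr] with x hx
    rw [hx]
  have e3 : ∑ o, ∫ p, ‖g o p - G o p‖ ^ 2 ∂halfVolume
      = (∑ o, ∫ p, ‖g o p‖ ^ 2 ∂halfVolume) + (∑ o, ∫ p, ‖G o p‖ ^ 2 ∂halfVolume)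
        - 2 * ∑ o, (∫ p, conj (G o p) * g o p ∂halfVolume).re := by
    simp_rw [integral_norm_sub_sq (hg2 _) (hG2 _)]
    rw [Finset.sum_sub_distrib, Finset.sum_add_distrib, Finset.mul_sum]
  have e4 := integral_norm_sub_sq hf.1 ha.memLp_left
  rw [quadForm, e1, e2, e3, e4]
  linarith

/-- For `f ∈ L²`, the harmonic extension of `a = (√(-Δ) + κ)⁻¹ V f` lies in `H¹` and has trace
`a`. -/
theorem memH1_synth_resolventSymbol (hu : IsPositiveSolution u) {f a H : E3 → ℂ}
    (hf : MemLp f 2 volume) (hHm : StronglyMeasurable H)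
    (hH : IsFourierPair (fun x => (potential u x : ℂ) * f x) H)
    (ha : IsFourierPair a (resolventSymbol (gap u) H)) :
    MemH1 (synth (resolventSymbol (gap u) H)) ∧ IsTrace (synth (resolventSymbol (gap u) H)) a ∧
    ∀ v, MemLp (synth fun ξ => phase ξ v * resolventSymbol (gap u) H ξ) 2 halfVolume ∧
      IsWeakDeriv v (synth (resolventSymbol (gap u) H))
        (synth fun ξ => phase ξ v * resolventSymbol (gap u) H ξ) := by
  have hcm : StronglyMeasurable (resolventSymbol (gap u) H) :=
    stronglyMeasurable_resolventSymbol hHm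
  have hfin := lintegral_norm_mul_resolventSymbol_lt_top hu.gap_pos hH.memLp_right
  have hns := hu.synthNormSq_lt_top hf hH
  exact ⟨memH1_synth hcm ha hns hfin, isTrace_synth hcm ha hns hfin, fun v =>
    ⟨memLp_synth_phase (damped_of_memLp hcm ha.memLp_right) hfin v,
      isWeakDeriv_synth hcm ha hns hfin v⟩⟩

theorem resolventSymbol_const_mul (κ : ℝ) (c : ℂ) (H : E3 → ℂ) :
    resolventSymbol κ (fun ξ => c * H ξ) = fun ξ => c * resolventSymbol κ H ξ := by
  ext ξ
  simp only [resolventSymbol]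
  ring

theorem synth_const_mul (c : ℂ) (F : E3 → ℂ) (p : E3 × ℝ) :
    synth (fun ξ => c * F ξ) p = c * synth F p := by
  rw [synth, synth, ← integral_const_mul]
  congr 1 with ξ
  ring

theorem synth_congr {F G : E3 → ℂ} (h : F =ᵐ[volume] G) (p : E3 × ℝ) : synth F p = synth G p := by
  refine integral_congr_ae ?_
  filter_upwards [h] with ξ hξ
  rw [hξ]

/-- The harmonic extension of `u` in terms of the Fourier transform of `V u`. -/
theorem harmonicExtension_ae_eq (hu : IsPositiveSolution u) {H : E3 → ℂ}
    (hH : IsFourierPair (fun x => (potential u x : ℂ) * (u x : ℂ)) H) :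
    (fun p => (harmonicExtension u p : ℂ)) =ᵐ[halfVolume] synth (resolventSymbol (gap u) H) := by
  filter_upwards [ae_mem_halfSpace] with p hp
  exact harmonicExtension_eq_synth (hu.isFourierPair_resolventSymbol hH) hp p.1

theorem memH1_harmonicExtension (hu : IsPositiveSolution u) :
    MemH1 fun p => (harmonicExtension u p : ℂ) := by
  obtain ⟨H, hHm, hH⟩ := IsFourierPair.exists_right (hu.memLp_potential_mul hu.memLp)
  exact (hu.memH1_synth_resolventSymbol hu.memLp hHm hH
    (hu.isFourierPair_resolventSymbol hH)).1.congr (hu.harmonicExtension_ae_eq hH).symm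

/-- The form is a sum of three nonnegative terms. If it vanishes, then `ψ - Θ` is constant in `t`, hence
zero, while `f = a` and `f` is a multiple of `u`, so that `Θ` is a multiple of the harmonic extension
of `u`. -/
theorem quadForm_nonneg (hu : IsPositiveSolution u) {ψ : E3 × ℝ → ℂ} (hψ : MemH1 ψ) :
    0 ≤ quadForm u ψ ∧ (quadForm u ψ = 0 →
      ∃ c : ℂ, ∀ᵐ p ∂halfVolume, ψ p = c * (harmonicExtension u p : ℂ)) := by
  have hκ := hu.gap_pos
  have hf := hψ.isTrace_trace
  set f := trace ψ
  obtain ⟨H, hHm, hH⟩ := IsFourierPair.exists_right (hu.memLp_potential_mul hf.1)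
  obtain ⟨a, ha⟩ := IsFourierPair.exists_left (memLp_resolventSymbol hκ hH.memLp_right)
  obtain ⟨hle, heq⟩ := hu.resolvent_form_le hf.1 hH
  have hid := hu.quadForm_eq hψ hf hHm hH ha
  set c := resolventSymbol (gap u) H with hc
  obtain ⟨hΘ, hΘt, hΘd⟩ := hu.memH1_synth_resolventSymbol hf.1 hHm hH ha
  have n1 : ∀ o, 0 ≤ ∫ p, ‖weakDeriv (axis o) ψ p
      - synth (fun ξ => phase ξ (axis o) * c ξ) p‖ ^ 2 ∂halfVolume := fun o =>
    integral_nonneg fun p => by positivity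
  have n1' := Finset.sum_nonneg fun o (_ : o ∈ Finset.univ) => n1 o
  have n2 : 0 ≤ ∫ x, ‖f x - a x‖ ^ 2 := integral_nonneg fun x => by positivity
  have n2' := mul_nonneg hκ.le n2
  refine ⟨by rw [hid]; linarith, fun h0 => ?_⟩
  rw [hid] at h0
  have z1 : ∑ o, ∫ p, ‖weakDeriv (axis o) ψ p
      - synth (fun ξ => phase ξ (axis o) * c ξ) p‖ ^ 2 ∂halfVolume = 0 := by linarith
  have z2 : gap u * ∫ x, ‖f x - a x‖ ^ 2 = 0 := by linarith
  obtain ⟨l, hl⟩ := heq (by linarith)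
  have z1' := (Finset.sum_eq_zero_iff_of_nonneg fun o _ => n1 o).1 z1 none (Finset.mem_univ _)
  have hdiff : ∀ {α : Type} [MeasurableSpace α] {μ : Measure α} {p q : α → ℂ}, MemLp p 2 μ →
      MemLp q 2 μ → ∫ x, ‖p x - q x‖ ^ 2 ∂μ = 0 → p =ᵐ[μ] q := by
    intro α _ μ p q hp hq h
    have := (integral_eq_zero_iff_of_nonneg (fun x => by positivity)
      ((memLp_two_iff_integrable_sq_norm (hp.sub hq).1).1 (hp.sub hq))).1 h
    filter_upwards [this] with x hx
    have hx : ‖p x - q x‖ ^ 2 = 0 := hx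
    exact sub_eq_zero.1 (by simpa using hx)
  have hψd := hψ.weakDeriv_spec (axis none)
  have hgrad := hdiff hψd.1 (hΘd (axis none)).1 z1'
  have hfa := hdiff hf.1 ha.memLp_left ((mul_eq_zero.1 z2).resolve_left hκ.ne')
  -- `ψ - Θ` is constant in `t`
  have hzero : (fun p => ψ p - synth c p) =ᵐ[halfVolume] fun _ => 0 := by
    refine ae_eq_zero_of_isWeakDeriv_zero (hψ.1.sub hΘ.1) fun φ h1 h2 h3 => ?_
    refine (IsWeakDeriv.sub hψ.1 hΘ.1 hψd.1 (hΘd (axis none)).1 hψd.2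
      (hΘd (axis none)).2 φ h1 h2 h3).trans ?_
    congr 1
    refine integral_congr_ae ?_
    filter_upwards [hgrad] with p hp
    rw [hp, sub_self]
  obtain ⟨Hu, -, hHu⟩ := IsFourierPair.exists_right (hu.memLp_potential_mul hu.memLp)
  have hcu : c =ᵐ[volume] fun ξ => l * resolventSymbol (gap u) Hu ξ := by
    refine ha.right_unique ((hu.isFourierPair_resolventSymbol hHu).const_mul l) ?_
    filter_upwards [hfa, hl] with x h1 h2
    rw [← h1, h2]
  refine ⟨l, ?_⟩
  filter_upwards [hzero, hu.harmonicExtension_ae_eq hHu] with p h1 h2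
  rw [sub_eq_zero.1 h1, synth_congr hcu, synth_const_mul, h2]

/-- For `ψ = l U` the three terms of the completed square vanish. -/
theorem quadForm_const_mul_harmonicExtension (hu : IsPositiveSolution u) {ψ : E3 × ℝ → ℂ} {l : ℂ}
    (h : ∀ᵐ p ∂halfVolume, ψ p = l * (harmonicExtension u p : ℂ)) : quadForm u ψ = 0 := by
  obtain ⟨H, hHm, hH⟩ := IsFourierPair.exists_right (hu.memLp_potential_mul hu.memLp)
  have hlH : IsFourierPair (fun x => (potential u x : ℂ) * (l * (u x : ℂ))) fun ξ => l * H ξ := by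
    refine (hH.const_mul l).congr (Eventually.of_forall fun x => ?_) (EventuallyEq.refl _ _)
    ring
  have hlm : StronglyMeasurable fun ξ => l * H ξ := hHm.const_mul l
  have ha : IsFourierPair (fun x => l * (u x : ℂ)) (resolventSymbol (gap u) fun ξ => l * H ξ) := by
    rw [resolventSymbol_const_mul]
    exact (hu.isFourierPair_resolventSymbol hH).const_mul l
  obtain ⟨hΘ, hΘt, hΘd⟩ := hu.memH1_synth_resolventSymbol (hu.memLp.const_mul l) hlm hlH ha
  have hψ : ψ =ᵐ[halfVolume] synth (resolventSymbol (gap u) fun ξ => l * H ξ) := by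
    filter_upwards [h, hu.harmonicExtension_ae_eq hH] with p h1 h2
    rw [h1, h2, resolventSymbol_const_mul, synth_const_mul]
  rw [quadForm_congr u hψ, hu.quadForm_eq hΘ hΘt hlm hlH ha]
  have e1 : ∀ o, ∫ p, ‖weakDeriv (axis o) (synth (resolventSymbol (gap u) fun ξ => l * H ξ)) p
      - synth (fun ξ => phase ξ (axis o) * resolventSymbol (gap u) (fun ξ => l * H ξ) ξ) p‖ ^ 2
      ∂halfVolume = 0 := by
    intro o
    refine integral_eq_zero_of_ae ?_
    filter_upwards [weakDeriv_ae_eq (hΘd (axis o)).2 (hΘd (axis o)).1] with p hp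
    rw [hp]
    simp
  have e2 : ∫ x, potential u x * ‖l * (u x : ℂ)‖ ^ 2
      = (∫ ξ, conj (l * H ξ) * resolventSymbol (gap u) (fun ξ => l * H ξ) ξ).re := by
    rw [← hlH.integral_conj_mul ha, ← Complex.ofReal_re (∫ x, _), ← integral_complex_ofReal]
    congr 2 with x
    rw [map_mul, Complex.conj_ofReal, mul_assoc, mul_comm (conj _), Complex.mul_conj,
      Complex.normSq_eq_norm_sq, Complex.ofReal_mul]
  simp only [e1, e2, sub_self]
  simp

end IsPositiveSolution

end BosonStar

theorem proposition1 (w : BosonStar.E3 → ℝ) (hw : BosonStar.IsGroundState w)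
    (hpos : ∀ᵐ x, 0 < w x) (hrad : BosonStar.IsRadial w)
    (e : ℝ) (he : e = BosonStar.scale w)
    (u : BosonStar.E3 → ℝ) (hu : u = BosonStar.rescale e w)
    (U : BosonStar.E3 × ℝ → ℝ) (hU : U = BosonStar.harmonicExtension u) :
    0 < e ∧ BosonStar.SolvesNormalized u ∧ BosonStar.MemH1 (fun p => (U p : ℂ)) ∧
    ∀ ψ : BosonStar.E3 × ℝ → ℂ, BosonStar.MemH1 ψ →
      BosonStar.IsTrace ψ (BosonStar.trace ψ) ∧
      Integrable (fun x => (BosonStar.Phi u x - 1) * ‖BosonStar.trace ψ x‖ ^ 2) ∧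
      0 ≤ BosonStar.quadForm u ψ ∧
      (BosonStar.quadForm u ψ = 0 ↔
        ∃ c : ℂ, ∀ᵐ p ∂BosonStar.halfVolume, ψ p = c * (U p : ℂ)) := by
  obtain ⟨he0, hsol⟩ := hw.isPositiveSolution_rescale hpos hrad
  rw [← he] at he0
  rw [← he, ← hu] at hsol
  subst hU
  refine ⟨he0, hsol.solves, hsol.memH1_harmonicExtension, fun ψ hψ => ?_⟩
  obtain ⟨h1, h2⟩ := hsol.quadForm_nonneg hψ
  exact ⟨hψ.isTrace_trace, (hsol.integrable_phi_sub_one_mul hψ.isTrace_trace.1).1, h1, h2,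
    fun ⟨c, hc⟩ => hsol.quadForm_const_mul_harmonicExtension hc⟩
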